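/- **Setting.** Let $M$ be a compact, simply connected (in particular connected) smooth manifold without boundary. Let $(D,g)$ be a sub-Riemannian structure on $M$: $D\subseteq TM$ is a smooth bracket-generating subbundle ($D=TM$ is allowed) and $g$ is a smooth metric tensor on $D$. Let $d\mu$ be a smooth positive volume density on $M$. Write $\sharp^g:T^*M\to D$ for the map given by $\beta(v)=\langle\sharp^g\beta,v\rangle_g$, $v\in D$; $\operatorname{div}_\mu$ for the divergence with respect to $d\mu$; $\Delta_{g,\mu}\phi=\operatorname{div}_\mu(\sharp^g d\phi)$ for the sub-Laplacian, extended complex-linearly to complex-valued functions; and $\operatorname{tr}_g\xi(\times,\times)=\sum_i\xi(v_i,v_i)$ for an orthonormal basis $v_i$ of $D_x$. Let $\nabla$ be any smooth affine connection on $TM$ compatible with $(D,g,d\mu)$: $\nabla$ preserves sections of $D$, is metric for $g$ on $D$, and $\operatorname{tr}_g\nabla_\times d\phi(\times)=\Delta_{g,\mu}\phi$ for all smooth $\phi$. Let $G$ be a Lie group with Lie algebra $\mathfrak g$ and left Maurer–Cartan form $\omega$, let $\mathfrak e\subseteq\mathfrak g$ be a subspace with an inner product, and let $\sharp:\mathfrak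 g^*\to\mathfrak e$ be defined by $\langle\sharp\beta,w\rangle=\beta(w)$ for $w\in\mathfrak e$. A smooth map $f:M\to G$ is *horizontal* if its Darboux derivative $\alpha_f=f^*\omega$ satisfies $\alpha_f(D)\subseteq\mathfrak e$. Let $\overline{\mathcal A}$ be the closure in $L^2\Omega^1(M,\mathfrak g)$ of the set of Darboux derivatives of horizontal maps, and for $\alpha\in\overline{\mathcal A}$ let $\hat{\mathscr E}(\alpha)=\frac12\int_M\operatorname{tr}_g\langle\alpha(\times),\alpha(\times)\rangle\,d\mu$. A horizontal map $f$ is *harmonic* if $\frac{d}{ds}\hat{\mathscr E}(\alpha_s)|_{s=0}=0$ for every ($L^2$-)differentiable curve $(-\varepsilon,\varepsilon)\to\overline{\mathcal A}$, $s\mapsto\alpha_s$, with $\alpha_0=\alpha_f$. It is *normal harmonic* if it is harmonic and there is a smooth $\lambda\in\Omega^1(M,\mathfrak g^*)$ with $\sharp\lambda|_D=\alpha_f|_D$ and $$\delta_D\lambda-\operatorname{tr}_g\operatorname{ad}^*(\alpha_f(\times))\lambda(\times)=0,\qquad \delta_D\lambda=-\operatorname{tr}_g\nabla_\times\lambda(\times),\qquad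 (\operatorname{ad}^*(A)\beta)(B)=-\beta([A,B]).$$ Let $H^n=\mathbb R^{2n+1}$ be the Heisenberg group with coordinates $(a,b,c)$, product $$(a,b,c)\cdot(\tilde a,\tilde b,\tilde c)=\bigl(a+\tilde a,\;b+\tilde b,\;c+\tilde c+\tfrac12(\langle a,\tilde b\rangle-\langle\tilde a,b\rangle)\bigr),$$ and the left-invariant structure for which $A_j=\partial_{a_j}-\frac12b_j\partial_c$, $B_j=\partial_{b_j}+\frac12a_j\partial_c$ $(1\le j\le n)$ are an orthonormal basis. **Proposition 4.6.** Let $f:M\to H^n$ be a horizontal map, write $(u,v,w)=(a,b,c)\circ f$ and $\zeta=u+iv:M\to\mathbb C^n$. Then $f$ is normal harmonic if and only if there is a smooth horizontal vector field $Y$ on $M$ (a section of $D$) with $\operatorname{div}_\mu Y=0$ such that $$(\Delta_{g,\mu}-iY)\zeta=0\quad\text{on } M.$$ -/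

import Mathlib

open scoped Manifold ContDiff Topology Bundle

namespace SubRiem

noncomputable section

/-! ### Fibrewise linear algebra -/

/-- `e` is an orthonormal basis of the subspace `W` for the bilinear form `B` on `W`. -/
def IsOrthonormalBasisOf {V : Type*} [AddCommGroup V] [Module ℝ V] {k : ℕ}
    (W : Submodule ℝ V) (B : W →ₗ[ℝ] W →ₗ[ℝ] ℝ) (e : Fin k → V) : Prop :=
  (∃ he : ∀ i, e i ∈ W, ∀ i j, B ⟨e i, he i⟩ ⟨e j, he j⟩ = if i = j then 1 else 0) ∧
    Submodule.span ℝ (Set.range e) = W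

/-! ### Vector fields, one-forms, sub-Riemannian structures

Manifolds are smooth, of dimension `m`, without boundary. -/

section Manifold

variable {m : ℕ} {M : Type*} [TopologicalSpace M] [ChartedSpace (EuclideanSpace ℝ (Fin m)) M]

variable (m M) in
/-- Not necessarily continuous vector fields on `M`. -/
abbrev VField : Type _ := (x : M) → TangentSpace (𝓡 m) x

variable (m M) in
/-- Not necessarily continuous real one-forms on `M`. -/
abbrev Form1 : Type _ := (x : M) → (TangentSpace (𝓡 m) x →L[ℝ] ℝ)

section

variable [IsManifold (𝓡 m) ∞ M]

/-- The vector field `X` is smooth on the set `U`. -/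
def SmoothFieldOn (X : VField m M) (U : Set M) : Prop :=
  ContMDiffOn (𝓡 m) (𝓡 m).tangent ∞ (fun x => (⟨x, X x⟩ : TangentBundle (𝓡 m) M)) U

/-- The vector field `X` is smooth. -/
def SmoothField (X : VField m M) : Prop :=
  ContMDiff (𝓡 m) (𝓡 m).tangent ∞ (fun x => (⟨x, X x⟩ : TangentBundle (𝓡 m) M))

/-- The real one-form `β` is smooth, as a section of `Hom(TM, ℝ)`. -/
def SmoothForm1 (β : Form1 m M) : Prop :=
  ContMDiff (𝓡 m) ((𝓡 m).prod 𝓘(ℝ, EuclideanSpace ℝ (Fin m) →L[ℝ] ℝ)) ∞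
    (fun x => (⟨x, β x⟩ : Bundle.TotalSpace (EuclideanSpace ℝ (Fin m) →L[ℝ] ℝ)
      (fun x : M => TangentSpace (𝓡 m) x →L[ℝ] Bundle.Trivial M ℝ x)))

/-- The vector fields obtained from smooth sections of `D` by iterated Lie brackets. -/
inductive IterBracket (D : (x : M) → Submodule ℝ (TangentSpace (𝓡 m) x)) : VField m M → Prop
  | base (X : VField m M) (hX : SmoothField X) (hD : ∀ x, X x ∈ D x) : IterBracket D X
  | bracket (V W : VField m M) (hV : IterBracket D V) (hW : IterBracket D W) :
      IterBracket D (VectorField.mlieBracket (𝓡 m) V W)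

variable (m M) in
/-- A sub-Riemannian structure `(D, g)` on `M`. That `D` is a smooth subbundle of `TM` of rank
`rank` and that the metric tensor `g` on `D` is smooth is expressed by the existence of smooth
local orthonormal frames. -/
structure SubRiemannianStructure where
  rank : ℕ
  D : (x : M) → Submodule ℝ (TangentSpace (𝓡 m) x)
  g : (x : M) → D x →ₗ[ℝ] D x →ₗ[ℝ] ℝ
  g_symm : ∀ x v w, g x v w = g x w v
  g_pos : ∀ x v, v ≠ 0 → 0 < g x v v
  exists_frame : ∀ x, ∃ U ∈ 𝓝 x, ∃ X : Fin rank → VField m M,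
    (∀ i, SmoothFieldOn (X i) U) ∧ ∀ y ∈ U, IsOrthonormalBasisOf (D y) (g y) (fun i => X i y)
  bracket_generating : ∀ x,
    Submodule.span ℝ {v : TangentSpace (𝓡 m) x | ∃ V, IterBracket D V ∧ V x = v} = ⊤

namespace SubRiemannianStructure

variable (S : SubRiemannianStructure m M)

theorem exists_onb (x : M) : ∃ e : Fin S.rank → TangentSpace (𝓡 m) x,
    IsOrthonormalBasisOf (S.D x) (S.g x) e := by
  obtain ⟨U, hU, X, -, h⟩ := S.exists_frame x
  exact ⟨_, h x (mem_of_mem_nhds hU)⟩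

/-- An (arbitrarily chosen) orthonormal basis of `D x`. -/
def onb (x : M) : Fin S.rank → TangentSpace (𝓡 m) x := (S.exists_onb x).choose

theorem onb_spec (x : M) : IsOrthonormalBasisOf (S.D x) (S.g x) (S.onb x) :=
  (S.exists_onb x).choose_spec

theorem onb_mem (x : M) (i : Fin S.rank) : S.onb x i ∈ S.D x := (S.onb_spec x).1.choose i

/-- The vector field `X` is a section of `D`. -/
def IsHorizontalField (X : VField m M) : Prop := ∀ x, X x ∈ S.D x

/-- The map `♯ : T*M → D`, characterized by `sharp_spec` below. -/
def sharp (x : M) (β : TangentSpace (𝓡 m) x →L[ℝ] ℝ) : TangentSpace (𝓡 m) x :=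
  ∑ i, β (S.onb x i) • S.onb x i

theorem sharp_mem (x : M) (β : TangentSpace (𝓡 m) x →L[ℝ] ℝ) : S.sharp x β ∈ S.D x :=
  Submodule.sum_mem _ fun i _ => Submodule.smul_mem _ _ (S.onb_mem x i)

theorem sharp_spec (x : M) (β : TangentSpace (𝓡 m) x →L[ℝ] ℝ) (v : S.D x) :
    S.g x ⟨S.sharp x β, S.sharp_mem x β⟩ v = β v := by
  obtain ⟨⟨he, hon⟩, hspan⟩ := S.onb_spec x
  have h1 : (⟨S.sharp x β, S.sharp_mem x β⟩ : S.D x)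
      = ∑ i, β (S.onb x i) • (⟨S.onb x i, he i⟩ : S.D x) := by
    ext
    simp [sharp]
  have h2 : (v : TangentSpace (𝓡 m) x) ∈ Submodule.span ℝ (Set.range (S.onb x)) := by
    rw [hspan]; exact v.2
  obtain ⟨c, hc⟩ := (Submodule.mem_span_range_iff_exists_fun ℝ).1 h2
  have h3 : v = ∑ i, c i • (⟨S.onb x i, he i⟩ : S.D x) := by
    ext
    simp [← hc]
  have h4 : β v = ∑ i, c i * β (S.onb x i) := by
    rw [← hc]; simp
  rw [h4, h1, h3]
  simp only [map_sum, LinearMap.sum_apply, map_smul, LinearMap.smul_apply, hon, smul_eq_mul]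
  simp

/-- The trace `tr_g ξ(×, ×)` at `x` of a two-tensor on `T_x M`. -/
def trace (x : M) (ξ : TangentSpace (𝓡 m) x → TangentSpace (𝓡 m) x → ℝ) : ℝ :=
  ∑ i, ξ (S.onb x i) (S.onb x i)

end SubRiemannianStructure

/-! ### Volume densities, divergence, sub-Laplacian -/

variable (m M) in
/-- A smooth volume density on `M`: a measure `μ` which, in the chart around each point `x`, has a
smooth positive density `ρ x` with respect to Lebesgue measure. -/
structure VolumeDensity [MeasurableSpace M] where
  μ : MeasureTheory.Measure M
  ρ : M → EuclideanSpace ℝ (Fin m) → ℝ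
  smooth : ∀ x, ContDiffOn ℝ ∞ (ρ x) (extChartAt (𝓡 m) x).target
  pos : ∀ x, ∀ y ∈ (extChartAt (𝓡 m) x).target, 0 < ρ x y
  map_chart : ∀ x, (μ.restrict (extChartAt (𝓡 m) x).source).map (extChartAt (𝓡 m) x) =
    (MeasureTheory.volume.restrict (extChartAt (𝓡 m) x).target).withDensity
      (fun y => ENNReal.ofReal (ρ x y))

/-- The expression of the vector field `X` in the chart around `x`. -/
def fieldInChart (x : M) (X : VField m M) (y : EuclideanSpace ℝ (Fin m)) :
    EuclideanSpace ℝ (Fin m) :=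
  mvfderiv (𝓡 m) (extChartAt (𝓡 m) x) ((extChartAt (𝓡 m) x).symm y)
    (X ((extChartAt (𝓡 m) x).symm y))

variable [MeasurableSpace M]

/-- The divergence `div_μ X`, computed at `x` by the formula `ρ⁻¹ ∑ᵢ ∂ᵢ (ρ Xⁱ)` in the chart
around `x`. -/
def VolumeDensity.div (vol : VolumeDensity m M) (X : VField m M) (x : M) : ℝ :=
  (vol.ρ x (extChartAt (𝓡 m) x x))⁻¹ *
    LinearMap.trace ℝ (EuclideanSpace ℝ (Fin m))
      (fderiv ℝ (fun y => vol.ρ x y • fieldInChart x X y) (extChartAt (𝓡 m) x x)).toLinearMap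

/-- The sub-Laplacian `Δ φ = div_μ (♯ dφ)`. -/
def subLaplacian (S : SubRiemannianStructure m M) (vol : VolumeDensity m M) (φ : M → ℝ) (x : M) :
    ℝ :=
  vol.div (fun y => S.sharp y (mvfderiv (𝓡 m) φ y)) x

/-- The sub-Laplacian extended complex-linearly to complex-valued functions. -/
def subLaplacianC (S : SubRiemannianStructure m M) (vol : VolumeDensity m M) (φ : M → ℂ) (x : M) :
    ℂ :=
  (subLaplacian S vol (fun y => (φ y).re) x : ℂ) +
    Complex.I * (subLaplacian S vol (fun y => (φ y).im) x : ℂ)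

/-! ### Compatible connections -/

variable (m M) in
/-- Affine connections on `TM`; `∇ X x v` is the covariant derivative `∇_v X` at `x`. -/
abbrev Connection : Type _ :=
  CovariantDerivative (𝓡 m) (EuclideanSpace ℝ (Fin m)) (fun x : M => TangentSpace (𝓡 m) x)

/-- The covariant derivative `(∇_v β)(w) = v(β(W)) - β(∇_v W)` of a one-form at `x`, where `W` is a
local extension of `w`, smooth near `x`. -/
def covDerivForm (nabla : Connection m M) (β : Form1 m M) (x : M)
    (v w : TangentSpace (𝓡 m) x) : ℝ :=
  mvfderiv (𝓡 m) (fun y => β y (FiberBundle.extend (EuclideanSpace ℝ (Fin m)) w y)) x v -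
    β x (nabla (FiberBundle.extend (EuclideanSpace ℝ (Fin m)) w) x v)

/-- The smooth affine connection `∇` is compatible with `(D, g, dμ)`. -/
structure IsCompatible (S : SubRiemannianStructure m M) (vol : VolumeDensity m M)
    (nabla : Connection m M) : Prop where
  smooth : CovariantDerivative.ContMDiffCovariantDerivative nabla ∞
  preserves : ∀ X : VField m M, SmoothField X → S.IsHorizontalField X →
    ∀ x v, nabla X x v ∈ S.D x
  metric : ∀ (X Y : VField m M), SmoothField X → SmoothField Y →
    ∀ (hX : S.IsHorizontalField X) (hY : S.IsHorizontalField Y),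
    ∀ (x : M) (v : TangentSpace (𝓡 m) x)
      (hvX : nabla X x v ∈ S.D x) (hvY : nabla Y x v ∈ S.D x),
    mvfderiv (𝓡 m) (fun y => S.g y ⟨X y, hX y⟩ ⟨Y y, hY y⟩) x v =
      S.g x ⟨nabla X x v, hvX⟩ ⟨Y x, hY x⟩ + S.g x ⟨X x, hX x⟩ ⟨nabla Y x v, hvY⟩
  laplacian : ∀ φ : M → ℝ, ContMDiff (𝓡 m) 𝓘(ℝ, ℝ) ∞ φ → ∀ x,
    S.trace x (covDerivForm nabla (fun y => mvfderiv (𝓡 m) φ y) x) = subLaplacian S vol φ x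

/-! ### Horizontal and harmonic maps into a Lie group -/

section LieGroupTarget

variable {E : Type*} [NormedAddCommGroup E] [NormedSpace ℝ E] {H : Type*} [TopologicalSpace H]
  {I : ModelWithCorners ℝ E H} {G : Type*} [TopologicalSpace G] [ChartedSpace H G] [Group G]

variable (I G) in
/-- The data `(𝔢, ⟨·,·⟩)` at the identity of a left-invariant structure on `G`. -/
structure LeftInvariantStructure where
  e : Submodule ℝ (GroupLieAlgebra I G)
  inner : e →ₗ[ℝ] e →ₗ[ℝ] ℝ
  inner_symm : ∀ v w, inner v w = inner w v
  inner_pos : ∀ v, v ≠ 0 → 0 < inner v v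

variable (I) in
/-- The left Maurer-Cartan form `ω(v) = a⁻¹ · v`. -/
def maurerCartan (a : G) : TangentSpace I a →L[ℝ] GroupLieAlgebra I G :=
  (mfderiv I I (fun b => a⁻¹ * b) a : TangentSpace I a →L[ℝ] TangentSpace I (a⁻¹ * a))

variable (m M I G) in
/-- Not necessarily continuous `𝔤`-valued one-forms on `M`. -/
abbrev LieForm1 : Type _ := (x : M) → (TangentSpace (𝓡 m) x →L[ℝ] GroupLieAlgebra I G)

variable (m I) in
/-- The left Darboux derivative `α_f = f^* ω`. -/
def darboux (f : M → G) : LieForm1 m M I G :=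
  fun x => (maurerCartan I (f x)).comp (mfderiv (𝓡 m) I f x)

variable (S : SubRiemannianStructure m M) (vol : VolumeDensity m M)
  (L : LeftInvariantStructure I G)

/-- `f` is smooth and `df(D) ⊆ E`, where `E` is the left translation of `𝔢`. -/
def IsHorizontalMap (f : M → G) : Prop :=
  ContMDiff (𝓡 m) I ∞ f ∧
    ∀ x, ∀ v ∈ S.D x, maurerCartan I (f x) (mfderiv (𝓡 m) I f x v) ∈ L.e

open Classical in
/-- The squared norm of an element of `𝔢` (and, by convention, `0` outside of `𝔢`). -/
def LeftInvariantStructure.normSq (v : GroupLieAlgebra I G) : ℝ :=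
  if hv : v ∈ L.e then L.inner ⟨v, hv⟩ ⟨v, hv⟩ else 0

/-- The energy `½ ∫ |α|²_{g*} dμ` of a form `α` with `α(D) ⊆ 𝔢` almost everywhere. -/
def energy (α : LieForm1 m M I G) : ℝ :=
  (1 / 2) * ∫ x, ∑ i, L.normSq (α x (S.onb x i)) ∂vol.μ

/-- `β` is an `L²` form: all its components, with respect to smooth vector fields on `M` and linear
functionals on `𝔤`, are in `L²(μ)`. -/
def IsL2Form (β : LieForm1 m M I G) : Prop :=
  ∀ X : VField m M, SmoothField X → ∀ l : GroupLieAlgebra I G →L[ℝ] ℝ,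
    MeasureTheory.MemLp (fun x => l (β x (X x))) 2 vol.μ

/-- Convergence of `𝔤`-valued one-forms in `L²`, tested on components. On a compact manifold
finitely many smooth vector fields span each tangent space, so that this is convergence for the
`L²` norm defined by any Riemannian metric on `M` and any inner product on `𝔤`. -/
def TendstoL2 {ι : Type*} (β : ι → LieForm1 m M I G) (F : Filter ι) (β₀ : LieForm1 m M I G) :
    Prop :=
  ∀ X : VField m M, SmoothField X → ∀ l : GroupLieAlgebra I G →L[ℝ] ℝ,
    Filter.Tendsto
      (fun s => MeasureTheory.eLpNorm (fun x => l (β s x (X x)) - l (β₀ x (X x))) 2 vol.μ) F (𝓝 0)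

/-- `β` is in the `L²` closure of the set of Darboux derivatives of horizontal maps `M → G`. -/
def InHorizontalClosure (β : LieForm1 m M I G) : Prop :=
  IsL2Form vol β ∧ ∃ f : ℕ → M → G, (∀ k, IsHorizontalMap S L (f k)) ∧
    TendstoL2 vol (fun k => darboux m I (f k)) Filter.atTop β

/-- `a` is a variation of `α`: a curve `(-ε, ε) → L²Ω¹(M, 𝔤)`, differentiable in `L²`, in the
closure of the set of Darboux derivatives of horizontal maps, with `a 0 = α`. -/
structure IsVariation (α : LieForm1 m M I G) (ε : ℝ) (a : ℝ → LieForm1 m M I G) : Prop where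
  pos : 0 < ε
  zero : a 0 = α
  mem : ∀ s ∈ Set.Ioo (-ε) ε, InHorizontalClosure S vol L (a s)
  diff : ∀ s ∈ Set.Ioo (-ε) ε, ∃ η : LieForm1 m M I G, IsL2Form vol η ∧
    TendstoL2 vol (fun h : ℝ => fun x => h⁻¹ • (a (s + h) x - a s x)) (𝓝[≠] 0) η

/-- `f` is a harmonic map: horizontal, and its Darboux derivative is a critical point of the
energy, under all variations. -/
def IsHarmonic (f : M → G) : Prop :=
  IsHorizontalMap S L f ∧ ∀ (ε : ℝ) (a : ℝ → LieForm1 m M I G),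
    IsVariation S vol L (darboux m I f) ε a → HasDerivAt (fun s => energy S vol L (a s)) 0 0

/-- The coadjoint representation, `(ad^*(A) β)(B) = - β([A, B])`. -/
def coad (A : GroupLieAlgebra I G) (β : GroupLieAlgebra I G → ℝ) (B : GroupLieAlgebra I G) : ℝ :=
  - β ⁅A, B⁆

/-- `A = ♯ β`, where `♯ : 𝔤^* → 𝔢` is defined by `⟨♯ β, w⟩ = β(w)` for `w ∈ 𝔢`. -/
def LeftInvariantStructure.IsSharp (β : GroupLieAlgebra I G → ℝ) (A : GroupLieAlgebra I G) :
    Prop :=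
  ∃ hA : A ∈ L.e, ∀ w : L.e, L.inner ⟨A, hA⟩ w = β w

variable (m M I G) in
/-- `𝔤^*`-valued one-forms on `M`, written as linear maps from `𝔤` to real one-forms: the value of
`lam` at `v ∈ T_x M` is the functional `B ↦ lam B x v`. -/
abbrev DualForm1 : Type _ := GroupLieAlgebra I G →ₗ[ℝ] Form1 m M

/-- `δ_D λ = - tr_g ∇_× λ(×)`, a function on `M` with values in `𝔤^*`. -/
def deltaD (nabla : Connection m M) (lam : DualForm1 m M I G) (x : M)
    (B : GroupLieAlgebra I G) : ℝ :=
  - S.trace x (covDerivForm nabla (lam B) x)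

/-- `f` is a normal harmonic map: it is harmonic, and there is a smooth `λ ∈ Ω¹(M, 𝔤^*)` with
`♯ λ|D = α_f|D` and `δ_D λ - tr_g ad^*(α_f(×)) λ(×) = 0`. -/
def IsNormalHarmonic (nabla : Connection m M) (f : M → G) : Prop :=
  IsHarmonic S vol L f ∧ ∃ lam : DualForm1 m M I G,
    (∀ B, SmoothForm1 (lam B)) ∧
    (∀ x, ∀ v ∈ S.D x, L.IsSharp (fun B => lam B x v) (darboux m I f x v)) ∧
    ∀ x B, deltaD S nabla lam x B -
      S.trace x (fun v w => coad (darboux m I f x v) (fun B' => lam B' x w) B) = 0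

end LieGroupTarget

end

end Manifold

/-! ### The Heisenberg group -/

/-- The space `H^n = ℝ^{2n+1}` with coordinates `(a, b, c)`. -/
def Heis (n : ℕ) : Type := EuclideanSpace ℝ (Fin n) × EuclideanSpace ℝ (Fin n) × ℝ

namespace Heis

variable {n : ℕ}

instance : NormedAddCommGroup (Heis n) :=
  inferInstanceAs (NormedAddCommGroup (EuclideanSpace ℝ (Fin n) × EuclideanSpace ℝ (Fin n) × ℝ))

instance : NormedSpace ℝ (Heis n) :=
  inferInstanceAs (NormedSpace ℝ (EuclideanSpace ℝ (Fin n) × EuclideanSpace ℝ (Fin n) × ℝ))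

instance : FiniteDimensional ℝ (Heis n) :=
  inferInstanceAs
    (FiniteDimensional ℝ (EuclideanSpace ℝ (Fin n) × EuclideanSpace ℝ (Fin n) × ℝ))

def mk (a b : EuclideanSpace ℝ (Fin n)) (c : ℝ) : Heis n := (a, b, c)

def a (p : Heis n) : EuclideanSpace ℝ (Fin n) := p.1

def b (p : Heis n) : EuclideanSpace ℝ (Fin n) := p.2.1

def c (p : Heis n) : ℝ := p.2.2

@[ext] theorem ext {p q : Heis n} (ha : p.a = q.a) (hb : p.b = q.b) (hc : p.c = q.c) : p = q :=
  Prod.ext ha (Prod.ext hb hc)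

instance : Mul (Heis n) :=
  ⟨fun p q => mk (p.a + q.a) (p.b + q.b)
    (p.c + q.c + (1 / 2) * (inner ℝ p.a q.b - inner ℝ q.a p.b))⟩

instance : One (Heis n) := ⟨mk 0 0 0⟩

instance : Inv (Heis n) := ⟨fun p => mk (-p.a) (-p.b) (-p.c)⟩

@[simp] theorem a_mk (u v : EuclideanSpace ℝ (Fin n)) (w : ℝ) : (mk u v w).a = u := rfl
@[simp] theorem b_mk (u v : EuclideanSpace ℝ (Fin n)) (w : ℝ) : (mk u v w).b = v := rfl
@[simp] theorem c_mk (u v : EuclideanSpace ℝ (Fin n)) (w : ℝ) : (mk u v w).c = w := rfl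

theorem mul_def (p q : Heis n) : p * q = mk (p.a + q.a) (p.b + q.b)
    (p.c + q.c + (1 / 2) * (inner ℝ p.a q.b - inner ℝ q.a p.b)) := rfl

theorem one_def : (1 : Heis n) = mk 0 0 0 := rfl

theorem inv_def (p : Heis n) : p⁻¹ = mk (-p.a) (-p.b) (-p.c) := rfl

instance : Group (Heis n) :=
  Group.ofLeftAxioms
    (by
      intro p q r
      ext1
      · simp [mul_def, add_assoc]
      · simp [mul_def, add_assoc]
      · simp only [mul_def, a_mk, b_mk, c_mk, inner_add_left, inner_add_right]
        ring)
    (by intro p; ext1 <;> simp [mul_def, one_def])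
    (by
      intro p
      ext1
      · simp [mul_def, inv_def, one_def]
      · simp [mul_def, inv_def, one_def]
      · simp [mul_def, inv_def, one_def])

theorem contDiff_mul : ContDiff ℝ ∞ (fun p : Heis n × Heis n => p.1 * p.2) := by
  have ha : ContDiff ℝ ∞ (a : Heis n → _) := contDiff_fst
  have hb : ContDiff ℝ ∞ (b : Heis n → _) := contDiff_fst.comp contDiff_snd
  have hc : ContDiff ℝ ∞ (c : Heis n → _) := contDiff_snd.comp contDiff_snd
  have ha1 := ha.comp (contDiff_fst : ContDiff ℝ ∞ (Prod.fst : Heis n × Heis n → _))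
  have ha2 := ha.comp (contDiff_snd : ContDiff ℝ ∞ (Prod.snd : Heis n × Heis n → _))
  have hb1 := hb.comp (contDiff_fst : ContDiff ℝ ∞ (Prod.fst : Heis n × Heis n → _))
  have hb2 := hb.comp (contDiff_snd : ContDiff ℝ ∞ (Prod.snd : Heis n × Heis n → _))
  have hc1 := hc.comp (contDiff_fst : ContDiff ℝ ∞ (Prod.fst : Heis n × Heis n → _))
  have hc2 := hc.comp (contDiff_snd : ContDiff ℝ ∞ (Prod.snd : Heis n × Heis n → _))
  exact (ha1.add ha2).prodMk ((hb1.add hb2).prodMk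
    ((hc1.add hc2).add (contDiff_const.mul ((ha1.inner ℝ hb2).sub (ha2.inner ℝ hb1)))))

theorem contDiff_inv : ContDiff ℝ ∞ (fun p : Heis n => p⁻¹) :=
  (contDiff_neg : ContDiff ℝ ∞ (fun p : Heis n => -p))

instance : LieGroup 𝓘(ℝ, Heis n) ∞ (Heis n) where
  contMDiff_mul := by
    rw [← modelWithCornersSelf_prod, chartedSpaceSelf_prod]
    exact contDiff_mul.contMDiff
  contMDiff_inv := contDiff_inv.contMDiff

/-- The coordinates `(a, b, c)` of an element of the Lie algebra `T_1 H^n` of `H^n`, that is, its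
coordinates with respect to the basis `A_j, B_j, C`. -/
def lieCoord : GroupLieAlgebra 𝓘(ℝ, Heis n) (Heis n) ≃L[ℝ] Heis n :=
  NormedSpace.fromTangentSpace (1 : Heis n)

/-- The projection `(a, b, c) ↦ (a, b)`, as a linear map. -/
def horizontalPart :
    Heis n →ₗ[ℝ] EuclideanSpace ℝ (Fin n) × EuclideanSpace ℝ (Fin n) where
  toFun p := (p.a, p.b)
  map_add' _ _ := rfl
  map_smul' _ _ := rfl

/-- The coordinate `c`, as a linear map. -/
def verticalPart : Heis n →ₗ[ℝ] ℝ where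
  toFun p := p.c
  map_add' _ _ := rfl
  map_smul' _ _ := rfl

/-- The inner product on `Heis n`, vanishing in the direction of `c`, for which the coordinate
vectors of `a` and `b` are orthonormal. -/
def horizontalForm : Heis n →ₗ[ℝ] Heis n →ₗ[ℝ] ℝ :=
  ((innerₗ (EuclideanSpace ℝ (Fin n))).compl₁₂
      (LinearMap.fst ℝ _ _ ∘ₗ horizontalPart) (LinearMap.fst ℝ _ _ ∘ₗ horizontalPart)) +
    ((innerₗ (EuclideanSpace ℝ (Fin n))).compl₁₂
      (LinearMap.snd ℝ _ _ ∘ₗ horizontalPart) (LinearMap.snd ℝ _ _ ∘ₗ horizontalPart))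

theorem horizontalForm_apply (p q : Heis n) :
    horizontalForm p q = inner ℝ p.a q.a + inner ℝ p.b q.b := rfl

/-- The standard structure on `H^n`: the subspace `𝔢` is spanned by `A_j`, `B_j` (so that it is
given by `c = 0`), and these vectors are orthonormal. -/
def standard (n : ℕ) : LeftInvariantStructure 𝓘(ℝ, Heis n) (Heis n) where
  e := LinearMap.ker (verticalPart ∘ₗ (lieCoord (n := n)).toLinearMap)
  inner := horizontalForm.compl₁₂
    ((lieCoord (n := n)).toLinearMap ∘ₗ Submodule.subtype _)
    ((lieCoord (n := n)).toLinearMap ∘ₗ Submodule.subtype _)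
  inner_symm v w := by
    simp only [LinearMap.compl₁₂_apply, horizontalForm_apply]
    rw [real_inner_comm, real_inner_comm (Heis.b _)]
  inner_pos v hv := by
    simp only [LinearMap.compl₁₂_apply, horizontalForm_apply]
    set p : Heis n := lieCoord (v : GroupLieAlgebra 𝓘(ℝ, Heis n) (Heis n)) with hp
    change 0 < inner ℝ p.a p.a + inner ℝ p.b p.b
    have hc : p.c = 0 := v.2
    have h : p.a ≠ 0 ∨ p.b ≠ 0 := by
      by_contra! h
      apply hv
      have h0 : p = 0 := ext h.1 h.2 hc
      exact Subtype.ext ((lieCoord (n := n)).map_eq_zero_iff.1 h0)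
    rcases h with h | h
    · exact add_pos_of_pos_of_nonneg (real_inner_self_pos.2 h) real_inner_self_nonneg
    · exact add_pos_of_nonneg_of_pos real_inner_self_nonneg (real_inner_self_pos.2 h)

/-- The components of `ζ = u + i v`, where `f = (u, v, w)`. -/
def zeta {M : Type*} (f : M → Heis n) (j : Fin n) (x : M) : ℂ :=
  ((f x).a j : ℂ) + Complex.I * ((f x).b j : ℂ)

end Heis

end

end SubRiem

/-! Evaluate a multiplier λ on the basis `A_j`, `B_j`, `C` of the Heisenberg algebra. The relation
♯λ|_D = α_f|_D forces λ(A_j) = du_j and λ(B_j) = dv_j on D and leaves λ(C) free; put Y = ♯^g λ(C).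
The volume condition on the connection, stated for exact forms, extends by the Leibniz rule to tr_g
∇β = div ♯β for every smooth one-form (`trace_covDerivForm_eq_div`). All brackets are multiples of
C, so the Euler–Lagrange equation at A_j, B_j, C reads Δu_j = -Y v_j, Δv_j = Y u_j, div Y = 0
(`euler_lagrange_iff`), and the first two are the real and imaginary parts of Δζ = iYζ. Conversely,
Y lifts to a smooth one-form β with ♯β = Y (`exists_form_sharp_eq`), and λ = (du, dv, β) is a
multiplier.

It remains to show that a solution of the ζ-equation is critical for the energy along every
differentiable curve in the L² closure, although such curves need not consist of Darboux
derivatives. Let A(φ, ψ) = ∫ φ (Yψ) dμ, which is antisymmetric because div Y = 0. Horizontality of a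
map g says dw = ½ Σ (u_j dv_j - v_j du_j) on D; integrating along Y gives Σ A(u_j, v_j) = 0
(`sum_advection_eq_zero`). For f solving the equation and any horizontal g, Green's formula and this
identity for both maps turn the pairing of α_f with α_g - α_f into -Σ A(u_j(g) - u_j(f), v_j(g) -
v_j(f)) (`first_variation_eq`): the first variation is itself quadratic in the difference.

Since A ignores additive constants, a Poincaré inequality on the compact connected manifold
(`exists_poincare`) bounds this by squared L² norms of components of α_g - α_f. Full rather than
horizontal derivatives are allowed there, because L² convergence is tested on all smooth fields.
Both sides are L²-continuous, so the estimate holds on the closure (`exists_energy_bound`). Along a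
curve differentiable at 0 the squared distance is O(s²), hence so is the change of energy, and its
derivative vanishes.

The supporting analysis works with the chartwise divergence: its independence of the chart, the
divergence theorem, and a finite Parseval frame of global sections of D that replaces the pointwise
chosen orthonormal bases. -/

namespace SubRiem
noncomputable section

/-! ### Smooth vector fields and one-forms at a point. -/

section Calculus

variable {m : ℕ} {M : Type*} [TopologicalSpace M] [ChartedSpace (EuclideanSpace ℝ (Fin m)) M]
  [IsManifold (𝓡 m) ∞ M]

/-- The vector field `X` is smooth at `x`. -/
def SmoothFieldAt (X : VField m M) (x : M) : Prop :=
  ContMDiffAt (𝓡 m) (𝓡 m).tangent ∞ (fun x => (⟨x, X x⟩ : TangentBundle (𝓡 m) M)) x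

/-- The one-form `β` is smooth at `x`. -/
def SmoothForm1At (β : Form1 m M) (x : M) : Prop :=
  ContMDiffAt (𝓡 m) ((𝓡 m).prod 𝓘(ℝ, EuclideanSpace ℝ (Fin m) →L[ℝ] ℝ)) ∞
    (fun x => (⟨x, β x⟩ : Bundle.TotalSpace (EuclideanSpace ℝ (Fin m) →L[ℝ] ℝ)
      (fun x : M => TangentSpace (𝓡 m) x →L[ℝ] Bundle.Trivial M ℝ x))) x

/-- The differential is smooth in bundle coordinates; applied to `X` it gives a smooth section of
`TF` along `φ`, and `TF` is trivial, so the second component is smooth. -/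
theorem contMDiffAt_mvfderiv_apply {F : Type*} [NormedAddCommGroup F] [NormedSpace ℝ F]
    {φ : M → F} {X : VField m M} {x : M} (hφ : ContMDiffAt (𝓡 m) 𝓘(ℝ, F) ∞ φ x)
    (hX : SmoothFieldAt X x) :
    ContMDiffAt (𝓡 m) 𝓘(ℝ, F) ∞ (fun y => mvfderiv (𝓡 m) φ y (X y)) x := by
  have h1 := hφ.mfderiv_const (m := ∞) (by simp)
  have h2 := ContMDiffAt.clm_apply_of_inCoordinates (b₁ := id) (b₂ := φ)
    (ϕ := fun y => mfderiv (𝓡 m) 𝓘(ℝ, F) φ y) (v := X) h1 hX hφ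
  have h3 := (contMDiff_snd_tangentBundle_modelSpace F 𝓘(ℝ, F) (n := ∞)).contMDiffAt
    (x := (⟨φ x, mfderiv (𝓡 m) 𝓘(ℝ, F) φ x (X x)⟩ : TangentBundle 𝓘(ℝ, F) F))
  exact h3.comp x h2

theorem smoothForm1At_mvfderiv {φ : M → ℝ} {x : M} (hφ : ContMDiffAt (𝓡 m) 𝓘(ℝ, ℝ) ∞ φ x) :
    SmoothForm1At (fun y => mvfderiv (𝓡 m) φ y) x := by
  have h1 := hφ.mfderiv_const (m := ∞) (by simp)
  unfold SmoothForm1At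
  rw [contMDiffAt_hom_bundle]
  refine ⟨contMDiffAt_id, h1.congr_of_eventuallyEq (.of_forall fun y => ?_)⟩
  simp only [inTangentCoordinates, ContinuousLinearMap.inCoordinates]
  ext v
  simp
  rfl

theorem SmoothForm1At.apply {β : Form1 m M} {X : VField m M} {x : M} (hβ : SmoothForm1At β x)
    (hX : SmoothFieldAt X x) : ContMDiffAt (𝓡 m) 𝓘(ℝ, ℝ) ∞ (fun y => β y (X y)) x := by
  have h := ContMDiffAt.clm_bundle_apply (b := fun y : M => y)
    (E₁ := fun y : M => TangentSpace (𝓡 m) y) (E₂ := Bundle.Trivial M ℝ) (ϕ := β) (v := X) hβ hX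
  rw [Bundle.contMDiffAt_totalSpace] at h
  exact h.2

theorem SmoothFieldAt.smul {X : VField m M} {x : M} {φ : M → ℝ}
    (hφ : ContMDiffAt (𝓡 m) 𝓘(ℝ, ℝ) ∞ φ x) (hX : SmoothFieldAt X x) :
    SmoothFieldAt (fun y => φ y • X y) x := hφ.smul_section hX

theorem SmoothFieldAt.add {X X' : VField m M} {x : M} 
    (hX : SmoothFieldAt X x) (hX' : SmoothFieldAt X' x) :
    SmoothFieldAt (fun y => X y + X' y) x := hX.add_section hX'

theorem SmoothFieldAt.sum {ι : Type*} {s : Finset ι} {X : ι → VField m M} {x : M}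
    (hX : ∀ i ∈ s, SmoothFieldAt (X i) x) : SmoothFieldAt (fun y => ∑ i ∈ s, X i y) x :=
  ContMDiffAt.sum_section hX

theorem SmoothForm1At.smul {β : Form1 m M} {x : M} {φ : M → ℝ}
    (hφ : ContMDiffAt (𝓡 m) 𝓘(ℝ, ℝ) ∞ φ x) (hβ : SmoothForm1At β x) :
    SmoothForm1At (fun y => φ y • β y) x :=
  ContMDiffAt.smul_section (V := fun x : M => TangentSpace (𝓡 m) x →L[ℝ] Bundle.Trivial M ℝ x) hφ hβ

theorem SmoothForm1At.add {β β' : Form1 m M} {x : M} (hβ : SmoothForm1At β x)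
    (hβ' : SmoothForm1At β' x) : SmoothForm1At (fun y => β y + β' y) x :=
  ContMDiffAt.add_section (V := fun x : M => TangentSpace (𝓡 m) x →L[ℝ] Bundle.Trivial M ℝ x) hβ hβ'

theorem SmoothForm1At.sum {ι : Type*} {s : Finset ι} {β : ι → Form1 m M} {x : M}
    (hβ : ∀ i ∈ s, SmoothForm1At (β i) x) : SmoothForm1At (fun y => ∑ i ∈ s, β i y) x :=
  ContMDiffAt.sum_section (V := fun x : M => TangentSpace (𝓡 m) x →L[ℝ] Bundle.Trivial M ℝ x) hβ

theorem SmoothFieldAt.congr {X X' : VField m M} {x : M} (hX : SmoothFieldAt X x)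
    (h : ∀ᶠ y in 𝓝 x, X' y = X y) : SmoothFieldAt X' x :=
  ContMDiffAt.congr_of_eventuallyEq hX (h.mono fun y hy => by simp [hy])

theorem SmoothForm1At.congr {β β' : Form1 m M} {x : M} (hβ : SmoothForm1At β x)
    (h : ∀ᶠ y in 𝓝 x, β' y = β y) : SmoothForm1At β' x :=
  ContMDiffAt.congr_of_eventuallyEq hβ (h.mono fun y hy => by simp [hy])

theorem SmoothFieldAt.extend {x : M} (w : TangentSpace (𝓡 m) x) :
    SmoothFieldAt (FiberBundle.extend (EuclideanSpace ℝ (Fin m)) w) x :=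
  FiberBundle.contMDiffAt_extend (𝓡 m) (EuclideanSpace ℝ (Fin m)) w

end Calculus

end
end SubRiem

namespace SubRiem
noncomputable section

/-! ### Coordinate fields, cut-offs, Parseval frames and surjectivity of ♯. -/

section Frames

set_option linter.unusedSectionVars false

variable {m : ℕ} {M : Type*} [TopologicalSpace M] [ChartedSpace (EuclideanSpace ℝ (Fin m)) M]
  [IsManifold (𝓡 m) ∞ M]

/-- The `i`-th coordinate vector field of the chart around `x₀`. -/
def coordField (x₀ : M) (i : Fin m) : VField m M :=
  (trivializationAt (EuclideanSpace ℝ (Fin m)) (TangentSpace (𝓡 m)) x₀).localFrame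
    (EuclideanSpace.basisFun (Fin m) ℝ).toBasis i

/-- The `i`-th coordinate function of the chart around `x₀`. -/
def coordFn (x₀ : M) (i : Fin m) (x : M) : ℝ := extChartAt (𝓡 m) x₀ x i

theorem contMDiffAt_extChartAt_of_mem {x₀ x : M} (hx : x ∈ (chartAt (EuclideanSpace ℝ (Fin m)) x₀).source) :
    ContMDiffAt (𝓡 m) 𝓘(ℝ, EuclideanSpace ℝ (Fin m)) ∞ (extChartAt (𝓡 m) x₀) x :=
  contMDiffAt_extChartAt' hx

theorem contMDiffAt_coordFn {x₀ x : M} (hx : x ∈ (chartAt (EuclideanSpace ℝ (Fin m)) x₀).source)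
    (i : Fin m) : ContMDiffAt (𝓡 m) 𝓘(ℝ, ℝ) ∞ (coordFn x₀ i) x :=
  (EuclideanSpace.proj (𝕜 := ℝ) i).contMDiff.contMDiffAt.comp x (contMDiffAt_extChartAt_of_mem hx)

theorem smoothFieldAt_coordField {x₀ x : M}
    (hx : x ∈ (chartAt (EuclideanSpace ℝ (Fin m)) x₀).source) (i : Fin m) :
    SmoothFieldAt (coordField x₀ i) x :=
  contMDiffAt_localFrame_of_mem ∞ _ _ i hx

/-- The tangent trivialization at `x₀` is the derivative of the chart; this makes `coordField` dual
to the differentials of `coordFn`. -/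
theorem mvfderiv_extChartAt_eq_linearEquivAt {x₀ x : M}
    (hx : x ∈ (chartAt (EuclideanSpace ℝ (Fin m)) x₀).source) (v : TangentSpace (𝓡 m) x) :
    mvfderiv (𝓡 m) (extChartAt (𝓡 m) x₀) x v =
      (trivializationAt (EuclideanSpace ℝ (Fin m)) (TangentSpace (𝓡 m)) x₀).linearEquivAt ℝ x hx
        v := by
  have h := TangentBundle.continuousLinearMapAt_trivializationAt (I := 𝓡 m) hx
  have h1 : mvfderiv (𝓡 m) (extChartAt (𝓡 m) x₀) x v =
      (trivializationAt (EuclideanSpace ℝ (Fin m)) (TangentSpace (𝓡 m)) x₀).continuousLinearMapAt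
        ℝ x v := by
    rw [h]; rfl
  rw [h1]
  exact congrFun (Bundle.Trivialization.coe_linearMapAt_of_mem _ hx) v

theorem mvfderiv_extChartAt_coordField {x₀ x : M}
    (hx : x ∈ (chartAt (EuclideanSpace ℝ (Fin m)) x₀).source) (i : Fin m) :
    mvfderiv (𝓡 m) (extChartAt (𝓡 m) x₀) x (coordField x₀ i x) = EuclideanSpace.single i 1 := by
  rw [mvfderiv_extChartAt_eq_linearEquivAt hx, coordField,
    Bundle.Trivialization.localFrame_apply_of_mem_baseSet _ _ hx]
  refine (LinearEquiv.apply_symm_apply (Bundle.Trivialization.linearEquivAt ℝ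
    (trivializationAt (EuclideanSpace ℝ (Fin m)) (TangentSpace (𝓡 m)) x₀) x hx) _).trans ?_
  simp

theorem mvfderiv_clm_comp {F F' : Type*} [NormedAddCommGroup F] [NormedSpace ℝ F]
    [NormedAddCommGroup F'] [NormedSpace ℝ F'] (l : F →L[ℝ] F') {φ : M → F} {x : M}
    (hφ : MDifferentiableAt (𝓡 m) 𝓘(ℝ, F) φ x) (v : TangentSpace (𝓡 m) x) :
    mvfderiv (𝓡 m) (fun y => l (φ y)) x v = l (mvfderiv (𝓡 m) φ x v) := by
  have h := mfderiv_comp x (l.mdifferentiableAt (x := φ x)) hφ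
  rw [ContinuousLinearMap.mfderiv_eq] at h
  exact DFunLike.congr_fun h v

theorem mvfderiv_coordFn {x₀ x : M} (hx : x ∈ (chartAt (EuclideanSpace ℝ (Fin m)) x₀).source)
    (i : Fin m) (v : TangentSpace (𝓡 m) x) :
    mvfderiv (𝓡 m) (coordFn x₀ i) x v = mvfderiv (𝓡 m) (extChartAt (𝓡 m) x₀) x v i :=
  mvfderiv_clm_comp (EuclideanSpace.proj (𝕜 := ℝ) i)
    ((contMDiffAt_extChartAt_of_mem hx).mdifferentiableAt (by simp)) v

theorem sum_mvfderiv_coordFn_smul_coordField {x₀ x : M}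
    (hx : x ∈ (chartAt (EuclideanSpace ℝ (Fin m)) x₀).source) (v : TangentSpace (𝓡 m) x) :
    ∑ i, mvfderiv (𝓡 m) (coordFn x₀ i) x v • coordField x₀ i x = v := by
  apply ((trivializationAt (EuclideanSpace ℝ (Fin m)) (TangentSpace (𝓡 m)) x₀).linearEquivAt ℝ x
    hx).injective
  rw [map_sum]
  simp only [map_smul, ← mvfderiv_extChartAt_eq_linearEquivAt hx,
    mvfderiv_extChartAt_coordField hx, mvfderiv_coordFn hx]
  ext j
  simp [Pi.single_apply]

theorem SmoothField.smul_of_tsupport {χ : M → ℝ} {X : VField m M}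
    (hχ : ContMDiff (𝓡 m) 𝓘(ℝ, ℝ) ∞ χ) (hX : ∀ x ∈ tsupport χ, SmoothFieldAt X x) :
    SmoothField (fun x => χ x • X x) := by
  intro x
  by_cases hx : x ∈ tsupport χ
  · exact SmoothFieldAt.smul hχ.contMDiffAt (hX x hx)
  · have h : ∀ᶠ y in 𝓝 x, χ y = 0 := by
      filter_upwards [(isClosed_tsupport χ).isOpen_compl.mem_nhds hx] with y hy
      exact image_eq_zero_of_notMem_tsupport hy
    exact SmoothFieldAt.congr (X := fun x => (0 : TangentSpace (𝓡 m) x))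
       (Bundle.contMDiff_zeroSection ℝ _ x) (h.mono fun y hy => by simp [hy])

theorem SmoothForm1.smul_of_tsupport {χ : M → ℝ} {β : Form1 m M}
    (hχ : ContMDiff (𝓡 m) 𝓘(ℝ, ℝ) ∞ χ) (hβ : ∀ x ∈ tsupport χ, SmoothForm1At β x) :
    SmoothForm1 (fun x => χ x • β x) := by
  intro x
  by_cases hx : x ∈ tsupport χ
  · exact SmoothForm1At.smul hχ.contMDiffAt (hβ x hx)
  · have h : ∀ᶠ y in 𝓝 x, χ y = 0 := by
      filter_upwards [(isClosed_tsupport χ).isOpen_compl.mem_nhds hx] with y hy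
      exact image_eq_zero_of_notMem_tsupport hy
    exact SmoothForm1At.congr (β := fun x => (0 : TangentSpace (𝓡 m) x →L[ℝ] ℝ))
       (Bundle.contMDiff_zeroSection ℝ
        (fun x : M => TangentSpace (𝓡 m) x →L[ℝ] Bundle.Trivial M ℝ x) x)
       (h.mono fun y hy => by simp [hy])

theorem contMDiff_mul_of_tsupport {χ φ : M → ℝ} (hχ : ContMDiff (𝓡 m) 𝓘(ℝ, ℝ) ∞ χ)
    (hφ : ∀ x ∈ tsupport χ, ContMDiffAt (𝓡 m) 𝓘(ℝ, ℝ) ∞ φ x) :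
    ContMDiff (𝓡 m) 𝓘(ℝ, ℝ) ∞ (fun x => χ x * φ x) :=
  contMDiff_of_tsupport fun x hx => hχ.contMDiffAt.mul (hφ x (tsupport_mul_subset_left hx))

variable [T2Space M] [CompactSpace M]

theorem exists_bump {x : M} {U : Set M} (hU : U ∈ 𝓝 x) : ∃ χ : M → ℝ,
    ContMDiff (𝓡 m) 𝓘(ℝ, ℝ) ∞ χ ∧ (∀ᶠ y in 𝓝 x, χ y = 1) ∧ tsupport χ ⊆ U ∧
      ∀ y, χ y ∈ Set.Icc 0 1 := by
  obtain ⟨V, hV, hVc, hVU⟩ := exists_mem_nhds_isClosed_subset hU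
  obtain ⟨f, h1, h0, h⟩ := exists_contMDiffMap_one_nhds_of_subset_interior (𝓡 m) (n := ⊤)
    (isClosed_singleton (x := x)) (t := V) (by simpa using mem_interior_iff_mem_nhds.2 hV)
  refine ⟨f, f.contMDiff, by simpa using h1, ?_, h⟩
  refine (closure_minimal (fun y hy => ?_) hVc).trans hVU
  by_contra hyV
  exact hy (h0 y hyV)

/-- A finite smooth partition of unity by squares, subordinate to a cover by neighbourhoods. -/
theorem exists_sq_partition {U : M → Set M} (hU : ∀ x, U x ∈ 𝓝 x) :
    ∃ (N : ℕ) (c : Fin N → M) (χ : Fin N → M → ℝ),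
      (∀ k, ContMDiff (𝓡 m) 𝓘(ℝ, ℝ) ∞ (χ k)) ∧ (∀ k, tsupport (χ k) ⊆ U (c k)) ∧
      ∀ x, ∑ k, χ k x ^ 2 = 1 := by
  choose χ hχ h1 hs h01 using fun x => exists_bump (m := m) (hU x)
  obtain ⟨t, -, ht⟩ := isCompact_univ.elim_nhds_subcover (fun x => {y | χ x y = 1})
    (fun x _ => h1 x)
  let e := t.equivFin.symm
  let q : M → ℝ := fun y => ∑ k, χ (e k) y ^ 2
  have hq : ∀ y, 0 < q y := by
    intro y
    obtain ⟨x, hx, hy⟩ := Set.mem_iUnion₂.1 (ht (Set.mem_univ y))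
    have : χ (e (t.equivFin ⟨x, hx⟩)) y ^ 2 ≤ q y :=
      Finset.single_le_sum (f := fun k => χ (e k) y ^ 2) (fun _ _ => sq_nonneg _)
        (Finset.mem_univ _)
    have hy' : χ x y = 1 := hy
    simp only [e, Equiv.symm_apply_apply, hy'] at this
    linarith
  have hqs : ContMDiff (𝓡 m) 𝓘(ℝ, ℝ) ∞ q :=
    contMDiff_finsetSum fun k _ => (hχ (e k)).pow 2
  have hsq : ContMDiff (𝓡 m) 𝓘(ℝ, ℝ) ∞ (fun y => (Real.sqrt (q y))⁻¹) := by
    intro y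
    have h2 : ContDiffAt ℝ ∞ (fun r : ℝ => (Real.sqrt r)⁻¹) (q y) :=
      (Real.contDiffAt_sqrt (hq y).ne').inv (Real.sqrt_pos.2 (hq y)).ne'
    exact h2.contMDiffAt.comp y (hqs y)
  -- Dividing by the root of the sum of squares normalises squares instead of the functions
  -- themselves, which suits ♯: a cut-off frame enters it quadratically.
  refine ⟨_, fun k => e k, fun k y => (Real.sqrt (q y))⁻¹ * χ (e k) y, fun k => hsq.mul (hχ _),
    fun k => (tsupport_mul_subset_right).trans (hs _), fun y => ?_⟩
  simp only [mul_pow, ← Finset.mul_sum, inv_pow, Real.sq_sqrt (hq y).le]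
  exact inv_mul_cancel₀ (hq y).ne'

theorem contMDiffAt_det {r : ℕ} {A : M → Matrix (Fin r) (Fin r) ℝ} {x : M}
    (hA : ∀ i j, ContMDiffAt (𝓡 m) 𝓘(ℝ, ℝ) ∞ (fun y => A y i j) x) :
    ContMDiffAt (𝓡 m) 𝓘(ℝ, ℝ) ∞ (fun y => (A y).det) x := by
  simp only [Matrix.det_apply']
  exact contMDiffAt_finsetSum fun σ _ => contMDiffAt_const.mul
    (contMDiffAt_finsetProd fun i _ => hA _ _)

theorem contMDiffAt_matrix_inv {r : ℕ} {A : M → Matrix (Fin r) (Fin r) ℝ} {x : M}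
    (hA : ∀ i j, ContMDiffAt (𝓡 m) 𝓘(ℝ, ℝ) ∞ (fun y => A y i j) x) (hdet : (A x).det ≠ 0)
    (i j : Fin r) : ContMDiffAt (𝓡 m) 𝓘(ℝ, ℝ) ∞ (fun y => (A y)⁻¹ i j) x := by
  have h1 : ContMDiffAt (𝓡 m) 𝓘(ℝ, ℝ) ∞ (fun y => ((A y).det)⁻¹) x :=
    (contDiffAt_inv ℝ hdet).contMDiffAt.comp x (contMDiffAt_det hA)
  have h2 : ContMDiffAt (𝓡 m) 𝓘(ℝ, ℝ) ∞ (fun y => (A y).adjugate i j) x := by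
    simp only [Matrix.adjugate_apply]
    refine contMDiffAt_det fun k l => ?_
    by_cases hk : k = j
    · subst hk
      simpa using contMDiffAt_const
    · simpa [Matrix.updateRow_ne hk] using hA k l
  simp only [Matrix.inv_def, Ring.inverse_eq_inv', Matrix.smul_apply, smul_eq_mul]
  exact h1.mul h2

theorem mvfderiv_finset_sum {ι : Type*} {s : Finset ι} {φ : ι → M → ℝ} {x : M}
    (hφ : ∀ i ∈ s, ContMDiffAt (𝓡 m) 𝓘(ℝ, ℝ) ∞ (φ i) x) :
    mvfderiv (𝓡 m) (fun y => ∑ i ∈ s, φ i y) x = ∑ i ∈ s, mvfderiv (𝓡 m) (φ i) x := by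
  classical
  induction s using Finset.induction_on with
  | empty => simpa using mvfderiv_const (I := 𝓡 m) (0 : ℝ) (x := x)
  | insert a s ha ih =>
    simp only [Finset.sum_insert ha]
    have h2 : ContMDiffAt (𝓡 m) 𝓘(ℝ, ℝ) ∞ (fun y => ∑ i ∈ s, φ i y) x :=
      contMDiffAt_finsetSum fun i hi => hφ i (Finset.mem_insert_of_mem hi)
    rw [← ih fun i hi => hφ i (Finset.mem_insert_of_mem hi)]
    exact mvfderiv_add ((hφ a (Finset.mem_insert_self _ _)).mdifferentiableAt (by simp))
      (h2.mdifferentiableAt (by simp))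

theorem mvfderiv_const_mul (c : ℝ) {φ : M → ℝ} {x : M}
    (hφ : MDifferentiableAt (𝓡 m) 𝓘(ℝ, ℝ) φ x) :
    mvfderiv (𝓡 m) (fun y => c * φ y) x = c • mvfderiv (𝓡 m) φ x := by
  ext v
  exact mvfderiv_clm_comp (c • ContinuousLinearMap.id ℝ ℝ) hφ v

namespace SubRiemannianStructure

variable (S : SubRiemannianStructure m M)

/-- Both vectors represent `β` on `D x`, and `g` is definite. This frees `sharp` from the arbitrary
choice of `onb`, so that smooth local frames can compute it. -/
theorem sharp_eq_sum {x : M} {e : Fin S.rank → TangentSpace (𝓡 m) x}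
    (he : IsOrthonormalBasisOf (S.D x) (S.g x) e) (β : TangentSpace (𝓡 m) x →L[ℝ] ℝ) :
    S.sharp x β = ∑ i, β (e i) • e i := by
  obtain ⟨⟨he, hon⟩, hspan⟩ := he
  have hmem : ∑ i, β (e i) • e i ∈ S.D x :=
    Submodule.sum_mem _ fun i _ => Submodule.smul_mem _ _ (he i)
  have h1 : (⟨_, hmem⟩ : S.D x) = ∑ i, β (e i) • (⟨e i, he i⟩ : S.D x) := by
    ext
    simp
  have key : ∀ v : S.D x, S.g x ⟨_, hmem⟩ v = β v := by
    intro v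
    have h2 : (v : TangentSpace (𝓡 m) x) ∈ Submodule.span ℝ (Set.range e) := by
      rw [hspan]; exact v.2
    obtain ⟨c, hc⟩ := (Submodule.mem_span_range_iff_exists_fun ℝ).1 h2
    have h3 : v = ∑ i, c i • (⟨e i, he i⟩ : S.D x) := by
      ext
      simp [← hc]
    have h4 : β v = ∑ i, c i * β (e i) := by
      rw [← hc]; simp
    rw [h4, h1, h3]
    simp only [map_sum, LinearMap.sum_apply, map_smul, LinearMap.smul_apply, hon, smul_eq_mul]
    simp
  by_contra hne
  set w : S.D x := ⟨S.sharp x β, S.sharp_mem x β⟩ - ⟨_, hmem⟩ with hw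
  have hw0 : w ≠ 0 := by
    intro h
    exact hne (congrArg Subtype.val (sub_eq_zero.1 h))
  have := S.g_pos x w hw0
  have h0 : S.g x w w = 0 := by
    conv_lhs => arg 1; rw [hw, map_sub]
    rw [LinearMap.sub_apply, S.sharp_spec, key, sub_self]
  rw [h0] at this
  exact lt_irrefl _ this

theorem apply_sharp (x : M) (β γ : TangentSpace (𝓡 m) x →L[ℝ] ℝ) :
    γ (S.sharp x β) = ∑ i, β (S.onb x i) * γ (S.onb x i) := by
  simp [sharp]

/-- Finitely many global smooth sections of `D` forming a Parseval frame at each point. -/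
theorem exists_parseval_frame : ∃ (N : ℕ) (Z : Fin N → VField m M),
    (∀ k, SmoothField (Z k)) ∧ (∀ k, S.IsHorizontalField (Z k)) ∧
      ∀ x (β : TangentSpace (𝓡 m) x →L[ℝ] ℝ), S.sharp x β = ∑ k, β (Z k x) • Z k x := by
  choose U hU X hX hon using S.exists_frame
  obtain ⟨N, c, χ, hχ, hs, h1⟩ := exists_sq_partition (m := m) (fun x => interior_mem_nhds.2 (hU x))
  let e := (finProdFinEquiv (m := N) (n := S.rank)).symm
  have hsup : ∀ k y, y ∉ U (c k) → χ k y = 0 := fun k y hy =>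
    image_eq_zero_of_notMem_tsupport fun h => hy (interior_subset (hs k h))
  refine ⟨_, fun l y => χ (e l).1 y • X (c (e l).1) (e l).2 y, fun l => ?_, fun l y => ?_,
    fun y β => ?_⟩
  · refine SmoothField.smul_of_tsupport (hχ _) fun y hy => ?_
    have h : U (c (e l).1) ∈ 𝓝 y := mem_interior_iff_mem_nhds.1 (hs _ hy)
    exact (hX _ _).contMDiffAt h
  · change χ (e l).1 y • X (c (e l).1) (e l).2 y ∈ S.D y
    by_cases hy : y ∈ U (c (e l).1)
    · exact Submodule.smul_mem _ _ ((hon _ y hy).1.choose _)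
    · rw [hsup _ _ hy, zero_smul]
      exact Submodule.zero_mem _
  · rw [Equiv.sum_comp e (fun p => β (χ p.1 y • X (c p.1) p.2 y) • χ p.1 y • X (c p.1) p.2 y),
      Fintype.sum_prod_type]
    -- Each local orthonormal frame reproduces ♯β with weight `χ k ^ 2`, and these weights sum to
    -- one.
    have : ∀ k, ∑ i, β (χ k y • X (c k) i y) • χ k y • X (c k) i y = χ k y ^ 2 • S.sharp y β := by
      intro k
      by_cases hy : y ∈ U (c k)
      · rw [S.sharp_eq_sum (hon _ y hy), Finset.smul_sum]
        refine Finset.sum_congr rfl fun i _ => ?_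
        rw [map_smul, smul_eq_mul, smul_smul, smul_smul]
        ring_nf
      · simp [hsup _ _ hy]
    simp only [this]
    rw [← Finset.sum_smul, h1, one_smul]

/-- A form β satisfies ♯β = Y when its value on each frame field is the corresponding coefficient of
Y. Such a form is built from differentials dψ_i that are dual to the frame at `x`, hence nearly dual
close to `x`, corrected by an inverse matrix. -/
theorem exists_local_sharp_eq {Y : VField m M} (hY : SmoothField Y) (hD : S.IsHorizontalField Y)
    (x : M) : ∃ U ∈ 𝓝 x, ∃ β : Form1 m M, ∀ y ∈ U, SmoothForm1At β y ∧ S.sharp y (β y) = Y y := by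
  obtain ⟨U, hU, X, hX, hon⟩ := S.exists_frame x
  have hXx : ∀ i, ∀ y ∈ interior U, SmoothFieldAt (X i) y := fun i y hy =>
    (hX i).contMDiffAt (mem_interior_iff_mem_nhds.1 hy)
  let F : (Fin S.rank → ℝ) →ₗ[ℝ] TangentSpace (𝓡 m) x := Fintype.linearCombination ℝ (fun i => X i x)
  have hF : LinearMap.ker F = ⊥ := by
    obtain ⟨⟨he, ho⟩, -⟩ := hon x (mem_of_mem_nhds hU)
    rw [LinearMap.ker_eq_bot']
    intro c hc
    rw [Fintype.linearCombination_apply] at hc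
    have h0 : (∑ i, c i • (⟨X i x, he i⟩ : S.D x)) = 0 := by
      ext
      simpa using hc
    ext j
    have := congrArg (fun w => S.g x w ⟨X j x, he j⟩) h0
    simp only [map_sum, LinearMap.sum_apply, map_smul, LinearMap.smul_apply, ho] at this
    simpa using this
  -- The components of `L` extend the dual basis of the frame from `D x` to the whole tangent space;
  -- each `ψ i` is linear in the chart with this component as its differential at `x`.
  obtain ⟨L, hL⟩ := F.exists_leftInverse_of_injective hF
  let ψ : Fin S.rank → M → ℝ := fun i y => ∑ k, L (coordField x k x) i * coordFn x k y
  have hψ : ∀ i, ∀ y ∈ (chartAt (EuclideanSpace ℝ (Fin m)) x).source,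
      ContMDiffAt (𝓡 m) 𝓘(ℝ, ℝ) ∞ (ψ i) y := fun i y hy =>
    contMDiffAt_finsetSum fun k _ => contMDiffAt_const.mul (contMDiffAt_coordFn hy k)
  have hψx : ∀ i v, mvfderiv (𝓡 m) (ψ i) x v = L v i := by
    intro i v
    have hx := mem_chart_source (EuclideanSpace ℝ (Fin m)) x
    have hd : ∀ k, MDifferentiableAt (𝓡 m) 𝓘(ℝ, ℝ) (coordFn x k) x := fun k =>
      (contMDiffAt_coordFn hx k).mdifferentiableAt (by simp)
    have h1 : mvfderiv (𝓡 m) (ψ i) x =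
        ∑ k, mvfderiv (𝓡 m) (fun y => L (coordField x k x) i * coordFn x k y) x :=
      mvfderiv_finset_sum fun k _ => contMDiffAt_const.mul (contMDiffAt_coordFn hx k)
    rw [h1]
    simp only [mvfderiv_const_mul _ (hd _), sum_apply, smul_apply, smul_eq_mul]
    conv_rhs => rw [← sum_mvfderiv_coordFn_smul_coordField hx v]
    simp [mul_comm]
  let A : M → Matrix (Fin S.rank) (Fin S.rank) ℝ := fun y => Matrix.of fun i k =>
    mvfderiv (𝓡 m) (ψ i) y (X k y)
  have hA : A x = 1 := by
    ext i k
    have h := congrFun (LinearMap.congr_fun hL (Pi.single k 1)) i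
    simp only [F, LinearMap.comp_apply, Fintype.linearCombination_apply_single, one_smul,
      LinearMap.id_apply] at h
    simp only [A, Matrix.of_apply, hψx, h, Matrix.one_apply, Pi.single_apply]
  have hAs : ∀ y ∈ interior U ∩ (chartAt (EuclideanSpace ℝ (Fin m)) x).source, ∀ i j,
      ContMDiffAt (𝓡 m) 𝓘(ℝ, ℝ) ∞ (fun y => A y i j) y :=
    fun y hy i j => contMDiffAt_mvfderiv_apply (hψ i y hy.2) (hXx j y hy.1)
  have hdet : ∀ᶠ y in 𝓝 x, (A y).det ≠ 0 := by
    have h := (contMDiffAt_det (hAs x ⟨mem_interior_iff_mem_nhds.2 hU,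
      mem_chart_source _ x⟩)).continuousAt
    exact h.eventually_ne (by simp [hA])
  have hAinv : ∀ y ∈ interior U ∩ (chartAt (EuclideanSpace ℝ (Fin m)) x).source, (A y).det ≠ 0 →
      ∀ i j, ContMDiffAt (𝓡 m) 𝓘(ℝ, ℝ) ∞ (fun y => (A y)⁻¹ i j) y :=
    fun y hy hd i j => contMDiffAt_matrix_inv (hAs y hy) hd i j
  -- If Y = Σ a_k X_k, then dψ(Y) = A a, so `c` recovers `a` by a visibly smooth formula; the row
  -- vector b = cA⁻¹ then makes Σ b_i dψ_i take the value c_k on X_k.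
  let c : Fin S.rank → M → ℝ := fun i y => ∑ j, (A y)⁻¹ i j * mvfderiv (𝓡 m) (ψ j) y (Y y)
  let b : Fin S.rank → M → ℝ := fun i y => ∑ j, c j y * (A y)⁻¹ j i
  refine ⟨(interior U ∩ (chartAt (EuclideanSpace ℝ (Fin m)) x).source) ∩ {y | (A y).det ≠ 0}, ?_,
    fun y => ∑ i, b i y • mvfderiv (𝓡 m) (ψ i) y, fun y hy => ⟨?_, ?_⟩⟩
  · exact Filter.inter_mem (Filter.inter_mem (interior_mem_nhds.2 hU) (chart_source_mem_nhds _ x))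
      hdet
  · refine SmoothForm1At.sum fun i _ => SmoothForm1At.smul ?_ 
      (smoothForm1At_mvfderiv (hψ i y hy.1.2))
    exact contMDiffAt_finsetSum fun j _ => (contMDiffAt_finsetSum fun k _ =>
      (hAinv y hy.1 hy.2 j k).mul (contMDiffAt_mvfderiv_apply (hψ k y hy.1.2) (hY y))).mul
        (hAinv y hy.1 hy.2 j i)
  · have hon' := hon y (interior_subset hy.1.1)
    obtain ⟨a, ha⟩ := (Submodule.mem_span_range_iff_exists_fun ℝ).1
      (by rw [hon'.2]; exact hD y : Y y ∈ Submodule.span ℝ (Set.range fun i => X i y))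
    have hunit : IsUnit (A y).det := isUnit_iff_ne_zero.2 hy.2
    have hc : ∀ i, c i y = a i := by
      have h1 : ∀ j, mvfderiv (𝓡 m) (ψ j) y (Y y) = (A y).mulVec a j := by
        intro j
        rw [← ha, map_sum]
        simp [A, Matrix.mulVec, dotProduct, mul_comm]
      have h2 : (fun i => c i y) = (A y)⁻¹.mulVec ((A y).mulVec a) := by
        ext i
        simp only [c, h1, Matrix.mulVec, dotProduct]
      rw [Matrix.mulVec_mulVec, Matrix.nonsing_inv_mul _ hunit, Matrix.one_mulVec] at h2
      exact fun i => congrFun h2 i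
    rw [S.sharp_eq_sum hon', ← ha]
    refine Finset.sum_congr rfl fun k _ => ?_
    congr 1
    have h3 : (∑ i, b i y • mvfderiv (𝓡 m) (ψ i) y) (X k y) =
        Matrix.vecMul (Matrix.vecMul a (A y)⁻¹) (A y) k := by
      simp only [b, hc, sum_apply, smul_apply, smul_eq_mul, Matrix.vecMul, dotProduct, A,
        Matrix.of_apply]
    rw [h3, Matrix.vecMul_vecMul, Matrix.nonsing_inv_mul _ hunit, Matrix.vecMul_one]

/-- The map `♯` from smooth one-forms to smooth sections of `D` is surjective. -/
theorem exists_form_sharp_eq {Y : VField m M} (hY : SmoothField Y) (hD : S.IsHorizontalField Y) :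
    ∃ β : Form1 m M, SmoothForm1 β ∧ ∀ x, S.sharp x (β x) = Y x := by
  choose U hU β hβ using S.exists_local_sharp_eq hY hD
  obtain ⟨N, c, χ, hχ, hs, h1⟩ := exists_sq_partition (m := m) hU
  -- One factor `χ k` already makes the local form globally smooth; the second produces the weight
  -- `χ k ^ 2` needed for the partition.
  refine ⟨fun y => ∑ k, χ k y • χ k y • β (c k) y, fun y => ?_, fun y => ?_⟩
  · refine SmoothForm1At.sum fun k _ => SmoothForm1At.smul (hχ k y) ?_
    exact SmoothForm1.smul_of_tsupport (hχ k) (fun z hz => (hβ _ z (hs k hz)).1) y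
  · have hlin : ∀ β' : TangentSpace (𝓡 m) y →L[ℝ] ℝ,
        S.sharp y β' = ∑ i, β' (S.onb y i) • S.onb y i := fun _ => rfl
    have : ∀ k, S.sharp y (χ k y • χ k y • β (c k) y) = χ k y ^ 2 • Y y := by
      intro k
      by_cases hy : y ∈ U (c k)
      · rw [← (hβ _ y hy).2, hlin, hlin, Finset.smul_sum]
        refine Finset.sum_congr rfl fun i _ => ?_
        simp only [smul_apply, smul_eq_mul, smul_smul]
        ring_nf
      · have : χ k y = 0 := image_eq_zero_of_notMem_tsupport fun h => hy (hs k h)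
        simp [this, hlin]
    rw [hlin]
    simp only [sum_apply, Finset.sum_smul]
    rw [Finset.sum_comm]
    simp only [← hlin, this]
    rw [← Finset.sum_smul, h1, one_smul]

end SubRiemannianStructure

end Frames
end
end SubRiem

namespace SubRiem
noncomputable section

/-! ### The divergence in a chart, and its relation to compatible connections. -/

section Divergence

set_option linter.unusedSectionVars false

variable {m : ℕ} {M : Type*} [TopologicalSpace M] [ChartedSpace (EuclideanSpace ℝ (Fin m)) M]
  [IsManifold (𝓡 m) ∞ M]

theorem contMDiffAt_extChartAt_symm_apply {x₀ p : M}
    (hp : p ∈ (chartAt (EuclideanSpace ℝ (Fin m)) x₀).source) :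
    ContMDiffAt 𝓘(ℝ, EuclideanSpace ℝ (Fin m)) (𝓡 m) ∞ (extChartAt (𝓡 m) x₀).symm
      (extChartAt (𝓡 m) x₀ p) := by
  have hp' : p ∈ (extChartAt (𝓡 m) x₀).source := by simpa using hp
  exact (contMDiffOn_extChartAt_symm x₀).contMDiffAt
    ((isOpen_extChartAt_target x₀).mem_nhds ((extChartAt (𝓡 m) x₀).map_source hp'))

theorem contDiffAt_comp_extChartAt_symm {F : Type*} [NormedAddCommGroup F] [NormedSpace ℝ F]
    {x₀ p : M} (hp : p ∈ (chartAt (EuclideanSpace ℝ (Fin m)) x₀).source) {φ : M → F}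
    (hφ : ContMDiffAt (𝓡 m) 𝓘(ℝ, F) ∞ φ p) :
    ContDiffAt ℝ ∞ (fun y => φ ((extChartAt (𝓡 m) x₀).symm y)) (extChartAt (𝓡 m) x₀ p) := by
  have hp' : p ∈ (extChartAt (𝓡 m) x₀).source := by simpa using hp
  rw [← contMDiffAt_iff_contDiffAt]
  have h : (extChartAt (𝓡 m) x₀).symm (extChartAt (𝓡 m) x₀ p) = p :=
    (extChartAt (𝓡 m) x₀).left_inv hp'
  exact ContMDiffAt.comp _ (by rwa [h]) (contMDiffAt_extChartAt_symm_apply hp)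

theorem contDiffAt_fieldInChart {x₀ p : M}
    (hp : p ∈ (chartAt (EuclideanSpace ℝ (Fin m)) x₀).source) {X : VField m M}
    (hX : SmoothFieldAt X p) :
    ContDiffAt ℝ ∞ (fieldInChart x₀ X) (extChartAt (𝓡 m) x₀ p) :=
  contDiffAt_comp_extChartAt_symm hp
    (contMDiffAt_mvfderiv_apply (contMDiffAt_extChartAt_of_mem hp) hX)

theorem fieldInChart_extChartAt {x₀ p : M}
    (hp : p ∈ (chartAt (EuclideanSpace ℝ (Fin m)) x₀).source) (X : VField m M) :
    fieldInChart x₀ X (extChartAt (𝓡 m) x₀ p) = mvfderiv (𝓡 m) (extChartAt (𝓡 m) x₀) p (X p) := by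
  have hp' : p ∈ (extChartAt (𝓡 m) x₀).source := by simpa using hp
  unfold fieldInChart
  rw [(extChartAt (𝓡 m) x₀).left_inv hp']

/-- Chain rule through the chart: the directional derivative Xφ is computed by the coordinate
expressions of φ and X. -/
theorem fderiv_comp_symm_fieldInChart {F : Type*} [NormedAddCommGroup F] [NormedSpace ℝ F]
    {x₀ p : M} (hp : p ∈ (chartAt (EuclideanSpace ℝ (Fin m)) x₀).source) {φ : M → F}
    (hφ : MDifferentiableAt (𝓡 m) 𝓘(ℝ, F) φ p) (X : VField m M) :
    fderiv ℝ (fun y => φ ((extChartAt (𝓡 m) x₀).symm y)) (extChartAt (𝓡 m) x₀ p)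
      (fieldInChart x₀ X (extChartAt (𝓡 m) x₀ p)) = mvfderiv (𝓡 m) φ p (X p) := by
  have hp' : p ∈ (extChartAt (𝓡 m) x₀).source := by simpa using hp
  have h : (extChartAt (𝓡 m) x₀).symm (extChartAt (𝓡 m) x₀ p) = p :=
    (extChartAt (𝓡 m) x₀).left_inv hp'
  rw [fieldInChart_extChartAt hp]
  have hg : MDifferentiableAt 𝓘(ℝ, EuclideanSpace ℝ (Fin m)) 𝓘(ℝ, F)
      (fun y => φ ((extChartAt (𝓡 m) x₀).symm y)) (extChartAt (𝓡 m) x₀ p) :=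
    MDifferentiableAt.comp (I' := 𝓡 m) _ (by rwa [h])
      ((contMDiffAt_extChartAt_symm_apply hp).mdifferentiableAt (by simp))
  have hc := mfderiv_comp p hg ((contMDiffAt_extChartAt_of_mem hp).mdifferentiableAt (by simp))
  have he : (fun y => φ ((extChartAt (𝓡 m) x₀).symm y)) ∘ (extChartAt (𝓡 m) x₀) =ᶠ[𝓝 p] φ := by
    filter_upwards [(isOpen_extChartAt_source x₀).mem_nhds hp'] with q hq
    rw [Function.comp_apply, (extChartAt (𝓡 m) x₀).left_inv hq]
  rw [he.mfderiv_eq, mfderiv_eq_fderiv] at hc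
  exact (DFunLike.congr_fun hc (X p)).symm

variable [MeasurableSpace M] (vol : VolumeDensity m M)

/-- The divergence of `X` at `p`, computed in the chart around `x₀`. -/
def VolumeDensity.divIn (x₀ : M) (X : VField m M) (p : M) : ℝ :=
  (vol.ρ x₀ (extChartAt (𝓡 m) x₀ p))⁻¹ *
    LinearMap.trace ℝ (EuclideanSpace ℝ (Fin m))
      (fderiv ℝ (fun y => vol.ρ x₀ y • fieldInChart x₀ X y) (extChartAt (𝓡 m) x₀ p)).toLinearMap

theorem VolumeDensity.div_eq_divIn (X : VField m M) (p : M) : vol.div X p = vol.divIn p X p := rfl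

theorem VolumeDensity.contDiffAt_ρ {x₀ p : M}
    (hp : p ∈ (chartAt (EuclideanSpace ℝ (Fin m)) x₀).source) :
    ContDiffAt ℝ ∞ (vol.ρ x₀) (extChartAt (𝓡 m) x₀ p) := by
  have hp' : p ∈ (extChartAt (𝓡 m) x₀).source := by simpa using hp
  exact (vol.smooth x₀).contDiffAt
    ((isOpen_extChartAt_target x₀).mem_nhds ((extChartAt (𝓡 m) x₀).map_source hp'))

theorem VolumeDensity.ρ_pos {x₀ p : M}
    (hp : p ∈ (chartAt (EuclideanSpace ℝ (Fin m)) x₀).source) :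
    0 < vol.ρ x₀ (extChartAt (𝓡 m) x₀ p) := by
  have hp' : p ∈ (extChartAt (𝓡 m) x₀).source := by simpa using hp
  exact vol.pos _ _ ((extChartAt (𝓡 m) x₀).map_source hp')

theorem eventually_extChartAt_symm {x₀ p : M}
    (hp : p ∈ (chartAt (EuclideanSpace ℝ (Fin m)) x₀).source) {P : M → Prop}
    (h : ∀ᶠ q in 𝓝 p, P q) :
    ∀ᶠ y in 𝓝 (extChartAt (𝓡 m) x₀ p), P ((extChartAt (𝓡 m) x₀).symm y) := by
  have hp' : p ∈ (extChartAt (𝓡 m) x₀).source := by simpa using hp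
  have hc := (contMDiffAt_extChartAt_symm_apply hp).continuousAt
  rw [ContinuousAt, (extChartAt (𝓡 m) x₀).left_inv hp'] at hc
  exact hc.eventually h

theorem VolumeDensity.divIn_congr {x₀ p : M}
    (hp : p ∈ (chartAt (EuclideanSpace ℝ (Fin m)) x₀).source) {X X' : VField m M}
    (h : ∀ᶠ q in 𝓝 p, X q = X' q) : vol.divIn x₀ X p = vol.divIn x₀ X' p := by
  unfold VolumeDensity.divIn
  congr 3
  apply Filter.EventuallyEq.fderiv_eq
  filter_upwards [eventually_extChartAt_symm hp h] with y hy
  rw [fieldInChart, fieldInChart, hy]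

theorem VolumeDensity.differentiableAt_ρ_smul {x₀ p : M}
    (hp : p ∈ (chartAt (EuclideanSpace ℝ (Fin m)) x₀).source) {X : VField m M}
    (hX : SmoothFieldAt X p) :
    DifferentiableAt ℝ (fun y => vol.ρ x₀ y • fieldInChart x₀ X y) (extChartAt (𝓡 m) x₀ p) :=
  ((vol.contDiffAt_ρ hp).smul (contDiffAt_fieldInChart hp hX)).differentiableAt (by simp)

/-- Differentiating the product adds the rank-one map dφ ⊗ ρX, whose trace is ρ · Xφ; the density
then cancels. -/
theorem VolumeDensity.divIn_smul {x₀ p : M}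
    (hp : p ∈ (chartAt (EuclideanSpace ℝ (Fin m)) x₀).source) {X : VField m M} {φ : M → ℝ}
    (hφ : ContMDiffAt (𝓡 m) 𝓘(ℝ, ℝ) ∞ φ p) (hX : SmoothFieldAt X p) :
    vol.divIn x₀ (fun q => φ q • X q) p =
      φ p * vol.divIn x₀ X p + mvfderiv (𝓡 m) φ p (X p) := by
  have hp' : p ∈ (extChartAt (𝓡 m) x₀).source := by simpa using hp
  have h1 : (fun y => vol.ρ x₀ y • fieldInChart x₀ (fun q => φ q • X q) y) =
      fun y => φ ((extChartAt (𝓡 m) x₀).symm y) • (vol.ρ x₀ y • fieldInChart x₀ X y) := by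
    ext1 y
    simp only [fieldInChart, map_smul, smul_smul, mul_comm]
  have h2 := (contDiffAt_comp_extChartAt_symm hp hφ).differentiableAt (by simp)
  have h3 := vol.differentiableAt_ρ_smul hp hX
  have hρ := (vol.ρ_pos hp).ne'
  unfold VolumeDensity.divIn
  rw [h1, fderiv_fun_smul h2 h3]
  have h4 := fderiv_comp_symm_fieldInChart hp (hφ.mdifferentiableAt (by simp)) X
  have h5 : ∀ (l : EuclideanSpace ℝ (Fin m) →L[ℝ] ℝ) (w : EuclideanSpace ℝ (Fin m)),
      LinearMap.trace ℝ (EuclideanSpace ℝ (Fin m)) (l.smulRight w).toLinearMap = l w := fun l w =>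
    LinearMap.trace_smulRight l.toLinearMap w
  rw [ContinuousLinearMap.toLinearMap_add, map_add, h5, map_smul, h4,
    ContinuousLinearMap.toLinearMap_smul, map_smul, (extChartAt (𝓡 m) x₀).left_inv hp']
  simp only [smul_eq_mul]
  field_simp

theorem VolumeDensity.divIn_add {x₀ p : M}
    (hp : p ∈ (chartAt (EuclideanSpace ℝ (Fin m)) x₀).source) {X X' : VField m M}
    (hX : SmoothFieldAt X p) (hX' : SmoothFieldAt X' p) :
    vol.divIn x₀ (fun q => X q + X' q) p = vol.divIn x₀ X p + vol.divIn x₀ X' p := by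
  have h1 : (fun y => vol.ρ x₀ y • fieldInChart x₀ (fun q => X q + X' q) y) =
      fun y => vol.ρ x₀ y • fieldInChart x₀ X y + vol.ρ x₀ y • fieldInChart x₀ X' y := by
    ext1 y
    simp only [fieldInChart, map_add, smul_add]
  have h3 := vol.differentiableAt_ρ_smul hp hX
  have h4 := vol.differentiableAt_ρ_smul hp hX'
  unfold VolumeDensity.divIn
  rw [h1, fderiv_fun_add h3 h4, ContinuousLinearMap.toLinearMap_add, map_add, mul_add]

theorem mvfderiv_congr {F : Type*} [NormedAddCommGroup F] [NormedSpace ℝ F] {φ φ' : M → F}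
    {x : M} (h : φ =ᶠ[𝓝 x] φ') : mvfderiv (𝓡 m) φ x = mvfderiv (𝓡 m) φ' x := by
  ext1 v
  exact DFunLike.congr_fun h.mfderiv_eq v

theorem covDerivForm_smul (nabla : Connection m M) {φ : M → ℝ} {β : Form1 m M} {x : M}
    (hφ : ContMDiffAt (𝓡 m) 𝓘(ℝ, ℝ) ∞ φ x) (hβ : SmoothForm1At β x)
    (v w : TangentSpace (𝓡 m) x) :
    covDerivForm nabla (fun y => φ y • β y) x v w =
      φ x * covDerivForm nabla β x v w + mvfderiv (𝓡 m) φ x v * β x w := by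
  have h := mvfderiv_mul (hφ.mdifferentiableAt (by simp))
    ((hβ.apply (SmoothFieldAt.extend w)).mdifferentiableAt (by simp))
  unfold covDerivForm
  have h' := DFunLike.congr_fun h v
  simp only [smul_apply, smul_eq_mul]
  refine (congrArg (· - _) h').trans ?_
  simp only [add_apply, smul_apply, smul_eq_mul, FiberBundle.extend_apply_self]
  ring

theorem covDerivForm_add (nabla : Connection m M) {β β' : Form1 m M} {x : M}
    (hβ : SmoothForm1At β x) (hβ' : SmoothForm1At β' x) (v w : TangentSpace (𝓡 m) x) :
    covDerivForm nabla (fun y => β y + β' y) x v w =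
      covDerivForm nabla β x v w + covDerivForm nabla β' x v w := by
  have h := mvfderiv_add ((hβ.apply (SmoothFieldAt.extend w)).mdifferentiableAt (by simp))
    ((hβ'.apply (SmoothFieldAt.extend w)).mdifferentiableAt (by simp))
  unfold covDerivForm
  have h' := DFunLike.congr_fun h v
  simp only [add_apply]
  refine (congrArg (· - _) h').trans ?_
  simp only [add_apply]
  ring

theorem covDerivForm_congr (nabla : Connection m M) {β β' : Form1 m M} {x : M}
    (h : ∀ᶠ y in 𝓝 x, β y = β' y) (v w : TangentSpace (𝓡 m) x) :
    covDerivForm nabla β x v w = covDerivForm nabla β' x v w := by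
  unfold covDerivForm
  have h1 : (fun y => β y (FiberBundle.extend (EuclideanSpace ℝ (Fin m)) w y)) =ᶠ[𝓝 x]
      fun y => β' y (FiberBundle.extend (EuclideanSpace ℝ (Fin m)) w y) :=
    h.mono fun y hy => by simp only [hy]
  rw [mvfderiv_congr h1, h.self_of_nhds]

variable [T2Space M] [CompactSpace M] (S : SubRiemannianStructure m M)

/-- The bases `onb` are chosen pointwise without any continuity, so smoothness has to be read off a
Parseval frame. -/
theorem SmoothForm1At.sharp {β : Form1 m M} {x : M} (hβ : SmoothForm1At β x) :
    SmoothFieldAt (fun y => S.sharp y (β y)) x := by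
  obtain ⟨N, Z, hZ, -, h⟩ := S.exists_parseval_frame
  simp only [h]
  exact SmoothFieldAt.sum fun k _ => SmoothFieldAt.smul (hβ.apply (hZ k x)) (hZ k x)

theorem SubRiemannianStructure.sharp_add (x : M) (β β' : TangentSpace (𝓡 m) x →L[ℝ] ℝ) :
    S.sharp x (β + β') = S.sharp x β + S.sharp x β' := by
  simp [SubRiemannianStructure.sharp, add_smul, Finset.sum_add_distrib]

theorem SubRiemannianStructure.sharp_smul (x : M) (c : ℝ) (β : TangentSpace (𝓡 m) x →L[ℝ] ℝ) :
    S.sharp x (c • β) = c • S.sharp x β := by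
  simp [SubRiemannianStructure.sharp, Finset.smul_sum, smul_smul]

/-- For a connection compatible with the volume, `tr_g ∇β = div ♯β` for all smooth one-forms. -/
theorem trace_covDerivForm_eq_div (nabla : Connection m M)
    (hlap : ∀ φ : M → ℝ, ContMDiff (𝓡 m) 𝓘(ℝ, ℝ) ∞ φ → ∀ x,
      S.trace x (covDerivForm nabla (fun y => mvfderiv (𝓡 m) φ y) x) = subLaplacian S vol φ x)
    {β : Form1 m M} {x : M} (hβ : SmoothForm1At β x) :
    S.trace x (covDerivForm nabla β x) = vol.div (fun y => S.sharp y (β y)) x := by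
  have hx := mem_chart_source (EuclideanSpace ℝ (Fin m)) x
  -- The hypothesis `hlap` speaks only of functions smooth on all of `M`, hence the cut-off of the
  -- coordinates.
  obtain ⟨χ, hχ, hχ1, hs, -⟩ := exists_bump (m := m) (chart_source_mem_nhds (EuclideanSpace ℝ (Fin m)) x)
  let ψ : Fin m → M → ℝ := fun i y => χ y * coordFn x i y
  have hψ : ∀ i, ContMDiff (𝓡 m) 𝓘(ℝ, ℝ) ∞ (ψ i) := fun i =>
    contMDiff_mul_of_tsupport hχ fun y hy => contMDiffAt_coordFn (hs hy) i
  let φ : Fin m → M → ℝ := fun i y => β y (coordField x i y)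
  have hφ : ∀ i, ContMDiffAt (𝓡 m) 𝓘(ℝ, ℝ) ∞ (φ i) x := fun i =>
    hβ.apply (smoothFieldAt_coordField hx i)
  have hdec : ∀ᶠ y in 𝓝 x, ∑ i, φ i y • mvfderiv (𝓡 m) (ψ i) y = β y := by
    filter_upwards [hχ1.eventually_nhds, chart_source_mem_nhds (EuclideanSpace ℝ (Fin m)) x]
      with y hy hys
    have h1 : ∀ i, mvfderiv (𝓡 m) (ψ i) y = mvfderiv (𝓡 m) (coordFn x i) y := by
      intro i
      have : ψ i =ᶠ[𝓝 y] coordFn x i := hy.mono fun z hz => by simp [ψ, hz]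
      exact mvfderiv_congr this
    ext v
    conv_rhs => rw [← sum_mvfderiv_coordFn_smul_coordField hys v]
    simp [h1, φ, mul_comm]
  -- Both sides are additive and satisfy the same Leibniz rule: the extra term tr_g(dφ ⊗ dψ) on the
  -- left equals dφ(♯dψ), the extra term of the divergence. So agreement on the exact forms dψ_i
  -- passes to Σ φ_i dψ_i, which is β near `x`.
  have key : ∀ s : Finset (Fin m),
      SmoothForm1At (fun y => ∑ i ∈ s, φ i y • mvfderiv (𝓡 m) (ψ i) y) x ∧
      S.trace x (covDerivForm nabla (fun y => ∑ i ∈ s, φ i y • mvfderiv (𝓡 m) (ψ i) y) x) =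
        vol.div (fun y => S.sharp y (∑ i ∈ s, φ i y • mvfderiv (𝓡 m) (ψ i) y)) x := by
    intro s
    have hterm : ∀ i, SmoothForm1At (fun y => φ i y • mvfderiv (𝓡 m) (ψ i) y) x := fun i =>
      SmoothForm1At.smul (hφ i) (smoothForm1At_mvfderiv (hψ i x))
    induction s using Finset.induction_on with
    | empty =>
      refine ⟨SmoothForm1At.sum fun i hi => hterm i, ?_⟩
      have h0 : ∀ y, S.sharp y 0 = 0 := fun y => by simp [SubRiemannianStructure.sharp]
      have h1 : mvfderiv (𝓡 m) (fun _ : M => (0 : ℝ)) x = 0 := mvfderiv_const _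
      have h2 : (fun y : M => ∑ i ∈ (∅ : Finset (Fin m)), φ i y • mvfderiv (𝓡 m) (ψ i) y) =
          fun y => 0 := by ext1; exact Finset.sum_empty
      have h3 : ∀ y : M, S.sharp y (∑ i ∈ (∅ : Finset (Fin m)),
          φ i y • mvfderiv (𝓡 m) (ψ i) y) = 0 := fun y => by
        rw [Finset.sum_empty, h0]
      rw [h2]
      simp only [h3]
      simp only [VolumeDensity.div, fieldInChart, map_zero, smul_zero]
      simp [SubRiemannianStructure.trace, covDerivForm, h1]
    | insert i s hi ih =>
      refine ⟨SmoothForm1At.sum fun i hi => hterm i, ?_⟩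
      simp only [Finset.sum_insert hi, S.sharp_add, S.sharp_smul]
      rw [vol.div_eq_divIn, vol.divIn_add hx (SmoothFieldAt.smul (hφ i)
        ((smoothForm1At_mvfderiv (hψ i x)).sharp S)) (ih.1.sharp S),
        vol.divIn_smul hx (hφ i) ((smoothForm1At_mvfderiv (hψ i x)).sharp S), 
        ← vol.div_eq_divIn, ← vol.div_eq_divIn, ← ih.2]
      have h1 := hlap _ (hψ i) x
      rw [subLaplacian] at h1
      rw [← h1]
      simp only [SubRiemannianStructure.trace]
      simp only [covDerivForm_add nabla (hterm i) ih.1,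
        covDerivForm_smul nabla (hφ i) (smoothForm1At_mvfderiv (hψ i x)), S.apply_sharp,
        Finset.sum_add_distrib]
      rw [Finset.mul_sum]
      simp only [mul_comm]
  have h1 := (key Finset.univ).2
  simp only [SubRiemannianStructure.trace] at h1 ⊢
  simp only [covDerivForm_congr nabla hdec] at h1
  rw [h1]
  exact vol.divIn_congr hx (hdec.mono fun y hy => by simp only [hy])

end Divergence
end
end SubRiem

namespace SubRiem
noncomputable section

/-! ### Integration in charts and the divergence theorem. -/

section Integration

set_option linter.unusedSectionVars false

open MeasureTheory

variable {m : ℕ}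

/-- Integration by parts against the constant function 1. -/
theorem integral_fderiv_eq_zero {E : Type*} [NormedAddCommGroup E] [NormedSpace ℝ E]
    [FiniteDimensional ℝ E] [MeasurableSpace E] [BorelSpace E] (μ : Measure E)
    [μ.IsAddHaarMeasure] {g : E → ℝ} (hg : ContDiff ℝ 1 g) (hc : HasCompactSupport g) (v : E) :
    ∫ y, fderiv ℝ g y v ∂μ = 0 := by
  have h1 : Integrable (fun y => fderiv ℝ g y v) μ :=
    ((hg.continuous_fderiv (by simp)).clm_apply continuous_const).integrable_of_hasCompactSupport
      (hc.fderiv_apply (𝕜 := ℝ) v)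
  have h4 := integral_mul_fderiv_eq_neg_fderiv_mul_of_integrable (μ := μ) (𝕜 := ℝ)
    (f := fun _ : E => (1 : ℝ)) (g := g) (v := v)
    (by simp) (by simpa using h1)
    (by simpa using hg.continuous.integrable_of_hasCompactSupport hc)
    (fun _ _ => by simp) (fun y _ => hg.differentiable (by simp) y)
  simpa using h4

theorem integral_trace_fderiv_eq_zero {W : EuclideanSpace ℝ (Fin m) → EuclideanSpace ℝ (Fin m)}
    (hW : ContDiff ℝ 1 W) (hc : HasCompactSupport W) :
    ∫ y, LinearMap.trace ℝ (EuclideanSpace ℝ (Fin m)) (fderiv ℝ W y).toLinearMap = 0 := by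
  have hg : ∀ i, ContDiff ℝ 1 fun y => W y i := fun i =>
    (EuclideanSpace.proj (𝕜 := ℝ) i).contDiff.comp hW
  have hgc : ∀ i, HasCompactSupport fun y => W y i := fun i =>
    HasCompactSupport.comp_left (g := EuclideanSpace.proj (𝕜 := ℝ) i) hc (map_zero _)
  have h1 : ∀ y, LinearMap.trace ℝ (EuclideanSpace ℝ (Fin m)) (fderiv ℝ W y).toLinearMap =
      ∑ i, fderiv ℝ (fun y => W y i) y (EuclideanSpace.single i 1) := by
    intro y
    rw [LinearMap.trace_eq_matrix_trace ℝ (EuclideanSpace.basisFun (Fin m) ℝ).toBasis,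
      Matrix.trace]
    refine Finset.sum_congr rfl fun i _ => ?_
    have h := (EuclideanSpace.proj (𝕜 := ℝ) i).hasFDerivAt.comp y
      ((hW.differentiable (by simp)) y).hasFDerivAt
    have h' : fderiv ℝ (fun y => W y i) y = _ := h.fderiv
    rw [h']
    simp [LinearMap.toMatrix_apply]
  simp only [h1]
  rw [integral_finsetSum]
  · exact Finset.sum_eq_zero fun i _ => integral_fderiv_eq_zero _ (hg i) (hgc i) _
  · exact fun i _ => (((hg i).continuous_fderiv (by simp)).clm_apply
      continuous_const).integrable_of_hasCompactSupport ((hgc i).fderiv_apply (𝕜 := ℝ) _)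

variable {M : Type*} [TopologicalSpace M] [ChartedSpace (EuclideanSpace ℝ (Fin m)) M]
  [IsManifold (𝓡 m) ∞ M] [MeasurableSpace M] [BorelSpace M] (vol : VolumeDensity m M)

theorem isOpen_source (x₀ : M) : IsOpen (extChartAt (𝓡 m) x₀).source := isOpen_extChartAt_source x₀

theorem mem_source_iff {x₀ p : M} : p ∈ (extChartAt (𝓡 m) x₀).source ↔
    p ∈ (chartAt (EuclideanSpace ℝ (Fin m)) x₀).source := by simp

theorem aemeasurable_extChartAt (x₀ : M) :
    AEMeasurable (extChartAt (𝓡 m) x₀) (vol.μ.restrict (extChartAt (𝓡 m) x₀).source) :=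
  (continuousOn_extChartAt x₀).aemeasurable (isOpen_source x₀).measurableSet

theorem measurable_ρ_restrict (x₀ : M) :
    AEMeasurable (fun y => ENNReal.ofReal (vol.ρ x₀ y))
      (volume.restrict (extChartAt (𝓡 m) x₀).target) :=
  ((vol.smooth x₀).continuousOn.aemeasurable (isOpen_extChartAt_target x₀).measurableSet).ennreal_ofReal

/-- Integration of a nonnegative function in a chart. -/
theorem setLIntegral_chart (x₀ : M) {F : EuclideanSpace ℝ (Fin m) → ENNReal}
    (hF : AEMeasurable F (volume.restrict (extChartAt (𝓡 m) x₀).target)) :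
    ∫⁻ p in (extChartAt (𝓡 m) x₀).source, F (extChartAt (𝓡 m) x₀ p) ∂vol.μ =
      ∫⁻ y in (extChartAt (𝓡 m) x₀).target, ENNReal.ofReal (vol.ρ x₀ y) * F y := by
  have hF' : AEMeasurable F ((volume.restrict (extChartAt (𝓡 m) x₀).target).withDensity
      (fun y => ENNReal.ofReal (vol.ρ x₀ y))) := hF.mono_ac (withDensity_absolutelyContinuous _ _)
  rw [← lintegral_map' (by rwa [vol.map_chart]) (aemeasurable_extChartAt vol x₀), vol.map_chart,
    lintegral_withDensity_eq_lintegral_mul₀' (measurable_ρ_restrict vol x₀) hF']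
  rfl

theorem measure_chart (x₀ : M) {s : Set (EuclideanSpace ℝ (Fin m))} (hs : MeasurableSet s) :
    vol.μ ((extChartAt (𝓡 m) x₀).source ∩ extChartAt (𝓡 m) x₀ ⁻¹' s) =
      ∫⁻ y in s ∩ (extChartAt (𝓡 m) x₀).target, ENNReal.ofReal (vol.ρ x₀ y) := by
  have h := congrArg (fun ν => ν s) (vol.map_chart x₀)
  beta_reduce at h
  rw [Measure.map_apply_of_aemeasurable (aemeasurable_extChartAt vol x₀) hs,
    withDensity_apply _ hs, Measure.restrict_restrict hs,
    Measure.restrict_apply' (isOpen_source x₀).measurableSet, Set.inter_comm] at h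
  exact h

theorem setIntegral_chart (x₀ : M) {F : EuclideanSpace ℝ (Fin m) → ℝ}
    (hF : ContinuousOn F (extChartAt (𝓡 m) x₀).target) :
    ∫ p in (extChartAt (𝓡 m) x₀).source, F (extChartAt (𝓡 m) x₀ p) ∂vol.μ =
      ∫ y in (extChartAt (𝓡 m) x₀).target, vol.ρ x₀ y * F y := by
  have ht := (isOpen_extChartAt_target (I := 𝓡 m) x₀).measurableSet
  have hF' : AEStronglyMeasurable F ((volume.restrict (extChartAt (𝓡 m) x₀).target).withDensity
      (fun y => ENNReal.ofReal (vol.ρ x₀ y))) :=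
    (hF.aestronglyMeasurable ht).mono_ac (withDensity_absolutelyContinuous _ _)
  rw [← integral_map (aemeasurable_extChartAt vol x₀) (by rwa [vol.map_chart]), vol.map_chart,
    integral_withDensity_eq_integral_toReal_smul₀ (measurable_ρ_restrict vol x₀)
      (by simp)]
  refine setIntegral_congr_fun ht fun y hy => ?_
  simp [ENNReal.toReal_ofReal (vol.pos x₀ y hy).le]

/-- On a closed ball in a chart the density is bounded and Lebesgue measure is finite. On compact
`M` this makes continuous functions integrable. -/
instance : IsLocallyFiniteMeasure vol.μ := by
  refine ⟨fun x => ?_⟩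
  have hx := mem_extChartAt_source (I := 𝓡 m) x
  have ht := (isOpen_extChartAt_target (I := 𝓡 m) x).mem_nhds ((extChartAt (𝓡 m) x).map_source hx)
  obtain ⟨r, hr, hrt⟩ := Metric.nhds_basis_closedBall.mem_iff.1 ht
  obtain ⟨C, hC⟩ := (isCompact_closedBall (extChartAt (𝓡 m) x x) r).bddAbove_image
    ((vol.smooth x).continuousOn.mono hrt)
  refine ⟨(extChartAt (𝓡 m) x).source ∩ extChartAt (𝓡 m) x ⁻¹' Metric.closedBall (extChartAt (𝓡 m) x x) r,
    Filter.inter_mem (extChartAt_source_mem_nhds x)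
      ((continuousAt_extChartAt x).preimage_mem_nhds (Metric.closedBall_mem_nhds _ hr)), ?_⟩
  rw [measure_chart vol x Metric.isClosed_closedBall.measurableSet, Set.inter_eq_left.2 hrt]
  refine (setLIntegral_mono' (g := fun _ => ENNReal.ofReal C)
    Metric.isClosed_closedBall.measurableSet fun y hy => ENNReal.ofReal_le_ofReal
    (hC (Set.mem_image_of_mem _ hy))).trans_lt ?_
  rw [setLIntegral_const]
  exact ENNReal.mul_lt_top ENNReal.ofReal_lt_top (isCompact_closedBall _ _).measure_lt_top

/-- The density is positive in charts. This upgrades almost-everywhere equality of continuous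
functions to equality, and gives overlaps of neighbourhoods positive mass in the Poincaré argument.
-/
instance : Measure.IsOpenPosMeasure vol.μ := by
  refine ⟨fun U hU hne h0 => ?_⟩
  obtain ⟨p, hp⟩ := hne
  have hV : IsOpen ((extChartAt (𝓡 m) p).target ∩ (extChartAt (𝓡 m) p).symm ⁻¹' U) :=
    (continuousOn_extChartAt_symm p).isOpen_inter_preimage (isOpen_extChartAt_target p) hU
  have h1 := measure_chart vol p hV.measurableSet
  have h2 : vol.μ ((extChartAt (𝓡 m) p).source ∩ extChartAt (𝓡 m) p ⁻¹'
      ((extChartAt (𝓡 m) p).target ∩ (extChartAt (𝓡 m) p).symm ⁻¹' U)) = 0 := by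
    refine measure_mono_null (fun q hq => ?_) h0
    have := hq.2.2
    rwa [Set.mem_preimage, (extChartAt (𝓡 m) p).left_inv hq.1] at this
  rw [h2, Set.inter_eq_left.2 Set.inter_subset_left] at h1
  have h3 := (setLIntegral_eq_zero_iff' hV.measurableSet
    ((measurable_ρ_restrict vol p).mono_measure (Measure.restrict_mono_set _
      Set.inter_subset_left))).1 h1.symm
  have hpV : extChartAt (𝓡 m) p p ∈
      (extChartAt (𝓡 m) p).target ∩ (extChartAt (𝓡 m) p).symm ⁻¹' U :=
    ⟨mem_extChartAt_target p, by simpa using hp⟩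
  refine (hV.measure_pos volume ⟨_, hpV⟩).ne' (measure_mono_null (fun y hy => ?_) h3)
  simp only [Set.mem_compl_iff, Set.mem_ofPred_eq, Classical.not_imp]
  exact ⟨hy, by simpa using vol.pos p y hy.1⟩

theorem VolumeDensity.contMDiffAt_divIn {x₀ p : M}
    (hp : p ∈ (chartAt (EuclideanSpace ℝ (Fin m)) x₀).source) {X : VField m M}
    (hX : SmoothFieldAt X p) : ContMDiffAt (𝓡 m) 𝓘(ℝ, ℝ) ∞ (vol.divIn x₀ X) p := by
  have h1 : ContDiffAt ℝ ∞ (fun y => vol.ρ x₀ y • fieldInChart x₀ X y) (extChartAt (𝓡 m) x₀ p) :=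
    (vol.contDiffAt_ρ hp).smul (contDiffAt_fieldInChart hp hX)
  have h2 := h1.fderiv_right (m := ∞) (by simp)
  let T : (EuclideanSpace ℝ (Fin m) →L[ℝ] EuclideanSpace ℝ (Fin m)) →L[ℝ] ℝ :=
    LinearMap.toContinuousLinearMap ((LinearMap.trace ℝ (EuclideanSpace ℝ (Fin m))) ∘ₗ
      (ContinuousLinearMap.coeLM ℝ))
  have h3 := ((vol.contDiffAt_ρ hp).inv (vol.ρ_pos hp).ne').mul (T.contDiff.contDiffAt.comp _ h2)
  exact h3.contMDiffAt.comp p (contMDiffAt_extChartAt_of_mem hp)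

variable [T2Space M] [CompactSpace M]

/-- The density in dμ = ρ dy cancels the factor ρ⁻¹ of the divergence, leaving the Euclidean
divergence of a compactly supported field. -/
theorem setIntegral_divIn_eq_zero (x₀ : M) {X : VField m M} {χ : M → ℝ} (hX : SmoothField X)
    (hχ : ContMDiff (𝓡 m) 𝓘(ℝ, ℝ) ∞ χ) (hs : tsupport χ ⊆ (extChartAt (𝓡 m) x₀).source) :
    ∫ p in (extChartAt (𝓡 m) x₀).source, vol.divIn x₀ (fun q => χ q • X q) p ∂vol.μ = 0 := by
  have ht := isOpen_extChartAt_target (I := 𝓡 m) x₀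
  have hXχ : SmoothField (fun q => χ q • X q) := fun p => SmoothFieldAt.smul (hχ p) (hX p)
  -- Extension by zero is smooth because the image of the support of `χ` is a compact subset of the
  -- chart target.
  let W := (extChartAt (𝓡 m) x₀).target.indicator
    (fun y => vol.ρ x₀ y • fieldInChart x₀ (fun q => χ q • X q) y)
  have hK : IsCompact (extChartAt (𝓡 m) x₀ '' tsupport χ) :=
    ((isClosed_tsupport χ).isCompact).image_of_continuousOn
      ((continuousOn_extChartAt x₀).mono hs)
  have hKt : extChartAt (𝓡 m) x₀ '' tsupport χ ⊆ (extChartAt (𝓡 m) x₀).target := by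
    rintro _ ⟨p, hp, rfl⟩
    exact (extChartAt (𝓡 m) x₀).map_source (hs hp)
  have hW0 : ∀ y ∉ extChartAt (𝓡 m) x₀ '' tsupport χ, W y = 0 := by
    intro y hy
    by_cases hyt : y ∈ (extChartAt (𝓡 m) x₀).target
    · have : χ ((extChartAt (𝓡 m) x₀).symm y) = 0 := image_eq_zero_of_notMem_tsupport fun h =>
        hy ⟨_, h, (extChartAt (𝓡 m) x₀).right_inv hyt⟩
      refine (Set.indicator_of_mem hyt _).trans ?_
      unfold fieldInChart
      beta_reduce
      rw [this, zero_smul, map_zero, smul_zero]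
    · exact Set.indicator_of_notMem hyt _
  have hWc : HasCompactSupport W := HasCompactSupport.intro hK hW0
  have hWe : ∀ y ∈ (extChartAt (𝓡 m) x₀).target,
      W =ᶠ[𝓝 y] fun y => vol.ρ x₀ y • fieldInChart x₀ (fun q => χ q • X q) y := fun y hy => by
    filter_upwards [ht.mem_nhds hy] with z hz using Set.indicator_of_mem hz _
  have hWt : ∀ y ∈ (extChartAt (𝓡 m) x₀).target, ContDiffAt ℝ ∞ W y := by
    intro y hy
    have hp := mem_source_iff.1 ((extChartAt (𝓡 m) x₀).map_target hy)
    have h1 := (vol.contDiffAt_ρ hp).smul (contDiffAt_fieldInChart hp (hXχ _))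
    rw [(extChartAt (𝓡 m) x₀).right_inv hy] at h1
    exact h1.congr_of_eventuallyEq (hWe y hy)
  have hWs : ContDiff ℝ ∞ W := by
    rw [contDiff_iff_contDiffAt]
    intro y
    by_cases hy : y ∈ extChartAt (𝓡 m) x₀ '' tsupport χ
    · exact hWt y (hKt hy)
    · refine contDiffAt_const (c := 0) |>.congr_of_eventuallyEq ?_
      filter_upwards [hK.isClosed.isOpen_compl.mem_nhds hy] with z hz using hW0 z hz
  have hW1 : ContDiff ℝ 1 W := hWs.of_le (by simp)
  let F : EuclideanSpace ℝ (Fin m) → ℝ := fun y => (vol.ρ x₀ y)⁻¹ *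
    LinearMap.trace ℝ (EuclideanSpace ℝ (Fin m)) (fderiv ℝ W y).toLinearMap
  let T : (EuclideanSpace ℝ (Fin m) →L[ℝ] EuclideanSpace ℝ (Fin m)) →L[ℝ] ℝ :=
    LinearMap.toContinuousLinearMap ((LinearMap.trace ℝ (EuclideanSpace ℝ (Fin m))) ∘ₗ
      (ContinuousLinearMap.coeLM ℝ))
  have hF : ContinuousOn F (extChartAt (𝓡 m) x₀).target :=
    ((vol.smooth x₀).continuousOn.inv₀ fun y hy => (vol.pos x₀ y hy).ne').mul
      (T.continuous.comp (hW1.continuous_fderiv (by simp))).continuousOn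
  have h1 : ∫ p in (extChartAt (𝓡 m) x₀).source, vol.divIn x₀ (fun q => χ q • X q) p ∂vol.μ =
      ∫ p in (extChartAt (𝓡 m) x₀).source, F (extChartAt (𝓡 m) x₀ p) ∂vol.μ := by
    refine setIntegral_congr_fun (isOpen_source x₀).measurableSet fun p hp => ?_
    have := hWe _ ((extChartAt (𝓡 m) x₀).map_source hp)
    simp only [F, VolumeDensity.divIn, this.fderiv_eq]
  rw [h1, setIntegral_chart vol x₀ hF]
  have h2 : ∫ y in (extChartAt (𝓡 m) x₀).target, vol.ρ x₀ y * F y =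
      ∫ y in (extChartAt (𝓡 m) x₀).target,
        LinearMap.trace ℝ (EuclideanSpace ℝ (Fin m)) (fderiv ℝ W y).toLinearMap := by
    refine setIntegral_congr_fun ht.measurableSet fun y hy => ?_
    simp only [F]
    rw [mul_inv_cancel_left₀ (vol.pos x₀ y hy).ne']
  rw [h2, setIntegral_eq_integral_of_forall_compl_eq_zero, integral_trace_fderiv_eq_zero hW1 hWc]
  intro y hy
  have : W =ᶠ[𝓝 y] fun _ => 0 := by
    filter_upwards [hK.isClosed.isOpen_compl.mem_nhds fun h => hy (hKt h)] with z hz using hW0 z hz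
  rw [this.fderiv_eq]
  simp

theorem integrable_of_contMDiff {φ : M → ℝ} (hφ : ContMDiff (𝓡 m) 𝓘(ℝ, ℝ) ∞ φ) :
    Integrable φ vol.μ :=
  hφ.continuous.integrable_of_hasCompactSupport (HasCompactSupport.of_compactSpace _)

theorem contMDiff_mvfderiv_apply {φ : M → ℝ} {X : VField m M}
    (hφ : ContMDiff (𝓡 m) 𝓘(ℝ, ℝ) ∞ φ) (hX : SmoothField X) :
    ContMDiff (𝓡 m) 𝓘(ℝ, ℝ) ∞ (fun p => mvfderiv (𝓡 m) φ p (X p)) := fun p =>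
  contMDiffAt_mvfderiv_apply (hφ p) (hX p)

theorem mvfderiv_eq_zero_of_notMem_tsupport {φ : M → ℝ} {p : M} (hp : p ∉ tsupport φ) :
    mvfderiv (𝓡 m) φ p = 0 := by
  have h : φ =ᶠ[𝓝 p] fun _ => 0 := by
    filter_upwards [(isClosed_tsupport φ).isOpen_compl.mem_nhds hp] with q hq
    exact image_eq_zero_of_notMem_tsupport hq
  rw [mvfderiv_congr h, mvfderiv_const]

/-- The weak characterization of the divergence in a chart. -/
theorem integral_mul_divIn (x₀ : M) {X : VField m M} {χ : M → ℝ} (hX : SmoothField X)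
    (hχ : ContMDiff (𝓡 m) 𝓘(ℝ, ℝ) ∞ χ) (hs : tsupport χ ⊆ (extChartAt (𝓡 m) x₀).source) :
    ∫ p, χ p * vol.divIn x₀ X p ∂vol.μ = - ∫ p, mvfderiv (𝓡 m) χ p (X p) ∂vol.μ := by
  have h1 : Integrable (fun p => χ p * vol.divIn x₀ X p) vol.μ := integrable_of_contMDiff vol
    (contMDiff_mul_of_tsupport hχ fun p hp => vol.contMDiffAt_divIn (mem_source_iff.1 (hs hp)) (hX p))
  have h2 := integrable_of_contMDiff vol (contMDiff_mvfderiv_apply hχ hX)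
  have h3 := setIntegral_divIn_eq_zero vol x₀ hX hχ hs
  rw [setIntegral_congr_fun (g := fun p => χ p * vol.divIn x₀ X p + mvfderiv (𝓡 m) χ p (X p))
    (isOpen_source x₀).measurableSet
    fun p hp => vol.divIn_smul (mem_source_iff.1 hp) (hχ p) (hX p),
    integral_add h1.integrableOn h2.integrableOn,
    setIntegral_eq_integral_of_forall_compl_eq_zero,
    setIntegral_eq_integral_of_forall_compl_eq_zero] at h3
  · exact eq_neg_of_add_eq_zero_left h3
  · intro p hp
    rw [mvfderiv_eq_zero_of_notMem_tsupport fun h => hp (hs h)]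
    rfl
  · intro p hp
    rw [image_eq_zero_of_notMem_tsupport fun h => hp (hs h), zero_mul]

/-- On the overlap of two charts both expressions satisfy the same weak formula against test
functions, so they agree almost everywhere and then everywhere by continuity; no Jacobian
computation is needed. Since `vol.div` changes chart from point to point, even its continuity rests
on this. -/
theorem VolumeDensity.divIn_eq_div {x₀ p : M}
    (hp : p ∈ (chartAt (EuclideanSpace ℝ (Fin m)) x₀).source) {X : VField m M}
    (hX : SmoothField X) : vol.divIn x₀ X p = vol.div X p := by
  let O := (extChartAt (𝓡 m) x₀).source ∩ (extChartAt (𝓡 m) p).source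
  have hO : IsOpen O := (isOpen_source x₀).inter (isOpen_source p)
  have hc0 : ContinuousOn (vol.divIn x₀ X) O := fun q hq =>
    (vol.contMDiffAt_divIn (mem_source_iff.1 hq.1) (hX q)).continuousAt.continuousWithinAt
  have hc1 : ContinuousOn (vol.divIn p X) O := fun q hq =>
    (vol.contMDiffAt_divIn (mem_source_iff.1 hq.2) (hX q)).continuousAt.continuousWithinAt
  have hae := hO.ae_eq_zero_of_integral_contMDiff_smul_eq_zero (𝓡 m) (μ := vol.μ)
    (f := fun q => vol.divIn x₀ X q - vol.divIn p X q)
    ((hc0.sub hc1).locallyIntegrableOn hO.measurableSet) fun g hg _ hgs => by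
      have hg0 := hgs.trans Set.inter_subset_left
      have hg1 := hgs.trans Set.inter_subset_right
      simp only [smul_eq_mul, mul_sub]
      rw [integral_sub, integral_mul_divIn vol x₀ hX hg hg0, integral_mul_divIn vol p hX hg hg1,
        sub_self]
      · exact integrable_of_contMDiff vol (contMDiff_mul_of_tsupport hg fun q hq =>
          vol.contMDiffAt_divIn (mem_source_iff.1 (hg0 hq)) (hX q))
      · exact integrable_of_contMDiff vol (contMDiff_mul_of_tsupport hg fun q hq =>
          vol.contMDiffAt_divIn (mem_source_iff.1 (hg1 hq)) (hX q))
  have hae' : vol.divIn x₀ X =ᵐ[vol.μ.restrict O] vol.divIn p X := by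
    rw [Filter.EventuallyEq, ae_restrict_iff' hO.measurableSet]
    exact hae.mono fun q hq hqO => sub_eq_zero.1 (hq hqO)
  exact Measure.eqOn_open_of_ae_eq hae' hO hc0 hc1
    ⟨mem_source_iff.2 hp, mem_extChartAt_source p⟩

theorem VolumeDensity.contMDiff_div {X : VField m M} (hX : SmoothField X) :
    ContMDiff (𝓡 m) 𝓘(ℝ, ℝ) ∞ (vol.div X) := by
  intro p
  refine (vol.contMDiffAt_divIn (mem_chart_source _ p) (hX p)).congr_of_eventuallyEq ?_
  filter_upwards [chart_source_mem_nhds (EuclideanSpace ℝ (Fin m)) p] with q hq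
  exact (vol.divIn_eq_div hq hX).symm

/-- The divergence theorem. -/
theorem integral_div_eq_zero {X : VField m M} (hX : SmoothField X) :
    ∫ p, vol.div X p ∂vol.μ = 0 := by
  obtain ⟨N, c, χ, hχ, hs, h1⟩ := exists_sq_partition (m := m)
    (fun x : M => extChartAt_source_mem_nhds (I := 𝓡 m) x)
  have hχ2 : ∀ k, ContMDiff (𝓡 m) 𝓘(ℝ, ℝ) ∞ (fun p => χ k p ^ 2) := fun k => (hχ k).pow 2
  have hs2 : ∀ k, tsupport (fun p => χ k p ^ 2) ⊆ (extChartAt (𝓡 m) (c k)).source := fun k =>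
    (closure_mono (Function.support_subset_iff'.2 fun p hp => by
      simp [Function.notMem_support.1 hp])).trans (hs k)
  have hk : ∀ k, ∫ p, χ k p ^ 2 * vol.div X p ∂vol.μ =
      - ∫ p, mvfderiv (𝓡 m) (fun p => χ k p ^ 2) p (X p) ∂vol.μ := by
    intro k
    rw [← integral_mul_divIn vol (c k) hX (hχ2 k) (hs2 k)]
    congr 1
    ext p
    by_cases hp : p ∈ tsupport (fun p => χ k p ^ 2)
    · rw [vol.divIn_eq_div (mem_source_iff.1 (hs2 k hp)) hX]
    · have : χ k p ^ 2 = 0 :=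
        image_eq_zero_of_notMem_tsupport (f := fun p => χ k p ^ 2) hp
      rw [this, zero_mul, zero_mul]
  have hd : ∫ p, vol.div X p ∂vol.μ = ∫ p, ∑ k, χ k p ^ 2 * vol.div X p ∂vol.μ := by
    simp only [← Finset.sum_mul, h1, one_mul]
  -- The boundary-free terms cancel because Σ X(χ_k²) is the derivative of the constant 1.
  have h0 : ∀ p, ∑ k, mvfderiv (𝓡 m) (fun p => χ k p ^ 2) p (X p) = 0 := fun p => by
    have h := mvfderiv_finset_sum (s := Finset.univ) (φ := fun k p => χ k p ^ 2) (x := p)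
      fun k _ => hχ2 k p
    simp only [h1] at h
    rw [mvfderiv_const] at h
    have := DFunLike.congr_fun h (X p)
    simpa using this.symm
  have h2 : ∀ k, Integrable (fun p => χ k p ^ 2 * vol.div X p) vol.μ := fun k =>
    integrable_of_contMDiff vol ((hχ2 k).mul (vol.contMDiff_div hX))
  rw [hd, integral_finsetSum _ fun k _ => h2 k]
  simp only [hk]
  rw [Finset.sum_neg_distrib, ← integral_finsetSum _ fun k _ =>
    integrable_of_contMDiff vol (contMDiff_mvfderiv_apply (hχ2 k) hX)]
  simp [h0]

theorem integral_mul_div {X : VField m M} {φ : M → ℝ} (hX : SmoothField X)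
    (hφ : ContMDiff (𝓡 m) 𝓘(ℝ, ℝ) ∞ φ) :
    ∫ p, φ p * vol.div X p ∂vol.μ = - ∫ p, mvfderiv (𝓡 m) φ p (X p) ∂vol.μ := by
  have h := integral_div_eq_zero vol (X := fun p => φ p • X p)
    fun p => SmoothFieldAt.smul (hφ p) (hX p)
  have h1 : ∀ p, vol.div (fun p => φ p • X p) p = φ p * vol.div X p + mvfderiv (𝓡 m) φ p (X p) :=
    fun p => vol.divIn_smul (mem_chart_source _ p) (hφ p) (hX p)
  simp only [h1] at h
  have h2 : Integrable (fun p => φ p * vol.div X p) vol.μ :=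
    integrable_of_contMDiff vol (hφ.mul (vol.contMDiff_div hX))
  rw [integral_add h2
    (integrable_of_contMDiff vol (contMDiff_mvfderiv_apply hφ hX))] at h
  exact eq_neg_of_add_eq_zero_left h

end Integration
end
end SubRiem

namespace SubRiem
noncomputable section

/-! ### A Poincaré inequality on Euclidean balls. -/

section EuclideanPoincare

open MeasureTheory

/-- The variance of `g` on the unit interval is nonnegative. -/
theorem sq_integral_le_integral_sq {g : ℝ → ℝ} (hg : ContinuousOn g (Set.uIcc 0 1)) :
    (∫ t in (0 : ℝ)..1, g t) ^ 2 ≤ ∫ t in (0 : ℝ)..1, g t ^ 2 := by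
  set a := ∫ t in (0 : ℝ)..1, g t
  have h1 := hg.intervalIntegrable (μ := volume)
  have h2 : IntervalIntegrable (fun t => g t ^ 2) volume 0 1 := (hg.pow 2).intervalIntegrable
  have h : 0 ≤ ∫ t in (0 : ℝ)..1, (g t - a) ^ 2 :=
    intervalIntegral.integral_nonneg zero_le_one fun _ _ => sq_nonneg _
  have h3 : ∫ t in (0 : ℝ)..1, (g t - a) ^ 2 = (∫ t in (0 : ℝ)..1, g t ^ 2) - a ^ 2 := by
    have : ∀ t, (g t - a) ^ 2 = g t ^ 2 - 2 * a * g t + a ^ 2 := fun t => by ring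
    simp only [this]
    rw [intervalIntegral.integral_add (h2.sub (h1.const_mul _)) intervalIntegrable_const,
      intervalIntegral.integral_sub h2 (h1.const_mul _), intervalIntegral.integral_const_mul]
    simp only [intervalIntegral.integral_const, sub_zero, one_smul]
    ring
  linarith

variable {m : ℕ}

/-- The squared norm of the gradient. -/
def gradSq (h : EuclideanSpace ℝ (Fin m) → ℝ) (x : EuclideanSpace ℝ (Fin m)) : ℝ :=
  ∑ i, fderiv ℝ h x (EuclideanSpace.single i 1) ^ 2

theorem sq_fderiv_le (h : EuclideanSpace ℝ (Fin m) → ℝ) (x z : EuclideanSpace ℝ (Fin m)) :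
    fderiv ℝ h x z ^ 2 ≤ ‖z‖ ^ 2 * gradSq h x := by
  have hz : fderiv ℝ h x z = ∑ i, z i * fderiv ℝ h x (EuclideanSpace.single i 1) := by
    conv_lhs => rw [← (EuclideanSpace.basisFun (Fin m) ℝ).sum_repr z]
    simp
  rw [hz, EuclideanSpace.norm_sq_eq]
  simpa [gradSq] using Finset.sum_mul_sq_le_sq_mul_sq Finset.univ (fun i => z i)
    (fun i => fderiv ℝ h x (EuclideanSpace.single i 1))

theorem measurable_gradSq (h : EuclideanSpace ℝ (Fin m) → ℝ) : Measurable (gradSq h) :=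
  Finset.measurable_sum _ fun _ _ => (measurable_fderiv_apply_const ℝ h _).pow_const 2

/-- The fundamental theorem of calculus along the segment, then the Cauchy–Schwarz inequality in `t`
and in the coordinates. The indicator prepares for integrating over all base points `x`. -/
theorem ofReal_sq_sub_le {h : EuclideanSpace ℝ (Fin m) → ℝ} {s : Set (EuclideanSpace ℝ (Fin m))}
    (hs : IsOpen s) (hh : ContDiffOn ℝ 1 h s) {x z : EuclideanSpace ℝ (Fin m)}
    (hseg : ∀ t ∈ Set.Icc (0 : ℝ) 1, x + t • z ∈ s) :
    ENNReal.ofReal ((h (x + z) - h x) ^ 2) ≤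
      ENNReal.ofReal (‖z‖ ^ 2) *
        ∫⁻ t in Set.Icc (0 : ℝ) 1, s.indicator (fun y => ENNReal.ofReal (gradSq h y)) (x + t • z) := by
  have hcf : ContinuousOn (fderiv ℝ h) s := hh.continuousOn_fderiv_of_isOpen hs le_rfl
  have hline : ContinuousOn (fun t : ℝ => x + t • z) (Set.Icc 0 1) := by fun_prop
  have hc : ContinuousOn (fun t : ℝ => fderiv ℝ h (x + t • z)) (Set.Icc 0 1) :=
    hcf.comp hline hseg
  have hc1 : ContinuousOn (fun t : ℝ => fderiv ℝ h (x + t • z) z) (Set.Icc 0 1) :=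
    hc.clm_apply continuousOn_const
  have hc2 : ContinuousOn (fun t : ℝ => gradSq h (x + t • z)) (Set.Icc 0 1) :=
    continuousOn_finsetSum _ fun i _ => (hc.clm_apply continuousOn_const).pow 2
  have hu : Set.uIcc (0 : ℝ) 1 = Set.Icc 0 1 := Set.uIcc_of_le zero_le_one
  have hftc : ∫ t in (0 : ℝ)..1, fderiv ℝ h (x + t • z) z = h (x + z) - h x := by
    have := intervalIntegral.integral_eq_sub_of_hasDerivAt (a := 0) (b := 1)
      (f := fun t : ℝ => h (x + t • z)) (f' := fun t => fderiv ℝ h (x + t • z) z)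
      (fun t ht => by
        rw [hu] at ht
        have h1 : HasFDerivAt h (fderiv ℝ h (x + t • z)) (x + t • z) :=
          ((hh.contDiffAt (hs.mem_nhds (hseg t ht))).differentiableAt (by simp)).hasFDerivAt
        have h2 : HasDerivAt (fun t : ℝ => x + t • z) z t := by
          simpa using ((hasDerivAt_id t).smul_const z).const_add x
        exact h1.comp_hasDerivAt t h2)
      ((by rwa [hu] : ContinuousOn _ (Set.uIcc (0 : ℝ) 1)).intervalIntegrable)
    simpa using this
  have hle : (h (x + z) - h x) ^ 2 ≤ ‖z‖ ^ 2 * ∫ t in Set.Icc (0 : ℝ) 1, gradSq h (x + t • z) := by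
    rw [← hftc]
    refine (sq_integral_le_integral_sq (by rwa [hu])).trans ?_
    rw [integral_Icc_eq_integral_Ioc, ← intervalIntegral.integral_of_le zero_le_one,
      ← intervalIntegral.integral_const_mul]
    refine intervalIntegral.integral_mono_on zero_le_one
      ((by rw [hu]; exact hc1.pow 2 : ContinuousOn _ (Set.uIcc (0 : ℝ) 1)).intervalIntegrable)
      ((by rw [hu]; exact continuousOn_const.mul hc2 :
        ContinuousOn _ (Set.uIcc (0 : ℝ) 1)).intervalIntegrable) fun t _ => sq_fderiv_le _ _ _
  refine (ENNReal.ofReal_le_ofReal hle).trans ?_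
  rw [ENNReal.ofReal_mul (by positivity), ofReal_integral_eq_lintegral_ofReal
    (hc2.integrableOn_compact isCompact_Icc)
    (.of_forall fun t => Finset.sum_nonneg fun i _ => sq_nonneg _)]
  refine le_of_eq (congrArg _ (setLIntegral_congr_fun measurableSet_Icc fun t ht => ?_))
  simp [Set.indicator_of_mem (hseg t ht)]

/-- A Poincaré inequality on balls. -/
theorem lintegral_ball_sq_sub_le {h : EuclideanSpace ℝ (Fin m) → ℝ} {c : EuclideanSpace ℝ (Fin m)}
    {r : ℝ} (hh : ContDiffOn ℝ 1 h (Metric.ball c (3 * r))) :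
    ∫⁻ x in Metric.ball c r, ∫⁻ y in Metric.ball c r, ENNReal.ofReal ((h x - h y) ^ 2) ≤
      (ENNReal.ofReal ((2 * r) ^ 2) * volume (Metric.ball (0 : EuclideanSpace ℝ (Fin m)) (2 * r))) *
        ∫⁻ x in Metric.ball c (3 * r), ENNReal.ofReal (gradSq h x) := by
  set G : EuclideanSpace ℝ (Fin m) → ENNReal :=
    (Metric.ball c (3 * r)).indicator fun y => ENNReal.ofReal (gradSq h y) with hG
  have hGm : Measurable G := (measurable_gradSq h).ennreal_ofReal.indicator measurableSet_ball
  have hGi : ∫⁻ x in Metric.ball c (3 * r), ENNReal.ofReal (gradSq h x) = ∫⁻ x, G x :=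
    (lintegral_indicator measurableSet_ball _).symm
  -- Substitute y = x + z with |z| < 2r; after enlarging the domain, the remaining integral over z
  -- no longer has a range depending on x.
  have h1 : ∀ x ∈ Metric.ball c r,
      ∫⁻ y in Metric.ball c r, ENNReal.ofReal ((h x - h y) ^ 2) ≤
        ENNReal.ofReal ((2 * r) ^ 2) * ∫⁻ z in Metric.ball (0 : EuclideanSpace ℝ (Fin m)) (2 * r),
          ∫⁻ t in Set.Icc (0 : ℝ) 1, G (x + t • z) := by
    intro x hx
    rw [← lintegral_indicator measurableSet_ball, ← lintegral_add_left_eq_self _ x,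
      ← lintegral_indicator measurableSet_ball, ← lintegral_const_mul' _ _ ENNReal.ofReal_ne_top]
    refine lintegral_mono fun z => ?_
    by_cases hz : x + z ∈ Metric.ball c r
    · have hzr : ‖z‖ < 2 * r := by
        have h1 := mem_ball_iff_norm.1 hx
        have h2 := mem_ball_iff_norm.1 hz
        have h3 : z = (x + z - c) - (x - c) := by abel
        rw [h3]
        exact (norm_sub_le _ _).trans_lt (by linarith)
      have hz' : z ∈ Metric.ball (0 : EuclideanSpace ℝ (Fin m)) (2 * r) := by simpa using hzr
      rw [Set.indicator_of_mem hz, Set.indicator_of_mem hz']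
      -- A crude estimate suffices: |x + tz - c| < r + 2r.
      have hseg : ∀ t ∈ Set.Icc (0 : ℝ) 1, x + t • z ∈ Metric.ball c (3 * r) := by
        intro t ht
        have h1 := mem_ball_iff_norm.1 hx
        rw [mem_ball_iff_norm, add_sub_right_comm]
        refine (norm_add_le _ _).trans_lt ?_
        rw [norm_smul, Real.norm_of_nonneg ht.1]
        have : t * ‖z‖ ≤ ‖z‖ := mul_le_of_le_one_left (norm_nonneg _) ht.2
        linarith
      have h4 := ofReal_sq_sub_le Metric.isOpen_ball hh hseg
      rw [← neg_sq, neg_sub]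
      refine h4.trans (mul_le_mul_left (ENNReal.ofReal_le_ofReal ?_) _)
      gcongr
    · rw [Set.indicator_of_notMem hz]
      exact zero_le
  have hm3 : Measurable fun p : (EuclideanSpace ℝ (Fin m) × EuclideanSpace ℝ (Fin m)) × ℝ =>
      G (p.1.1 + p.2 • p.1.2) := hGm.comp (by fun_prop)
  calc ∫⁻ x in Metric.ball c r, ∫⁻ y in Metric.ball c r, ENNReal.ofReal ((h x - h y) ^ 2)
      ≤ ∫⁻ x in Metric.ball c r, ENNReal.ofReal ((2 * r) ^ 2) *
          ∫⁻ z in Metric.ball (0 : EuclideanSpace ℝ (Fin m)) (2 * r),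
            ∫⁻ t in Set.Icc (0 : ℝ) 1, G (x + t • z) := setLIntegral_mono' measurableSet_ball h1
    _ ≤ ∫⁻ x, ENNReal.ofReal ((2 * r) ^ 2) *
          ∫⁻ z in Metric.ball (0 : EuclideanSpace ℝ (Fin m)) (2 * r),
            ∫⁻ t in Set.Icc (0 : ℝ) 1, G (x + t • z) := setLIntegral_le_lintegral _ _
    _ = ENNReal.ofReal ((2 * r) ^ 2) * ∫⁻ z in Metric.ball (0 : EuclideanSpace ℝ (Fin m)) (2 * r),
          ∫⁻ t in Set.Icc (0 : ℝ) 1, ∫⁻ x, G (x + t • z) := by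
        rw [lintegral_const_mul' _ _ ENNReal.ofReal_ne_top, lintegral_lintegral_swap]
        · congr 1
          refine lintegral_congr fun z => lintegral_lintegral_swap ?_
          exact (hGm.comp (by fun_prop : Measurable fun p : EuclideanSpace ℝ (Fin m) × ℝ =>
            p.1 + p.2 • z)).aemeasurable
        · exact (hm3.lintegral_prod_right').aemeasurable
    _ = _ := by
        -- With the x-integral innermost and over the whole space, translation by tz disappears, so
        -- the integrals over t and z contribute only constants.
        simp only [lintegral_add_right_eq_self]
        simp only [setLIntegral_const, Real.volume_Icc, sub_zero, ENNReal.ofReal_one, mul_one]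
        rw [hGi]
        ring

end EuclideanPoincare

end
end SubRiem

namespace SubRiem
noncomputable section

/-! ### The Poincaré inequality on a compact connected manifold. -/

section Poincare

set_option linter.unusedSectionVars false

open MeasureTheory

variable {m : ℕ} {M : Type*} [TopologicalSpace M] [ChartedSpace (EuclideanSpace ℝ (Fin m)) M]
  [IsManifold (𝓡 m) ∞ M] [MeasurableSpace M] [BorelSpace M] (vol : VolumeDensity m M)

/-- The functional `Q` on smooth functions is bounded by a Dirichlet energy
`u ↦ C ∑ ∫ (X_k u)²` of finitely many smooth vector fields. -/
def DirichletBounded (Q : (M → ℝ) → ENNReal) : Prop :=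
  ∃ (ι : Type) (_ : Fintype ι) (X : ι → VField m M) (C : ENNReal), (∀ k, SmoothField (X k)) ∧
    C ≠ ⊤ ∧ ∀ u : M → ℝ, ContMDiff (𝓡 m) 𝓘(ℝ, ℝ) ∞ u →
      Q u ≤ C * ∑ k, ∫⁻ p, ENNReal.ofReal (mvfderiv (𝓡 m) u p (X k p) ^ 2) ∂vol.μ

variable {vol}

theorem DirichletBounded.mono {Q Q' : (M → ℝ) → ENNReal} (h : DirichletBounded vol Q)
    (hle : ∀ u : M → ℝ, ContMDiff (𝓡 m) 𝓘(ℝ, ℝ) ∞ u → Q' u ≤ Q u) : DirichletBounded vol Q' := by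
  obtain ⟨ι, hι, X, C, hX, hC, h⟩ := h
  exact ⟨ι, hι, X, C, hX, hC, fun u hu => (hle u hu).trans (h u hu)⟩

theorem DirichletBounded.const_mul {Q : (M → ℝ) → ENNReal} (h : DirichletBounded vol Q)
    {c : ENNReal} (hc : c ≠ ⊤) : DirichletBounded vol (fun u => c * Q u) := by
  obtain ⟨ι, hι, X, C, hX, hC, h⟩ := h
  refine ⟨ι, hι, X, c * C, hX, ENNReal.mul_ne_top hc hC, fun u hu => ?_⟩
  rw [mul_assoc]
  exact mul_le_mul_right (h u hu) c

theorem DirichletBounded.add {Q Q' : (M → ℝ) → ENNReal} (h : DirichletBounded vol Q)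
    (h' : DirichletBounded vol Q') : DirichletBounded vol (fun u => Q u + Q' u) := by
  obtain ⟨ι, hι, X, C, hX, hC, h⟩ := h
  obtain ⟨ι', hι', X', C', hX', hC', h'⟩ := h'
  refine ⟨ι ⊕ ι', inferInstance, Sum.elim X X', C + C', ?_, ENNReal.add_ne_top.2 ⟨hC, hC'⟩,
    fun u hu => ?_⟩
  · rintro (k | k)
    exacts [hX k, hX' k]
  · refine (add_le_add (h u hu) (h' u hu)).trans ?_
    rw [Fintype.sum_sum_type, mul_add]
    simp only [Sum.elim_inl, Sum.elim_inr]
    exact add_le_add (mul_le_mul_left le_self_add _) (mul_le_mul_left le_add_self _)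

theorem dirichletBounded_zero : DirichletBounded vol (fun _ : M → ℝ => 0) :=
  ⟨Empty, inferInstance, fun k => k.elim, 0, fun k => k.elim, by simp, fun _ _ => zero_le⟩

variable (vol)

/-- The double integral `∫_U ∫_V (u p - u q)²`. -/
def sqDiff (U V : Set M) (u : M → ℝ) : ENNReal :=
  ∫⁻ p in U, ∫⁻ q in V, ENNReal.ofReal ((u p - u q) ^ 2) ∂vol.μ ∂vol.μ

theorem sqDiff_mono {U U' V V' : Set M} (hU : U ⊆ U') (hV : V ⊆ V') (u : M → ℝ) :
    sqDiff vol U V u ≤ sqDiff vol U' V' u :=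
  (lintegral_mono_set hU).trans (lintegral_mono fun _ => lintegral_mono_set hV)

variable [T2Space M] [CompactSpace M]

theorem measurable_sqDiff_kernel {u : M → ℝ} (hu : Measurable u) :
    Measurable fun z : M × M => ENNReal.ofReal ((u z.1 - u z.2) ^ 2) := by
  have h1 : Measurable fun z : M × M => u z.1 := hu.comp measurable_fst
  have h2 : Measurable fun z : M × M => u z.2 := hu.comp measurable_snd
  exact ((h1.sub h2).pow_const 2).ennreal_ofReal

theorem sqDiff_comm (U V : Set M) {u : M → ℝ} (hu : Measurable u) :
    sqDiff vol U V u = sqDiff vol V U u := by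
  unfold sqDiff
  rw [lintegral_lintegral_swap (measurable_sqDiff_kernel hu).aemeasurable]
  refine lintegral_congr fun p => lintegral_congr fun q => ?_
  rw [← neg_sq, neg_sub]

/-- Integrate (u p - u r)² ≤ 2 (u p - u q)² + 2 (u r - u q)² over an intermediate point q in `V`.
This chains estimates through `V`. -/
theorem measure_mul_sqDiff_le (U V W : Set M) {u : M → ℝ} (hu : Measurable u) :
    vol.μ V * sqDiff vol U W u ≤
      2 * vol.μ W * sqDiff vol U V u + 2 * vol.μ U * sqDiff vol V W u := by
  rw [sqDiff_comm vol V W hu]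
  unfold sqDiff
  set d : M → M → ENNReal := fun p q => ENNReal.ofReal ((u p - u q) ^ 2) with hd
  have hdm : Measurable (Function.uncurry d) := measurable_sqDiff_kernel hu
  have hdi : ∀ V : Set M, Measurable fun p => ∫⁻ q in V, d p q ∂vol.μ := fun V =>
    hdm.lintegral_prod_right'
  have htri : ∀ p q r, d p r ≤ 2 * d p q + 2 * d r q := by
    intro p q r
    have : (2 : ENNReal) = ENNReal.ofReal 2 := by simp
    rw [this]
    simp only [hd]
    rw [← ENNReal.ofReal_mul (by norm_num), ← ENNReal.ofReal_mul (by norm_num),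
      ← ENNReal.ofReal_add (by positivity) (by positivity)]
    refine ENNReal.ofReal_le_ofReal ?_
    nlinarith [sq_nonneg (u p - u q + (u r - u q))]
  have hpr : ∀ p r, vol.μ V * d p r ≤
      2 * ∫⁻ q in V, d p q ∂vol.μ + 2 * ∫⁻ q in V, d r q ∂vol.μ := by
    intro p r
    calc vol.μ V * d p r = ∫⁻ _q in V, d p r ∂vol.μ := by
          rw [setLIntegral_const, mul_comm]
      _ ≤ ∫⁻ q in V, (2 * d p q + 2 * d r q) ∂vol.μ := lintegral_mono fun q => htri p q r
      _ = _ := by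
        have hdp : Measurable fun q => 2 * d p q :=
          (hdm.comp (measurable_prodMk_left (x := p))).const_mul _
        rw [lintegral_add_left hdp, lintegral_const_mul' _ _ (by simp), lintegral_const_mul' _ _ (by simp)]
  have hfin := measure_ne_top vol.μ V
  calc vol.μ V * ∫⁻ p in U, ∫⁻ r in W, d p r ∂vol.μ ∂vol.μ
      = ∫⁻ p in U, ∫⁻ r in W, vol.μ V * d p r ∂vol.μ ∂vol.μ := by
        rw [← lintegral_const_mul' _ _ hfin]
        simp only [lintegral_const_mul' _ _ hfin]
    _ ≤ ∫⁻ p in U, ∫⁻ r in W, (2 * ∫⁻ q in V, d p q ∂vol.μ + 2 * ∫⁻ q in V, d r q ∂vol.μ)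
          ∂vol.μ ∂vol.μ := lintegral_mono fun p => lintegral_mono fun r => hpr p r
    _ = _ := by
      simp only [lintegral_add_left measurable_const, setLIntegral_const]
      rw [lintegral_add_right _ measurable_const, setLIntegral_const,
        lintegral_mul_const' _ _ (measure_ne_top vol.μ W), lintegral_const_mul' _ _ (by simp),
        lintegral_const_mul' _ _ (by simp)]
      ring

theorem setLIntegral_chart_preimage (x₀ : M) {s : Set (EuclideanSpace ℝ (Fin m))} (hs : IsOpen s)
    (hst : s ⊆ (extChartAt (𝓡 m) x₀).target) {F : EuclideanSpace ℝ (Fin m) → ENNReal}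
    (hF : Measurable F) :
    ∫⁻ p in (extChartAt (𝓡 m) x₀).source ∩ extChartAt (𝓡 m) x₀ ⁻¹' s,
        F (extChartAt (𝓡 m) x₀ p) ∂vol.μ = ∫⁻ y in s, ENNReal.ofReal (vol.ρ x₀ y) * F y := by
  have hU : IsOpen ((extChartAt (𝓡 m) x₀).source ∩ extChartAt (𝓡 m) x₀ ⁻¹' s) :=
    (continuousOn_extChartAt x₀).isOpen_inter_preimage (isOpen_source x₀) hs
  have h := setLIntegral_chart vol x₀ (hF.indicator hs.measurableSet).aemeasurable
  have h1 : ∫⁻ p in (extChartAt (𝓡 m) x₀).source, s.indicator F (extChartAt (𝓡 m) x₀ p) ∂vol.μ =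
      ∫⁻ p in (extChartAt (𝓡 m) x₀).source ∩ extChartAt (𝓡 m) x₀ ⁻¹' s,
        F (extChartAt (𝓡 m) x₀ p) ∂vol.μ := by
    rw [← Set.inter_eq_left.2 (Set.inter_subset_left (s := (extChartAt (𝓡 m) x₀).source)
      (t := extChartAt (𝓡 m) x₀ ⁻¹' s)), ← setLIntegral_indicator hU.measurableSet]
    refine setLIntegral_congr_fun (isOpen_source x₀).measurableSet fun p hp => ?_
    by_cases hps : extChartAt (𝓡 m) x₀ p ∈ s
    · rw [Set.indicator_of_mem hps, Set.indicator_of_mem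
        (show p ∈ (extChartAt (𝓡 m) x₀).source ∩ extChartAt (𝓡 m) x₀ ⁻¹' s from ⟨hp, hps⟩)]
    · rw [Set.indicator_of_notMem hps, Set.indicator_of_notMem
        (show p ∉ (extChartAt (𝓡 m) x₀).source ∩ extChartAt (𝓡 m) x₀ ⁻¹' s from fun h => hps h.2)]
  have h2 : ∫⁻ y in (extChartAt (𝓡 m) x₀).target,
      ENNReal.ofReal (vol.ρ x₀ y) * s.indicator F y =
      ∫⁻ y in s, ENNReal.ofReal (vol.ρ x₀ y) * F y := by
    rw [← Set.inter_eq_left.2 hst, ← setLIntegral_indicator hs.measurableSet]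
    refine lintegral_congr fun y => ?_
    rw [Set.inter_eq_left.2 hst]
    by_cases hy : y ∈ s
    · rw [Set.indicator_of_mem hy, Set.indicator_of_mem hy]
    · rw [Set.indicator_of_notMem hy, Set.indicator_of_notMem hy, mul_zero]
  rw [← h1, h, h2]

set_option maxHeartbeats 400000 in
/-- A local Poincaré inequality. -/
theorem exists_nhds_dirichletBounded (x : M) :
    ∃ U ∈ 𝓝 x, DirichletBounded vol (sqDiff vol U U) := by
  set e := extChartAt (𝓡 m) x with he
  -- The Dirichlet energy is taken with global fields, so the coordinate fields are cut off; the
  -- ball of radius 3r will lie where `χ` is 1.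
  obtain ⟨χ, hχ, hχ1, hχs, -⟩ := exists_bump (m := m) (extChartAt_source_mem_nhds (I := 𝓡 m) x)
  have hTo : IsOpen (e.target ∩ e.symm ⁻¹' interior {p | χ p = 1}) :=
    (continuousOn_extChartAt_symm x).isOpen_inter_preimage (isOpen_extChartAt_target x)
      isOpen_interior
  have hxT : e x ∈ e.target ∩ e.symm ⁻¹' interior {p | χ p = 1} := by
    refine ⟨mem_extChartAt_target x, ?_⟩
    rw [Set.mem_preimage, he, extChartAt_to_inv]
    exact mem_interior_iff_mem_nhds.2 hχ1
  obtain ⟨ε, hε, hεT⟩ := Metric.nhds_basis_closedBall.mem_iff.1 (hTo.mem_nhds hxT)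
  obtain ⟨r, rfl⟩ : ∃ r, ε = 3 * r := ⟨ε / 3, by ring⟩
  have hr : 0 < r := by linarith
  have hKt : Metric.closedBall (e x) (3 * r) ⊆ e.target := hεT.trans Set.inter_subset_left
  have hρc : ContinuousOn (vol.ρ x) (Metric.closedBall (e x) (3 * r)) :=
    (vol.smooth x).continuousOn.mono hKt
  obtain ⟨y₁, hy₁, hmax⟩ := (isCompact_closedBall (e x) (3 * r)).exists_isMaxOn
    (Metric.nonempty_closedBall.2 hε.le) hρc
  obtain ⟨y₀, hy₀, hmin⟩ := (isCompact_closedBall (e x) (3 * r)).exists_isMinOn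
    (Metric.nonempty_closedBall.2 hε.le) hρc
  -- The extrema of the density compare μ with Lebesgue measure: the maximum enters twice, for the
  -- double integral, and the minimum once, inverted, for the gradient energy.
  set C := ENNReal.ofReal (vol.ρ x y₁)
  set c := ENNReal.ofReal (vol.ρ x y₀)
  have hc0 : c ≠ 0 := (ENNReal.ofReal_pos.2 (vol.pos x y₀ (hKt hy₀))).ne'
  have hct : c ≠ ⊤ := ENNReal.ofReal_ne_top
  have hBK : Metric.ball (e x) r ⊆ Metric.closedBall (e x) (3 * r) :=
    Metric.ball_subset_closedBall.trans (Metric.closedBall_subset_closedBall (by linarith))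
  have hB3K : Metric.ball (e x) (3 * r) ⊆ Metric.closedBall (e x) (3 * r) :=
    Metric.ball_subset_closedBall
  let U := e.source ∩ e ⁻¹' Metric.ball (e x) r
  have hU : IsOpen U := (continuousOn_extChartAt x).isOpen_inter_preimage (isOpen_source x)
    Metric.isOpen_ball
  have hU3 : IsOpen (e.source ∩ e ⁻¹' Metric.ball (e x) (3 * r)) :=
    (continuousOn_extChartAt x).isOpen_inter_preimage (isOpen_source x) Metric.isOpen_ball
  have hX : ∀ i, SmoothField (fun p => χ p • coordField x i p) := fun i =>
    SmoothField.smul_of_tsupport hχ fun p hp =>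
      smoothFieldAt_coordField (mem_source_iff.1 (hχs hp)) i
  have hle : ∀ F : EuclideanSpace ℝ (Fin m) → ENNReal, Measurable F →
      ∫⁻ p in U, F (e p) ∂vol.μ ≤ C * ∫⁻ y in Metric.ball (e x) r, F y := by
    intro F hF
    rw [setLIntegral_chart_preimage vol x Metric.isOpen_ball (hBK.trans hKt) hF,
      ← lintegral_const_mul' _ _ ENNReal.ofReal_ne_top]
    exact setLIntegral_mono' measurableSet_ball fun y hy =>
      mul_le_mul_left (ENNReal.ofReal_le_ofReal (hmax (hBK hy))) _
  have hge : ∀ F : EuclideanSpace ℝ (Fin m) → ENNReal, Measurable F →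
      c * ∫⁻ y in Metric.ball (e x) (3 * r), F y ≤
        ∫⁻ p in e.source ∩ e ⁻¹' Metric.ball (e x) (3 * r), F (e p) ∂vol.μ := by
    intro F hF
    rw [setLIntegral_chart_preimage vol x Metric.isOpen_ball (hB3K.trans hKt) hF,
      ← lintegral_const_mul' _ _ ENNReal.ofReal_ne_top]
    exact setLIntegral_mono' measurableSet_ball fun y hy =>
      mul_le_mul_left (ENNReal.ofReal_le_ofReal (hmin (hB3K hy))) _
  refine ⟨U, hU.mem_nhds ⟨mem_extChartAt_source x, Metric.mem_ball_self hr⟩,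
    Fin m, inferInstance, fun i p => χ p • coordField x i p,
    C * C * (ENNReal.ofReal ((2 * r) ^ 2) *
      volume (Metric.ball (0 : EuclideanSpace ℝ (Fin m)) (2 * r))) * c⁻¹, hX, ?_,
    fun u hu => ?_⟩
  · exact ENNReal.mul_ne_top (ENNReal.mul_ne_top (ENNReal.mul_ne_top ENNReal.ofReal_ne_top
      ENNReal.ofReal_ne_top) (ENNReal.mul_ne_top ENNReal.ofReal_ne_top
        measure_ball_lt_top.ne)) (by simpa using hc0)
  let h : EuclideanSpace ℝ (Fin m) → ℝ := e.target.indicator fun y => u (e.symm y)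
  have ht := isOpen_extChartAt_target (I := 𝓡 m) x
  have hsymm : ∀ y ∈ e.target, ContDiffAt ℝ ∞ (fun y => u (e.symm y)) y := by
    intro y hy
    have := contDiffAt_comp_extChartAt_symm (mem_source_iff.1 (e.map_target hy)) (hu _)
    rwa [← he, e.right_inv hy] at this
  have hev : ∀ y ∈ e.target, h =ᶠ[𝓝 y] fun y => u (e.symm y) := fun y hy => by
    filter_upwards [ht.mem_nhds hy] with z hz using Set.indicator_of_mem hz _
  have hhe : ∀ p ∈ e.source, h (e p) = u p := fun p hp => by
    refine (Set.indicator_of_mem (e.map_source hp) _).trans ?_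
    rw [e.left_inv hp]
  have hcont : ContinuousOn (fun y => u (e.symm y)) e.target := fun y hy =>
    (hsymm y hy).continuousAt.continuousWithinAt
  have hm : Measurable h := by
    classical
    have : h = e.target.piecewise (fun y => u (e.symm y)) fun _ => 0 :=
      (Set.piecewise_eq_indicator).symm
    rw [this]
    exact hcont.measurable_piecewise continuousOn_const ht.measurableSet
  have hsmooth : ContDiffOn ℝ 1 h (Metric.ball (e x) (3 * r)) := fun y hy =>
    (((hsymm y (hKt (hB3K hy))).congr_of_eventuallyEq (hev y (hKt (hB3K hy)))).of_le
      (by simp)).contDiffWithinAt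
  have hk : Measurable fun z : EuclideanSpace ℝ (Fin m) × EuclideanSpace ℝ (Fin m) =>
      ENNReal.ofReal ((h z.1 - h z.2) ^ 2) :=
    (((hm.comp measurable_fst).sub (hm.comp measurable_snd)).pow_const 2).ennreal_ofReal
  have hgrad : ∀ p ∈ e.source ∩ e ⁻¹' Metric.ball (e x) (3 * r),
      ENNReal.ofReal (gradSq h (e p)) =
        ∑ i, ENNReal.ofReal (mvfderiv (𝓡 m) u p (χ p • coordField x i p) ^ 2) := by
    intro p hp
    have hps := mem_source_iff.1 hp.1
    have hχp : χ p = 1 := by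
      have h1 := interior_subset (hεT (hB3K hp.2)).2
      rwa [Set.mem_ofPred_eq, e.left_inv hp.1] at h1
    rw [gradSq, ENNReal.ofReal_sum_of_nonneg fun _ _ => sq_nonneg _]
    refine Finset.sum_congr rfl fun i _ => ?_
    rw [hχp, one_smul, (hev _ (e.map_source hp.1)).fderiv_eq,
      ← fderiv_comp_symm_fieldInChart hps ((hu p).mdifferentiableAt (by simp)) (coordField x i),
      fieldInChart_extChartAt hps, mvfderiv_extChartAt_coordField hps]
  have h1 : sqDiff vol U U u ≤ C * C * ∫⁻ y in Metric.ball (e x) r,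
      ∫⁻ z in Metric.ball (e x) r, ENNReal.ofReal ((h y - h z) ^ 2) := by
    rw [mul_assoc, ← lintegral_const_mul' _ _ ENNReal.ofReal_ne_top]
    have hk1 : Measurable fun y : EuclideanSpace ℝ (Fin m) =>
        C * ∫⁻ z in Metric.ball (e x) r, ENNReal.ofReal ((h y - h z) ^ 2) :=
      hk.lintegral_prod_right'.const_mul C
    have hk2 : ∀ y, Measurable fun z : EuclideanSpace ℝ (Fin m) =>
        ENNReal.ofReal ((h y - h z) ^ 2) := fun y =>
      ((measurable_const.sub hm).pow_const 2).ennreal_ofReal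
    refine le_trans ?_ (hle _ hk1)
    refine setLIntegral_mono' hU.measurableSet fun p hp => ?_
    refine le_trans (le_of_eq ?_) (hle _ (hk2 (e p)))
    refine setLIntegral_congr_fun hU.measurableSet fun q hq => ?_
    rw [hhe p hp.1, hhe q hq.1]
  have h2 : ∫⁻ y in Metric.ball (e x) (3 * r), ENNReal.ofReal (gradSq h y) ≤
      c⁻¹ * ∑ i, ∫⁻ p, ENNReal.ofReal (mvfderiv (𝓡 m) u p (χ p • coordField x i p) ^ 2) ∂vol.μ := by
    rw [← ENNReal.mul_le_iff_le_inv hc0 hct]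
    refine (hge _ (measurable_gradSq h).ennreal_ofReal).trans ?_
    refine (setLIntegral_congr_fun hU3.measurableSet hgrad).le.trans ?_
    refine (setLIntegral_le_lintegral _ _).trans (le_of_eq (lintegral_finsetSum _ fun i _ => ?_))
    exact ((contMDiff_mvfderiv_apply hu (hX i)).continuous.measurable.pow_const 2).ennreal_ofReal
  refine h1.trans ?_
  rw [mul_assoc (C * C) _ c⁻¹, mul_assoc (C * C)]
  refine mul_le_mul_right ?_ (C * C)
  refine (lintegral_ball_sq_sub_le hsmooth).trans ?_
  rw [mul_assoc _ c⁻¹]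
  exact mul_le_mul_right h2 _

/-- The points `y` that can be compared with `x` form a clopen set: the local inequality supplies
short steps, and estimates chain transitively. Connectedness enters here. -/
theorem exists_nhds_dirichletBounded_pair [ConnectedSpace M] (x y : M) :
    ∃ U ∈ 𝓝 x, ∃ V ∈ 𝓝 y, DirichletBounded vol (sqDiff vol U V) := by
  have trans : ∀ y z, (∃ U ∈ 𝓝 x, ∃ V ∈ 𝓝 y, DirichletBounded vol (sqDiff vol U V)) →
      (∃ U ∈ 𝓝 y, ∃ V ∈ 𝓝 z, DirichletBounded vol (sqDiff vol U V)) →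
      ∃ U ∈ 𝓝 x, ∃ V ∈ 𝓝 z, DirichletBounded vol (sqDiff vol U V) := by
    rintro y z ⟨U, hU, V, hV, h⟩ ⟨V', hV', W, hW, h'⟩
    refine ⟨U, hU, W, hW, ?_⟩
    -- The chaining estimate carries the mass of the intermediate set on its left side, so that mass
    -- must be nonzero and finite to divide by.
    have hV0 : vol.μ (V ∩ V') ≠ 0 := (Measure.measure_pos_of_mem_nhds _ (Filter.inter_mem hV hV')).ne'
    have hVt : vol.μ (V ∩ V') ≠ ⊤ := measure_ne_top _ _
    have h1 : DirichletBounded vol (sqDiff vol U (V ∩ V')) :=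
      h.mono fun u _ => sqDiff_mono vol (subset_refl U) Set.inter_subset_left u
    have h2 : DirichletBounded vol (sqDiff vol (V ∩ V') W) :=
      h'.mono fun u _ => sqDiff_mono vol Set.inter_subset_right (subset_refl W) u
    have h3 := (h1.const_mul (c := 2 * vol.μ W)
      (ENNReal.mul_ne_top (by simp) (measure_ne_top _ _))).add
      (h2.const_mul (c := 2 * vol.μ U) (ENNReal.mul_ne_top (by simp) (measure_ne_top _ _)))
    refine (h3.const_mul (c := (vol.μ (V ∩ V'))⁻¹) (by simpa using hV0)).mono fun u hu => ?_
    rw [← ENNReal.mul_le_iff_le_inv hV0 hVt]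
    exact measure_mul_sqDiff_le vol U (V ∩ V') W hu.continuous.measurable
  let A : Set M := {y | ∃ U ∈ 𝓝 x, ∃ V ∈ 𝓝 y, DirichletBounded vol (sqDiff vol U V)}
  have hloc : ∀ y : M, ∃ U ∈ 𝓝 y, ∀ z ∈ U, (∃ V ∈ 𝓝 y, ∃ V' ∈ 𝓝 z,
      DirichletBounded vol (sqDiff vol V V')) ∧ (∃ V' ∈ 𝓝 z, ∃ V ∈ 𝓝 y,
      DirichletBounded vol (sqDiff vol V' V)) := by
    intro y
    obtain ⟨U, hU, h⟩ := exists_nhds_dirichletBounded vol y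
    refine ⟨interior U, interior_mem_nhds.2 hU, fun z hz => ?_⟩
    have hz' := mem_interior_iff_mem_nhds.1 hz
    exact ⟨⟨U, hU, U, hz', h⟩, ⟨U, hz', U, hU, h⟩⟩
  have hopen : IsOpen A := by
    rw [isOpen_iff_mem_nhds]
    intro y hy
    obtain ⟨U, hU, h⟩ := hloc y
    filter_upwards [hU] with z hz using trans y z hy (h z hz).1
  have hclosed : IsClosed A := by
    rw [← isOpen_compl_iff, isOpen_iff_mem_nhds]
    intro y hy
    obtain ⟨U, hU, h⟩ := hloc y
    filter_upwards [hU] with z hz using fun hzA => hy (trans z y hzA (h z hz).2)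
  have hx : x ∈ A := by
    obtain ⟨U, hU, h⟩ := exists_nhds_dirichletBounded vol x
    exact ⟨U, hU, U, hU, h⟩
  have hA : A = Set.univ := IsClopen.eq_univ ⟨hclosed, hopen⟩ ⟨x, hx⟩
  exact (hA ▸ Set.mem_univ y : y ∈ A)

/-- Compactness is used twice: first to cover the second variable for a fixed neighbourhood in the
first, then to cover the first. -/
theorem dirichletBounded_sqDiff_univ [ConnectedSpace M] :
    DirichletBounded vol (sqDiff vol Set.univ Set.univ) := by
  have h1 : ∀ x : M, ∃ U ∈ 𝓝 x, DirichletBounded vol (sqDiff vol U Set.univ) := by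
    intro x
    refine isCompact_univ.induction_on (p := fun s => ∃ U ∈ 𝓝 x,
      DirichletBounded vol (sqDiff vol U s)) ⟨Set.univ, Filter.univ_mem, ?_⟩ ?_ ?_ ?_
    · exact dirichletBounded_zero.mono fun u _ => by simp [sqDiff]
    · rintro s t hst ⟨U, hU, h⟩
      exact ⟨U, hU, h.mono fun u _ => sqDiff_mono vol subset_rfl hst u⟩
    · rintro s t ⟨U, hU, h⟩ ⟨U', hU', h'⟩
      refine ⟨U ∩ U', Filter.inter_mem hU hU', (h.add h').mono fun u hu => ?_⟩
      refine (lintegral_mono fun p => lintegral_union_le _ s t).trans ?_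
      rw [lintegral_add_left
        (measurable_sqDiff_kernel hu.continuous.measurable).lintegral_prod_right']
      exact add_le_add (lintegral_mono_set Set.inter_subset_left)
        (lintegral_mono_set Set.inter_subset_right)
    · intro y _
      obtain ⟨U, hU, V, hV, h⟩ := exists_nhds_dirichletBounded_pair vol x y
      exact ⟨V, mem_nhdsWithin_of_mem_nhds hV, U, hU, h⟩
  refine isCompact_univ.induction_on (p := fun s => DirichletBounded vol (sqDiff vol s Set.univ))
    ?_ ?_ ?_ ?_
  · exact dirichletBounded_zero.mono fun u _ => by simp [sqDiff]
  · exact fun s t hst h => h.mono fun u _ => sqDiff_mono vol hst subset_rfl u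
  · exact fun s t h h' => (h.add h').mono fun u _ => lintegral_union_le _ s t
  · intro x _
    obtain ⟨U, hU, h⟩ := h1 x
    exact ⟨U, mem_nhdsWithin_of_mem_nhds hU, h⟩

/-- The Poincaré inequality on a compact connected manifold. -/
theorem exists_poincare [ConnectedSpace M] :
    ∃ (ι : Type) (_ : Fintype ι) (X : ι → VField m M) (C : ℝ), (∀ k, SmoothField (X k)) ∧
      0 ≤ C ∧ ∀ u : M → ℝ, ContMDiff (𝓡 m) 𝓘(ℝ, ℝ) ∞ u → ∃ c : ℝ,
        ∫ p, (u p - c) ^ 2 ∂vol.μ ≤ C * ∑ k, ∫ p, mvfderiv (𝓡 m) u p (X k p) ^ 2 ∂vol.μ := by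
  obtain ⟨ι, hι, X, C, hX, hC, h⟩ := dirichletBounded_sqDiff_univ vol
  set V := vol.μ.real Set.univ with hV
  have hV0 : 0 < V := by
    rw [hV, measureReal_def]
    exact ENNReal.toReal_pos (isOpen_univ.measure_pos _ Set.univ_nonempty).ne' (measure_ne_top _ _)
  -- The double integral of (u p - u q)² equals 2V times the integral of (u - I/V)², which explains
  -- the factor 2V and the choice of the mean I/V as the constant below.
  refine ⟨ι, hι, X, C.toReal / (2 * V), hX, by positivity, fun u hu => ?_⟩
  have hi1 := integrable_of_contMDiff vol hu
  have hi2 : Integrable (fun p => u p ^ 2) vol.μ := integrable_of_contMDiff vol (hu.pow 2)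
  set I := ∫ p, u p ∂vol.μ
  set J := ∫ p, u p ^ 2 ∂vol.μ
  have hsq : ∀ a : ℝ, ∫ p, (a - u p) ^ 2 ∂vol.μ = V * a ^ 2 - 2 * a * I + J := by
    intro a
    have h1 : ∀ p, (a - u p) ^ 2 = a ^ 2 - 2 * a * u p + u p ^ 2 := fun p => by ring
    simp only [h1]
    have h2 : Integrable (fun p => a ^ 2 - 2 * a * u p) vol.μ :=
      (integrable_const _).sub (hi1.const_mul _)
    rw [integral_add h2 hi2,
      integral_sub (integrable_const _) (hi1.const_mul _), integral_const, integral_const_mul]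
    simp [hV, I, J]
  refine ⟨I / V, ?_⟩
  have h1 : ∫ p, (u p - I / V) ^ 2 ∂vol.μ = J - I ^ 2 / V := by
    have : ∀ p, (u p - I / V) ^ 2 = (I / V - u p) ^ 2 := fun p => by ring
    simp only [this, hsq]
    field_simp
    ring
  have h2 : ∫ p, ∫ q, (u p - u q) ^ 2 ∂vol.μ ∂vol.μ = 2 * (V * J - I ^ 2) := by
    simp only [hsq]
    have h2 : Integrable (fun p => V * u p ^ 2 - 2 * u p * I) vol.μ :=
      (hi2.const_mul _).sub ((hi1.const_mul 2).mul_const I)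
    rw [integral_add h2 (integrable_const _),
      integral_sub (hi2.const_mul _) ((hi1.const_mul 2).mul_const I), integral_const_mul,
      integral_mul_const, integral_const_mul, integral_const]
    simp only [← hV, smul_eq_mul]
    ring
  have h3 : sqDiff vol Set.univ Set.univ u = ENNReal.ofReal (2 * (V * J - I ^ 2)) := by
    have hint : ∀ a : ℝ, Integrable (fun q => (a - u q) ^ 2) vol.μ := fun a =>
      integrable_of_contMDiff vol ((contMDiff_const.sub hu).pow 2)
    rw [← h2, ofReal_integral_eq_lintegral_ofReal]
    · simp only [sqDiff, Measure.restrict_univ]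
      refine lintegral_congr fun p => ?_
      rw [ofReal_integral_eq_lintegral_ofReal (hint _) (.of_forall fun q => sq_nonneg _)]
    · simp only [hsq]
      exact ((hi2.const_mul _).sub ((hi1.const_mul 2).mul_const I)).add (integrable_const _)
    · exact .of_forall fun p => integral_nonneg fun q => sq_nonneg _
  have h4 := h u hu
  have h5 : ∀ k, ∫⁻ p, ENNReal.ofReal (mvfderiv (𝓡 m) u p (X k p) ^ 2) ∂vol.μ =
      ENNReal.ofReal (∫ p, mvfderiv (𝓡 m) u p (X k p) ^ 2 ∂vol.μ) := fun k =>
    (ofReal_integral_eq_lintegral_ofReal (integrable_of_contMDiff vol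
      ((contMDiff_mvfderiv_apply hu (hX k)).pow 2)) (.of_forall fun p => sq_nonneg _)).symm
  have hnn : 0 ≤ ∑ k, ∫ p, mvfderiv (𝓡 m) u p (X k p) ^ 2 ∂vol.μ :=
    Finset.sum_nonneg fun k _ => integral_nonneg fun p => sq_nonneg _
  rw [h3, Finset.sum_congr rfl fun k _ => h5 k, ← ENNReal.ofReal_sum_of_nonneg
    fun k _ => integral_nonneg fun p => sq_nonneg _, ← ENNReal.ofReal_toReal hC,
    ← ENNReal.ofReal_mul ENNReal.toReal_nonneg, ENNReal.ofReal_le_ofReal_iff (by positivity)] at h4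
  rw [h1, div_mul_eq_mul_div, le_div_iff₀ (by positivity)]
  refine le_trans (le_of_eq ?_) h4
  field_simp

end Poincare
end
end SubRiem

namespace SubRiem
noncomputable section

/-! ### Lie algebra and Darboux derivatives of the Heisenberg group. -/

namespace Heis

variable {n : ℕ}

/-- The coordinate `a_j`. -/
def coordA (j : Fin n) : Heis n →L[ℝ] ℝ :=
  (EuclideanSpace.proj j).comp (ContinuousLinearMap.fst ℝ (EuclideanSpace ℝ (Fin n))
    (EuclideanSpace ℝ (Fin n) × ℝ))

/-- The coordinate `b_j`. -/
def coordB (j : Fin n) : Heis n →L[ℝ] ℝ :=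
  (EuclideanSpace.proj j).comp ((ContinuousLinearMap.fst ℝ (EuclideanSpace ℝ (Fin n)) ℝ).comp
    (ContinuousLinearMap.snd ℝ (EuclideanSpace ℝ (Fin n)) (EuclideanSpace ℝ (Fin n) × ℝ)))

/-- The coordinate `c`. -/
def coordC : Heis n →L[ℝ] ℝ :=
  (ContinuousLinearMap.snd ℝ (EuclideanSpace ℝ (Fin n)) ℝ).comp
    (ContinuousLinearMap.snd ℝ (EuclideanSpace ℝ (Fin n)) (EuclideanSpace ℝ (Fin n) × ℝ))

@[simp] theorem a_add (p q : Heis n) : (p + q).a = p.a + q.a := rfl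
@[simp] theorem b_add (p q : Heis n) : (p + q).b = p.b + q.b := rfl
@[simp] theorem c_add (p q : Heis n) : (p + q).c = p.c + q.c := rfl
@[simp] theorem a_sub (p q : Heis n) : (p - q).a = p.a - q.a := rfl
@[simp] theorem b_sub (p q : Heis n) : (p - q).b = p.b - q.b := rfl
@[simp] theorem c_sub (p q : Heis n) : (p - q).c = p.c - q.c := rfl
@[simp] theorem a_smul (r : ℝ) (p : Heis n) : (r • p).a = r • p.a := rfl
@[simp] theorem b_smul (r : ℝ) (p : Heis n) : (r • p).b = r • p.b := rfl
@[simp] theorem c_smul (r : ℝ) (p : Heis n) : (r • p).c = r * p.c := rfl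

/-- The linear map `q ↦ (0, 0, ½ (⟨q.a, p.b⟩ - ⟨p.a, q.b⟩))`. -/
def twist (p : Heis n) : Heis n →L[ℝ] Heis n := LinearMap.toContinuousLinearMap
  { toFun := fun q => mk 0 0 ((1 / 2) * (inner ℝ q.a p.b - inner ℝ p.a q.b))
    map_add' := fun q r => by
      ext1
      · simp
      · simp
      · simp only [c_mk, c_add, a_add, b_add, inner_add_left, inner_add_right]
        ring
    map_smul' := fun t q => by
      ext1
      · simp
      · simp
      · simp only [c_mk, c_smul, a_smul, b_smul, real_inner_smul_left, real_inner_smul_right,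
          RingHom.id_apply]
        ring }

theorem twist_apply (p q : Heis n) :
    twist p q = mk 0 0 ((1 / 2) * (inner ℝ q.a p.b - inner ℝ p.a q.b)) := rfl

/-- Left translation is affine, so its derivative is the same at every point. Invariant fields and
the Maurer–Cartan form are both read off from this. -/
theorem mul_eq_sub_twist (p q : Heis n) : p * q = p + (q - twist p q) := by
  ext1
  · simp [mul_def, twist_apply]
  · simp [mul_def, twist_apply]
  · simp only [mul_def, twist_apply, c_mk, c_add, c_sub]
    ring

/-- Antisymmetry of the symplectic form exhibits the left-invariant field generated by `q` as an
affine function of the base point `p`. -/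
theorem sub_twist_comm (p q : Heis n) : q - twist p q = q + twist q p := by
  ext1
  · simp [twist_apply]
  · simp [twist_apply]
  · simp only [twist_apply, c_mk, c_add, c_sub]
    ring

theorem hasFDerivAt_mul_left (p q : Heis n) :
    HasFDerivAt (fun r => p * r) (ContinuousLinearMap.id ℝ (Heis n) - twist p) q := by
  have h := ((ContinuousLinearMap.id ℝ (Heis n) - twist p).hasFDerivAt (x := q)).const_add p
  refine h.congr_of_eventuallyEq (.of_forall fun r => ?_)
  exact mul_eq_sub_twist p r

theorem mfderiv_mul_left (p q : Heis n) :
    mfderiv 𝓘(ℝ, Heis n) 𝓘(ℝ, Heis n) (fun r => p * r) q =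
      (ContinuousLinearMap.id ℝ (Heis n) - twist p : Heis n →L[ℝ] Heis n) := by
  rw [mfderiv_eq_fderiv]
  exact (hasFDerivAt_mul_left p q).fderiv

theorem one_eq_zero : (1 : Heis n) = 0 := rfl

theorem mlieBracket_eq_lieBracket {E : Type*} [NormedAddCommGroup E] [NormedSpace ℝ E]
    (V W : (x : E) → TangentSpace 𝓘(ℝ, E) x) (x : E) :
    VectorField.mlieBracket 𝓘(ℝ, E) V W x = VectorField.lieBracket ℝ V W x := by
  rw [← VectorField.mlieBracketWithin_univ, VectorField.mlieBracketWithin_eq_lieBracketWithin]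
  exact congrFun VectorField.lieBracketWithin_univ x

/-- Left-invariant fields are affine with linear part `twist`, and the identity is the origin, so
the bracket there is `twist B A - twist A B`; the two halves add up. -/
theorem lieCoord_bracket (A B : GroupLieAlgebra 𝓘(ℝ, Heis n) (Heis n)) :
    lieCoord ⁅A, B⁆ = mk 0 0 (inner ℝ (lieCoord A).a (lieCoord B).b -
      inner ℝ (lieCoord B).a (lieCoord A).b) := by
  have hV : ∀ A : GroupLieAlgebra 𝓘(ℝ, Heis n) (Heis n), (mulInvariantVectorField A :
      (g : Heis n) → TangentSpace 𝓘(ℝ, Heis n) g) =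
      fun g : Heis n => lieCoord A + twist (lieCoord A) g := by
    intro A
    funext g
    rw [← sub_twist_comm]
    exact DFunLike.congr_fun (mfderiv_mul_left g 1) A
  have hd : ∀ (v g : Heis n), HasFDerivAt (fun g => v + twist v g) (twist v) g := fun v g =>
    (twist v).hasFDerivAt.const_add v
  rw [GroupLieAlgebra.bracket_def, hV, hV]
  refine (congrArg lieCoord (mlieBracket_eq_lieBracket _ _ _)).trans ?_
  change VectorField.lieBracket ℝ (fun g : Heis n => lieCoord A + twist (lieCoord A) g)
      (fun g : Heis n => lieCoord B + twist (lieCoord B) g) 1 = _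
  rw [VectorField.lieBracket, (hd _ _).fderiv, (hd _ _).fderiv, one_eq_zero, map_zero, map_zero,
    add_zero, add_zero]
  ext1
  · simp [twist_apply]
  · simp [twist_apply]
  · simp only [twist_apply, c_mk, c_sub]
    ring

theorem lieCoord_maurerCartan (p : Heis n) (w : TangentSpace 𝓘(ℝ, Heis n) p) :
    lieCoord (maurerCartan 𝓘(ℝ, Heis n) p w) =
      NormedSpace.fromTangentSpace p w - twist (p⁻¹) (NormedSpace.fromTangentSpace p w) :=
  DFunLike.congr_fun (mfderiv_mul_left p⁻¹ p) w

theorem mem_standard_e {A : GroupLieAlgebra 𝓘(ℝ, Heis n) (Heis n)} :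
    A ∈ (standard n).e ↔ (lieCoord A).c = 0 := Iff.rfl

theorem standard_inner (v w : (standard n).e) : (standard n).inner v w =
    inner ℝ (lieCoord (v : GroupLieAlgebra 𝓘(ℝ, Heis n) (Heis n))).a
      (lieCoord (w : GroupLieAlgebra 𝓘(ℝ, Heis n) (Heis n))).a +
    inner ℝ (lieCoord (v : GroupLieAlgebra 𝓘(ℝ, Heis n) (Heis n))).b
      (lieCoord (w : GroupLieAlgebra 𝓘(ℝ, Heis n) (Heis n))).b := rfl

theorem normSq_standard {A : GroupLieAlgebra 𝓘(ℝ, Heis n) (Heis n)} (hA : (lieCoord A).c = 0) :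
    (standard n).normSq A = ∑ j, ((lieCoord A).a j ^ 2 + (lieCoord A).b j ^ 2) := by
  rw [LeftInvariantStructure.normSq, dif_pos (mem_standard_e.2 hA), standard_inner,
    Finset.sum_add_distrib]
  simp only [PiLp.inner_apply, RCLike.inner_apply, conj_trivial, pow_two]

section Maps

variable {m : ℕ} {M : Type*} [TopologicalSpace M] [ChartedSpace (EuclideanSpace ℝ (Fin m)) M]

/-- The `j`-th component of `u = a ∘ f`. -/
def fA (f : M → Heis n) (j : Fin n) (x : M) : ℝ := (f x).a j

/-- The `j`-th component of `v = b ∘ f`. -/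
def fB (f : M → Heis n) (j : Fin n) (x : M) : ℝ := (f x).b j

/-- `w = c ∘ f`. -/
def fC (f : M → Heis n) (x : M) : ℝ := (f x).c

variable {f : M → Heis n}

theorem contMDiff_fA (hf : ContMDiff (𝓡 m) 𝓘(ℝ, Heis n) ∞ f) (j : Fin n) : ContMDiff (𝓡 m) 𝓘(ℝ, ℝ) ∞ (fA f j) :=
  (coordA j).contMDiff.comp hf

theorem contMDiff_fB (hf : ContMDiff (𝓡 m) 𝓘(ℝ, Heis n) ∞ f) (j : Fin n) : ContMDiff (𝓡 m) 𝓘(ℝ, ℝ) ∞ (fB f j) :=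
  (coordB j).contMDiff.comp hf

theorem contMDiff_fC (hf : ContMDiff (𝓡 m) 𝓘(ℝ, Heis n) ∞ f) : ContMDiff (𝓡 m) 𝓘(ℝ, ℝ) ∞ (fC f) :=
  (coordC (n := n)).contMDiff.comp hf

variable [IsManifold (𝓡 m) ∞ M]

theorem lieCoord_darboux_a (hf : ContMDiff (𝓡 m) 𝓘(ℝ, Heis n) ∞ f) (x : M) (v : TangentSpace (𝓡 m) x) (j : Fin n) :
    (lieCoord (darboux m 𝓘(ℝ, Heis n) f x v)).a j = mvfderiv (𝓡 m) (fA f j) x v := by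
  refine Eq.trans ?_ (mvfderiv_clm_comp (coordA j) ((hf x).mdifferentiableAt (by simp)) v).symm
  refine (congrArg (coordA j) (lieCoord_maurerCartan (f x) _)).trans ?_
  rw [map_sub]
  exact sub_zero _

theorem lieCoord_darboux_b (hf : ContMDiff (𝓡 m) 𝓘(ℝ, Heis n) ∞ f) (x : M) (v : TangentSpace (𝓡 m) x) (j : Fin n) :
    (lieCoord (darboux m 𝓘(ℝ, Heis n) f x v)).b j = mvfderiv (𝓡 m) (fB f j) x v := by
  refine Eq.trans ?_ (mvfderiv_clm_comp (coordB j) ((hf x).mdifferentiableAt (by simp)) v).symm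
  refine (congrArg (coordB j) (lieCoord_maurerCartan (f x) _)).trans ?_
  rw [map_sub]
  exact sub_zero _

/-- The pulled-back contact form dw - ½ Σ (u_j dv_j - v_j du_j); horizontality of `f` is its
vanishing on `D`. -/
theorem lieCoord_darboux_c (hf : ContMDiff (𝓡 m) 𝓘(ℝ, Heis n) ∞ f) (x : M) (v : TangentSpace (𝓡 m) x) :
    (lieCoord (darboux m 𝓘(ℝ, Heis n) f x v)).c = mvfderiv (𝓡 m) (fC f) x v -
      (1 / 2) * ∑ j, (fA f j x * mvfderiv (𝓡 m) (fB f j) x v -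
        fB f j x * mvfderiv (𝓡 m) (fA f j) x v) := by
  have hd := (hf x).mdifferentiableAt (n := ∞) (by simp)
  have hA : ∀ j, mvfderiv (𝓡 m) (fA f j) x v = (mvfderiv (𝓡 m) f x v).a j := fun j =>
    mvfderiv_clm_comp (coordA j) hd v
  have hB : ∀ j, mvfderiv (𝓡 m) (fB f j) x v = (mvfderiv (𝓡 m) f x v).b j := fun j =>
    mvfderiv_clm_comp (coordB j) hd v
  have hC : mvfderiv (𝓡 m) (fC f) x v = (mvfderiv (𝓡 m) f x v).c :=
    mvfderiv_clm_comp coordC hd v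
  refine (congrArg c (lieCoord_maurerCartan (f x) _)).trans ?_
  change (mvfderiv (𝓡 m) f x v - twist (f x)⁻¹ (mvfderiv (𝓡 m) f x v)).c = _
  simp only [hA, hB, hC, c_sub, twist_apply, c_mk, inv_def, a_mk, b_mk, inner_neg_left,
    inner_neg_right, PiLp.inner_apply, RCLike.inner_apply, conj_trivial, fA, fB,
    Finset.sum_sub_distrib]
  simp only [mul_comm]
  ring

end Maps

end Heis
end
end SubRiem

namespace SubRiem
noncomputable section

/-! ### Linearity of the divergence. -/

section Divergence

set_option linter.unusedSectionVars false

variable {m : ℕ} {M : Type*} [TopologicalSpace M] [ChartedSpace (EuclideanSpace ℝ (Fin m)) M]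
  [IsManifold (𝓡 m) ∞ M] [MeasurableSpace M] (vol : VolumeDensity m M)

theorem VolumeDensity.div_const_smul (r : ℝ) {X : VField m M} {x : M} (hX : SmoothFieldAt X x) :
    vol.div (fun y => r • X y) x = r * vol.div X x := by
  rw [vol.div_eq_divIn, vol.divIn_smul (mem_chart_source _ x) contMDiffAt_const hX, mvfderiv_const,
    vol.div_eq_divIn]
  exact add_zero _

theorem VolumeDensity.div_add {X X' : VField m M} {x : M} (hX : SmoothFieldAt X x)
    (hX' : SmoothFieldAt X' x) : vol.div (fun y => X y + X' y) x = vol.div X x + vol.div X' x :=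
  vol.divIn_add (mem_chart_source _ x) hX hX'

theorem VolumeDensity.div_zero (x : M) : vol.div (fun _ : M => 0) x = 0 := by
  unfold VolumeDensity.div fieldInChart
  simp only [map_zero, smul_zero, fderiv_fun_const, Pi.zero_apply]
  exact (congrArg _ (map_zero _)).trans (mul_zero _)

theorem VolumeDensity.div_sum {ι : Type*} (s : Finset ι) {X : ι → VField m M} {x : M}
    (hX : ∀ i ∈ s, SmoothFieldAt (X i) x) :
    vol.div (fun y => ∑ i ∈ s, X i y) x = ∑ i ∈ s, vol.div (X i) x := by
  classical
  induction s using Finset.induction_on with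
  | empty => simpa using vol.div_zero x
  | insert i s hi ih =>
    simp only [Finset.sum_insert hi]
    rw [vol.div_add (hX i (Finset.mem_insert_self i s))
      (SmoothFieldAt.sum fun j hj => hX j (Finset.mem_insert_of_mem hj)),
      ih fun j hj => hX j (Finset.mem_insert_of_mem hj)]

/-- Only the restriction to `D` matters, which is why a multiplier prescribed merely on `D` still
determines the divergences in the Euler–Lagrange equation. -/
theorem SubRiemannianStructure.sharp_congr (S : SubRiemannianStructure m M) {x : M}
    {β β' : TangentSpace (𝓡 m) x →L[ℝ] ℝ} (h : ∀ v ∈ S.D x, β v = β' v) :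
    S.sharp x β = S.sharp x β' :=
  Finset.sum_congr rfl fun i _ => by rw [h _ (S.onb_mem x i)]

end Divergence

/-! ### Normal multipliers and the equation for ζ. -/

namespace Heis

variable {n : ℕ}

/-- The element `A_j` of the Lie algebra. -/
def lieA (j : Fin n) : GroupLieAlgebra 𝓘(ℝ, Heis n) (Heis n) :=
  lieCoord.symm (mk (EuclideanSpace.single j 1) 0 0)

/-- The element `B_j` of the Lie algebra. -/
def lieB (j : Fin n) : GroupLieAlgebra 𝓘(ℝ, Heis n) (Heis n) :=
  lieCoord.symm (mk 0 (EuclideanSpace.single j 1) 0)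

/-- The element `C` of the Lie algebra. -/
def lieC : GroupLieAlgebra 𝓘(ℝ, Heis n) (Heis n) := lieCoord.symm (mk 0 0 1)

theorem lieCoord_lieA (j : Fin n) : lieCoord (lieA j) = mk (EuclideanSpace.single j 1) 0 0 :=
  lieCoord.apply_symm_apply _

theorem lieCoord_lieB (j : Fin n) : lieCoord (lieB j) = mk 0 (EuclideanSpace.single j 1) 0 :=
  lieCoord.apply_symm_apply _

theorem lieCoord_lieC : lieCoord (lieC (n := n)) = mk 0 0 1 :=
  lieCoord.apply_symm_apply _

theorem bracket_eq_smul_lieC (A B : GroupLieAlgebra 𝓘(ℝ, Heis n) (Heis n)) :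
    ⁅A, B⁆ = (∑ j, ((lieCoord A).a j * (lieCoord B).b j -
      (lieCoord B).a j * (lieCoord A).b j)) • lieC (n := n) := by
  apply lieCoord.injective
  rw [lieCoord_bracket, map_smul, lieCoord_lieC]
  ext1
  · simp
  · simp
  · rw [c_smul, c_mk, c_mk, mul_one]
    simp only [PiLp.inner_apply, RCLike.inner_apply, conj_trivial,
      Finset.sum_sub_distrib, mul_comm]

theorem isSharp_standard_apply_lieA {β : GroupLieAlgebra 𝓘(ℝ, Heis n) (Heis n) → ℝ}
    {A : GroupLieAlgebra 𝓘(ℝ, Heis n) (Heis n)} (h : (standard n).IsSharp β A) (j : Fin n) :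
    β (lieA j) = (lieCoord A).a j := by
  obtain ⟨hA, h⟩ := h
  have hj : lieA j ∈ (standard n).e := mem_standard_e.2 (by rw [lieCoord_lieA, c_mk])
  rw [← h ⟨_, hj⟩, standard_inner, lieCoord_lieA, a_mk, b_mk, inner_zero_right, add_zero,
    EuclideanSpace.inner_single_right]
  simp

theorem isSharp_standard_apply_lieB {β : GroupLieAlgebra 𝓘(ℝ, Heis n) (Heis n) → ℝ}
    {A : GroupLieAlgebra 𝓘(ℝ, Heis n) (Heis n)} (h : (standard n).IsSharp β A) (j : Fin n) :
    β (lieB j) = (lieCoord A).b j := by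
  obtain ⟨hA, h⟩ := h
  have hj : lieB j ∈ (standard n).e := mem_standard_e.2 (by rw [lieCoord_lieB, c_mk])
  rw [← h ⟨_, hj⟩, standard_inner, lieCoord_lieB, a_mk, b_mk, inner_zero_right, zero_add,
    EuclideanSpace.inner_single_right]
  simp

section Maps

set_option linter.unusedSectionVars false

variable {m : ℕ} {M : Type*} [TopologicalSpace M] [ChartedSpace (EuclideanSpace ℝ (Fin m)) M]
  [IsManifold (𝓡 m) ∞ M] [T2Space M] [CompactSpace M] [MeasurableSpace M]
  {S : SubRiemannianStructure m M}
  {vol : VolumeDensity m M} {nabla : Connection m M} {f : M → Heis n}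

/-- The Euler-Lagrange equation of normal harmonic maps, evaluated at an element of the Lie
algebra. -/
theorem euler_lagrange_iff (hnabla : IsCompatible S vol nabla)
    (hf : ContMDiff (𝓡 m) 𝓘(ℝ, Heis n) ∞ f)
    {lam : DualForm1 m M 𝓘(ℝ, Heis n) (Heis n)} (hlam : ∀ B, SmoothForm1 (lam B)) (x : M)
    (B : GroupLieAlgebra 𝓘(ℝ, Heis n) (Heis n)) :
    deltaD S nabla lam x B - S.trace x (fun v w =>
      coad (darboux m 𝓘(ℝ, Heis n) f x v) (fun B' => lam B' x w) B) = 0 ↔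
    vol.div (fun y => S.sharp y (lam B y)) x =
      ∑ j, ((lieCoord B).b j * mvfderiv (𝓡 m) (fA f j) x (S.sharp x (lam lieC x)) -
        (lieCoord B).a j * mvfderiv (𝓡 m) (fB f j) x (S.sharp x (lam lieC x))) := by
  -- Every bracket is a multiple of `lieC`, so the coadjoint term sees only λ(C), and its trace is a
  -- pairing of du_j, dv_j with ♯λ(C).
  have h1 : S.trace x (fun v w =>
      coad (darboux m 𝓘(ℝ, Heis n) f x v) (fun B' => lam B' x w) B) =
      - ∑ j, ((lieCoord B).b j * mvfderiv (𝓡 m) (fA f j) x (S.sharp x (lam lieC x)) -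
        (lieCoord B).a j * mvfderiv (𝓡 m) (fB f j) x (S.sharp x (lam lieC x))) := by
    simp only [S.apply_sharp, Finset.mul_sum, ← Finset.sum_sub_distrib]
    rw [Finset.sum_comm, ← Finset.sum_neg_distrib]
    refine Finset.sum_congr rfl fun i _ => ?_
    simp only [coad, bracket_eq_smul_lieC, map_smul, Pi.smul_apply, smul_apply, smul_eq_mul,
      lieCoord_darboux_a hf, lieCoord_darboux_b hf, Finset.sum_mul]
    congr 1
    refine Finset.sum_congr rfl fun j _ => ?_
    ring
  rw [deltaD, trace_covDerivForm_eq_div vol S nabla hnabla.laplacian (hlam B x), h1, sub_neg_eq_add,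
    neg_add_eq_zero]

/-- Split into real and imaginary parts: i Y(u + iv) = -Yv + i Yu. -/
theorem zeta_equation_iff (hf : ContMDiff (𝓡 m) 𝓘(ℝ, Heis n) ∞ f) (j : Fin n) (x : M)
    (v : TangentSpace (𝓡 m) x) :
    subLaplacianC S vol (zeta f j) x - Complex.I * mvfderiv (𝓡 m) (zeta f j) x v = 0 ↔
      subLaplacian S vol (fA f j) x = - mvfderiv (𝓡 m) (fB f j) x v ∧
        subLaplacian S vol (fB f j) x = mvfderiv (𝓡 m) (fA f j) x v := by
  have hre : (fun y => (zeta f j y).re) = fA f j := by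
    funext y
    simp [zeta, fA]
  have him : (fun y => (zeta f j y).im) = fB f j := by
    funext y
    simp [zeta, fB]
  have hz : ContMDiff (𝓡 m) 𝓘(ℝ, ℂ) ∞ (zeta f j) :=
    (Complex.ofRealCLM.contMDiff.comp (contMDiff_fA hf j)).add
      ((ContinuousLinearMap.contMDiff (Complex.I • Complex.ofRealCLM)).comp (contMDiff_fB hf j))
  have hd := (hz x).mdifferentiableAt (n := ∞) (by simp)
  have h1 : (mvfderiv (𝓡 m) (zeta f j) x v).re = mvfderiv (𝓡 m) (fA f j) x v := by
    rw [← hre]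
    exact (mvfderiv_clm_comp Complex.reCLM hd v).symm
  have h2 : (mvfderiv (𝓡 m) (zeta f j) x v).im = mvfderiv (𝓡 m) (fB f j) x v := by
    rw [← him]
    exact (mvfderiv_clm_comp Complex.imCLM hd v).symm
  rw [subLaplacianC, hre, him, Complex.ext_iff]
  simp only [Complex.sub_re, Complex.add_re, Complex.ofReal_re, Complex.mul_re, Complex.I_re,
    zero_mul, Complex.I_im, one_mul, Complex.ofReal_im, sub_zero, h2, Complex.zero_re,
    Complex.sub_im, Complex.add_im, Complex.mul_im, h1, Complex.zero_im, zero_sub]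
  constructor
  · rintro ⟨h, h'⟩
    constructor <;> linarith
  · rintro ⟨h, h'⟩
    constructor <;> linarith

/-- A normal multiplier determines the vector field in the equation for `ζ`. -/
theorem exists_field_of_normal (hnabla : IsCompatible S vol nabla)
    (hf : ContMDiff (𝓡 m) 𝓘(ℝ, Heis n) ∞ f)
    {lam : DualForm1 m M 𝓘(ℝ, Heis n) (Heis n)} (hlam : ∀ B, SmoothForm1 (lam B))
    (hsharp : ∀ x, ∀ v ∈ S.D x, (standard n).IsSharp (fun B => lam B x v)
      (darboux m 𝓘(ℝ, Heis n) f x v))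
    (heq : ∀ x B, deltaD S nabla lam x B - S.trace x (fun v w =>
      coad (darboux m 𝓘(ℝ, Heis n) f x v) (fun B' => lam B' x w) B) = 0) :
    ∃ Y : VField m M, SmoothField Y ∧ S.IsHorizontalField Y ∧ (∀ x, vol.div Y x = 0) ∧
      ∀ (j : Fin n) (x : M),
        subLaplacianC S vol (zeta f j) x - Complex.I * mvfderiv (𝓡 m) (zeta f j) x (Y x) = 0 := by
  have hEL := fun x B => (euler_lagrange_iff hnabla hf hlam x B).1 (heq x B)
  -- The field is ♯λ(C). It is divergence free because C is central, so the Euler–Lagrange equation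
  -- at C has no bracket term.
  refine ⟨fun x => S.sharp x (lam lieC x), fun x => SmoothForm1At.sharp S (hlam lieC x),
    fun x => S.sharp_mem x _, fun x => ?_, fun j x => ?_⟩
  · rw [hEL x lieC, lieCoord_lieC]
    simp
  · rw [zeta_equation_iff hf]
    have hA : (fun y => S.sharp y (mvfderiv (𝓡 m) (fA f j) y)) =
        fun y => S.sharp y (lam (lieA j) y) := funext fun y => S.sharp_congr fun v hv => by
      rw [← lieCoord_darboux_a hf, ← isSharp_standard_apply_lieA (hsharp y v hv)]
    have hB : (fun y => S.sharp y (mvfderiv (𝓡 m) (fB f j) y)) =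
        fun y => S.sharp y (lam (lieB j) y) := funext fun y => S.sharp_congr fun v hv => by
      rw [← lieCoord_darboux_b hf, ← isSharp_standard_apply_lieB (hsharp y v hv)]
    rw [subLaplacian, subLaplacian, hA, hB, hEL, hEL, lieCoord_lieA, lieCoord_lieB]
    constructor <;> simp

/-- The multiplier `λ = (du, dv, β)`. -/
def multiplier (f : M → Heis n) (β : Form1 m M) : DualForm1 m M 𝓘(ℝ, Heis n) (Heis n) where
  toFun B x := ∑ j, ((lieCoord B).a j • mvfderiv (𝓡 m) (fA f j) x +
    (lieCoord B).b j • mvfderiv (𝓡 m) (fB f j) x) + (lieCoord B).c • β x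
  map_add' B B' := by
    funext x
    simp only [map_add, a_add, b_add, c_add, PiLp.add_apply, add_smul, Pi.add_apply,
      Finset.sum_add_distrib]
    abel
  map_smul' r B := by
    funext x
    simp only [map_smul, a_smul, b_smul, c_smul, PiLp.smul_apply, smul_eq_mul, mul_smul,
      Pi.smul_apply, Finset.smul_sum, smul_add, RingHom.id_apply]

theorem multiplier_apply (β : Form1 m M) (B : GroupLieAlgebra 𝓘(ℝ, Heis n) (Heis n)) (x : M) :
    multiplier f β B x = ∑ j, ((lieCoord B).a j • mvfderiv (𝓡 m) (fA f j) x +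
      (lieCoord B).b j • mvfderiv (𝓡 m) (fB f j) x) + (lieCoord B).c • β x := rfl

theorem multiplier_lieC (β : Form1 m M) (x : M) : multiplier f β lieC x = β x := by
  rw [multiplier_apply, lieCoord_lieC]
  simp

/-- A horizontal divergence-free field as in the equation for `ζ` gives a normal multiplier. -/
theorem exists_multiplier (hnabla : IsCompatible S vol nabla)
    (hf : IsHorizontalMap S (standard n) f) {Y : VField m M} (hY : SmoothField Y)
    (hD : S.IsHorizontalField Y) (hdiv : ∀ x, vol.div Y x = 0)
    (hA : ∀ j x, subLaplacian S vol (fA f j) x = - mvfderiv (𝓡 m) (fB f j) x (Y x))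
    (hB : ∀ j x, subLaplacian S vol (fB f j) x = mvfderiv (𝓡 m) (fA f j) x (Y x)) :
    ∃ lam : DualForm1 m M 𝓘(ℝ, Heis n) (Heis n), (∀ B, SmoothForm1 (lam B)) ∧
      (∀ x, ∀ v ∈ S.D x, (standard n).IsSharp (fun B => lam B x v)
        (darboux m 𝓘(ℝ, Heis n) f x v)) ∧
      ∀ x B, deltaD S nabla lam x B - S.trace x (fun v w =>
        coad (darboux m 𝓘(ℝ, Heis n) f x v) (fun B' => lam B' x w) B) = 0 := by
  obtain ⟨β, hβ, hβY⟩ := S.exists_form_sharp_eq hY hD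
  have hsA : ∀ j x, SmoothForm1At (fun x => mvfderiv (𝓡 m) (fA f j) x) x := fun j x =>
    smoothForm1At_mvfderiv (contMDiff_fA hf.1 j x)
  have hsB : ∀ j x, SmoothForm1At (fun x => mvfderiv (𝓡 m) (fB f j) x) x := fun j x =>
    smoothForm1At_mvfderiv (contMDiff_fB hf.1 j x)
  have hlam : ∀ B, SmoothForm1 (multiplier f β B) := fun B x =>
    SmoothForm1At.add (SmoothForm1At.sum fun j _ => SmoothForm1At.add
      (SmoothForm1At.smul contMDiffAt_const (hsA j x))
      (SmoothForm1At.smul contMDiffAt_const (hsB j x)))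
      (SmoothForm1At.smul contMDiffAt_const (hβ x))
  refine ⟨multiplier f β, hlam, fun x v hv => ⟨hf.2 x v hv, fun w => ?_⟩, fun x B => ?_⟩
  -- Elements of 𝔢 have no `c`-component, so the free part β of the multiplier drops out.
  · have hw : (lieCoord (w : GroupLieAlgebra 𝓘(ℝ, Heis n) (Heis n))).c = 0 := mem_standard_e.1 w.2
    rw [standard_inner]
    beta_reduce
    rw [multiplier_apply, hw, zero_smul, add_zero]
    simp only [PiLp.inner_apply, RCLike.inner_apply, conj_trivial, lieCoord_darboux_a hf.1,
      lieCoord_darboux_b hf.1, sum_apply, add_apply, smul_apply, smul_eq_mul,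
      Finset.sum_add_distrib]
  · rw [euler_lagrange_iff hnabla hf.1 hlam, multiplier_lieC, hβY]
    have h1 : (fun y => S.sharp y (multiplier f β B y)) = fun y =>
        ∑ j, ((lieCoord B).a j • S.sharp y (mvfderiv (𝓡 m) (fA f j) y) +
          (lieCoord B).b j • S.sharp y (mvfderiv (𝓡 m) (fB f j) y)) + (lieCoord B).c • Y y := by
      funext y
      rw [← hβY y]
      simp only [multiplier_apply, SubRiemannianStructure.sharp, sum_apply, add_apply, smul_apply,
        smul_eq_mul, add_smul, Finset.sum_smul, Finset.smul_sum, mul_smul, Finset.sum_add_distrib]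
      rw [Finset.sum_comm]
      congr 2
      rw [Finset.sum_comm]
    have hSA := fun j => (hsA j x).sharp S
    have hSB := fun j => (hsB j x).sharp S
    have hSA' := fun j => SmoothFieldAt.smul (contMDiffAt_const (c := (lieCoord B).a j)) (hSA j)
    have hSB' := fun j => SmoothFieldAt.smul (contMDiffAt_const (c := (lieCoord B).b j)) (hSB j)
    rw [h1, vol.div_add (SmoothFieldAt.sum fun j _ => (hSA' j).add (hSB' j))
      (SmoothFieldAt.smul contMDiffAt_const (hY x)), vol.div_const_smul _ (hY x), hdiv, mul_zero,
      add_zero, vol.div_sum _ fun j _ => (hSA' j).add (hSB' j)]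
    refine Finset.sum_congr rfl fun j _ => ?_
    rw [vol.div_add (hSA' j) (hSB' j), vol.div_const_smul _ (hSA j), vol.div_const_smul _ (hSB j)]
    have h2 := hA j x
    have h3 := hB j x
    rw [subLaplacian] at h2 h3
    rw [h2, h3]
    ring

end Maps

end Heis
end
end SubRiem

namespace SubRiem
noncomputable section

/-! ### The antisymmetric form ∫ φ (Yψ) dμ and Green's formula. -/

section Advection

set_option linter.unusedSectionVars false

open MeasureTheory

variable {m : ℕ} {M : Type*} [TopologicalSpace M] [ChartedSpace (EuclideanSpace ℝ (Fin m)) M]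
  [IsManifold (𝓡 m) ∞ M] [T2Space M] [CompactSpace M] [MeasurableSpace M] [BorelSpace M]
  (vol : VolumeDensity m M)

theorem memLp_two_of_contMDiff {φ : M → ℝ} (hφ : ContMDiff (𝓡 m) 𝓘(ℝ, ℝ) ∞ φ) :
    MemLp φ 2 vol.μ :=
  hφ.continuous.memLp_of_hasCompactSupport (HasCompactSupport.of_compactSpace _)

/-- The integral `∫ φ (Y ψ) dμ`. -/
def advection (Y : VField m M) (φ ψ : M → ℝ) : ℝ :=
  ∫ p, φ p * mvfderiv (𝓡 m) ψ p (Y p) ∂vol.μ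

theorem mvfderiv_sub_apply {φ ψ : M → ℝ} (hφ : ContMDiff (𝓡 m) 𝓘(ℝ, ℝ) ∞ φ)
    (hψ : ContMDiff (𝓡 m) 𝓘(ℝ, ℝ) ∞ ψ) (p : M) (v : TangentSpace (𝓡 m) p) :
    mvfderiv (𝓡 m) (fun q => φ q - ψ q) p v = mvfderiv (𝓡 m) φ p v - mvfderiv (𝓡 m) ψ p v :=
  DFunLike.congr_fun (mvfderiv_sub ((hφ p).mdifferentiableAt (by simp))
    ((hψ p).mdifferentiableAt (by simp))) v

variable {vol} {Y : VField m M}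

theorem integrable_advection (hY : SmoothField Y) {φ ψ : M → ℝ}
    (hφ : ContMDiff (𝓡 m) 𝓘(ℝ, ℝ) ∞ φ) (hψ : ContMDiff (𝓡 m) 𝓘(ℝ, ℝ) ∞ ψ) :
    Integrable (fun p => φ p * mvfderiv (𝓡 m) ψ p (Y p)) vol.μ :=
  integrable_of_contMDiff vol (hφ.mul (contMDiff_mvfderiv_apply hψ hY))

theorem advection_sub_left (hY : SmoothField Y) {φ φ' ψ : M → ℝ}
    (hφ : ContMDiff (𝓡 m) 𝓘(ℝ, ℝ) ∞ φ) (hφ' : ContMDiff (𝓡 m) 𝓘(ℝ, ℝ) ∞ φ')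
    (hψ : ContMDiff (𝓡 m) 𝓘(ℝ, ℝ) ∞ ψ) :
    advection vol Y (fun p => φ p - φ' p) ψ = advection vol Y φ ψ - advection vol Y φ' ψ := by
  unfold advection
  rw [← integral_sub (integrable_advection hY hφ hψ) (integrable_advection hY hφ' hψ)]
  exact integral_congr_ae (.of_forall fun p => by ring)

theorem advection_sub_right (hY : SmoothField Y) {φ ψ ψ' : M → ℝ}
    (hφ : ContMDiff (𝓡 m) 𝓘(ℝ, ℝ) ∞ φ) (hψ : ContMDiff (𝓡 m) 𝓘(ℝ, ℝ) ∞ ψ)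
    (hψ' : ContMDiff (𝓡 m) 𝓘(ℝ, ℝ) ∞ ψ') :
    advection vol Y φ (fun p => ψ p - ψ' p) = advection vol Y φ ψ - advection vol Y φ ψ' := by
  unfold advection
  rw [← integral_sub (integrable_advection hY hφ hψ) (integrable_advection hY hφ hψ')]
  refine integral_congr_ae (.of_forall fun p => ?_)
  beta_reduce
  rw [mvfderiv_sub_apply hψ hψ']
  ring

theorem integral_mvfderiv_eq_zero (hY : SmoothField Y) (hdiv : ∀ x, vol.div Y x = 0) {φ : M → ℝ}
    (hφ : ContMDiff (𝓡 m) 𝓘(ℝ, ℝ) ∞ φ) : ∫ p, mvfderiv (𝓡 m) φ p (Y p) ∂vol.μ = 0 := by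
  have h := integral_mul_div vol hY hφ
  simp only [hdiv, mul_zero, integral_zero] at h
  linarith

/-- The integral of Y(φψ) vanishes because Y is divergence free. -/
theorem advection_comm (hY : SmoothField Y) (hdiv : ∀ x, vol.div Y x = 0) {φ ψ : M → ℝ}
    (hφ : ContMDiff (𝓡 m) 𝓘(ℝ, ℝ) ∞ φ) (hψ : ContMDiff (𝓡 m) 𝓘(ℝ, ℝ) ∞ ψ) :
    advection vol Y φ ψ = - advection vol Y ψ φ := by
  have h := integral_mvfderiv_eq_zero hY hdiv (hφ.mul hψ)
  rw [eq_neg_iff_add_eq_zero, ← h]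
  unfold advection
  rw [← integral_add (integrable_advection hY hφ hψ) (integrable_advection hY hψ hφ)]
  refine integral_congr_ae (.of_forall fun p => ?_)
  have h1 := DFunLike.congr_fun (mvfderiv_mul ((hφ p).mdifferentiableAt (n := ∞) (by simp))
    ((hψ p).mdifferentiableAt (n := ∞) (by simp))) (Y p)
  exact h1.symm

/-- Since ∫ Yψ = 0, a constant may be subtracted from φ; then |ab| ≤ a² + b². The constant will be
the one from the Poincaré inequality. -/
theorem abs_advection_le (hY : SmoothField Y) (hdiv : ∀ x, vol.div Y x = 0) {φ ψ : M → ℝ}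
    (hφ : ContMDiff (𝓡 m) 𝓘(ℝ, ℝ) ∞ φ) (hψ : ContMDiff (𝓡 m) 𝓘(ℝ, ℝ) ∞ ψ) (c : ℝ) :
    |advection vol Y φ ψ| ≤ ∫ p, (φ p - c) ^ 2 ∂vol.μ +
      ∫ p, mvfderiv (𝓡 m) ψ p (Y p) ^ 2 ∂vol.μ := by
  have hc : ContMDiff (𝓡 m) 𝓘(ℝ, ℝ) ∞ (fun p => φ p - c) := hφ.sub contMDiff_const
  have h1 : advection vol Y φ ψ = advection vol Y (fun p => φ p - c) ψ := by
    rw [advection_sub_left hY hφ contMDiff_const hψ]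
    have : advection vol Y (fun _ => c) ψ = 0 := by
      unfold advection
      rw [integral_const_mul, integral_mvfderiv_eq_zero hY hdiv hψ, mul_zero]
    rw [this, sub_zero]
  have hi1 : Integrable (fun p => (φ p - c) ^ 2) vol.μ := integrable_of_contMDiff vol (hc.pow 2)
  have hi2 : Integrable (fun p => mvfderiv (𝓡 m) ψ p (Y p) ^ 2) vol.μ :=
    integrable_of_contMDiff vol ((contMDiff_mvfderiv_apply hψ hY).pow 2)
  rw [h1, ← integral_add hi1 hi2]
  refine (abs_integral_le_integral_abs).trans
    (integral_mono (integrable_advection hY hc hψ).abs (hi1.add hi2) fun p => ?_)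
  beta_reduce
  rw [abs_le]
  constructor <;> nlinarith [sq_nonneg ((φ p - c) + mvfderiv (𝓡 m) ψ p (Y p)),
    sq_nonneg ((φ p - c) - mvfderiv (𝓡 m) ψ p (Y p)), sq_nonneg (φ p - c),
    sq_nonneg (mvfderiv (𝓡 m) ψ p (Y p))]

/-- The Poincaré inequality bounds `∫ φ (Y ψ)` by Dirichlet energies. -/
theorem exists_abs_advection_le [ConnectedSpace M] (hY : SmoothField Y)
    (hdiv : ∀ x, vol.div Y x = 0) :
    ∃ (ι : Type) (_ : Fintype ι) (W : ι → VField m M) (C : ℝ), (∀ k, SmoothField (W k)) ∧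
      ∀ φ ψ : M → ℝ, ContMDiff (𝓡 m) 𝓘(ℝ, ℝ) ∞ φ → ContMDiff (𝓡 m) 𝓘(ℝ, ℝ) ∞ ψ →
        |advection vol Y φ ψ| ≤ C * (∑ k, ∫ p, mvfderiv (𝓡 m) φ p (W k p) ^ 2 ∂vol.μ +
          ∑ k, ∫ p, mvfderiv (𝓡 m) ψ p (W k p) ^ 2 ∂vol.μ) := by
  obtain ⟨ι, hι, X, C, hX, hC, h⟩ := exists_poincare vol
  -- `Y` joins the Poincaré fields, and the extra 1 in the constant pays for the term ∫ (Yψ)².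
  refine ⟨Option ι, inferInstance, fun o => o.elim Y X, C + 1, ?_, fun φ ψ hφ hψ => ?_⟩
  · rintro (_ | k)
    exacts [hY, hX k]
  · obtain ⟨c, hc⟩ := h φ hφ
    refine (abs_advection_le hY hdiv hφ hψ c).trans ?_
    simp only [Fintype.sum_option, Option.elim_none, Option.elim_some]
    have hnn : ∀ (φ : M → ℝ) (X : VField m M),
        0 ≤ ∫ p, mvfderiv (𝓡 m) φ p (X p) ^ 2 ∂vol.μ := fun φ X =>
      integral_nonneg fun p => sq_nonneg _
    have hs : ∀ φ : M → ℝ, 0 ≤ ∑ k, ∫ p, mvfderiv (𝓡 m) φ p (X k p) ^ 2 ∂vol.μ := fun φ =>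
      Finset.sum_nonneg fun k _ => hnn φ (X k)
    have := hnn φ Y
    have := hnn ψ Y
    nlinarith [hs φ, hs ψ, mul_nonneg hC (hs ψ), mul_nonneg hC (hnn φ Y), mul_nonneg hC (hnn ψ Y)]

/-- Green's formula, with the horizontal inner product computed in a Parseval frame. -/
theorem sum_integral_mvfderiv_mul (S : SubRiemannianStructure m M) {N : ℕ}
    {Z : Fin N → VField m M} (hZ : ∀ k, SmoothField (Z k))
    (hP : ∀ x (β : TangentSpace (𝓡 m) x →L[ℝ] ℝ), S.sharp x β = ∑ k, β (Z k x) • Z k x)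
    {φ ψ : M → ℝ} (hφ : ContMDiff (𝓡 m) 𝓘(ℝ, ℝ) ∞ φ) (hψ : ContMDiff (𝓡 m) 𝓘(ℝ, ℝ) ∞ ψ) :
    ∑ k, ∫ p, mvfderiv (𝓡 m) ψ p (Z k p) * mvfderiv (𝓡 m) φ p (Z k p) ∂vol.μ =
      - ∫ p, φ p * subLaplacian S vol ψ p ∂vol.μ := by
  have h := integral_mul_div vol (X := fun y => S.sharp y (mvfderiv (𝓡 m) ψ y))
    (fun x => SmoothForm1At.sharp S (smoothForm1At_mvfderiv (hψ x))) hφ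
  simp only [subLaplacian]
  have hi : ∀ k, Integrable
      (fun p => mvfderiv (𝓡 m) ψ p (Z k p) * mvfderiv (𝓡 m) φ p (Z k p)) vol.μ := fun k =>
    integrable_of_contMDiff vol
      ((contMDiff_mvfderiv_apply hψ (hZ k)).mul (contMDiff_mvfderiv_apply hφ (hZ k)))
  rw [h, neg_neg, ← integral_finsetSum _ fun k _ => hi k]
  refine integral_congr_ae (.of_forall fun p => ?_)
  simp only [hP, map_sum, map_smul, smul_eq_mul]

end Advection

namespace Heis

/-! ### The first variation between horizontal maps. -/

section FirstVariation

set_option linter.unusedSectionVars false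

open MeasureTheory

variable {n m : ℕ} {M : Type*} [TopologicalSpace M] [ChartedSpace (EuclideanSpace ℝ (Fin m)) M]
  [IsManifold (𝓡 m) ∞ M] [T2Space M] [CompactSpace M] [MeasurableSpace M] [BorelSpace M]
  {S : SubRiemannianStructure m M} {vol : VolumeDensity m M} {Y : VField m M}

/-- Horizontality gives Yw = ½ Σ (u_j Yv_j - v_j Yu_j). The integral of Yw vanishes, and by
antisymmetry the right side integrates to the sum in question. -/
theorem sum_advection_eq_zero (hY : SmoothField Y) (hD : S.IsHorizontalField Y)
    (hdiv : ∀ x, vol.div Y x = 0) {g : M → Heis n} (hg : IsHorizontalMap S (standard n) g) :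
    ∑ j, advection vol Y (fA g j) (fB g j) = 0 := by
  have hA := contMDiff_fA hg.1
  have hB := contMDiff_fB hg.1
  have h1 : ∀ p, mvfderiv (𝓡 m) (fC g) p (Y p) =
      (1 / 2) * ∑ j, (fA g j p * mvfderiv (𝓡 m) (fB g j) p (Y p) -
        fB g j p * mvfderiv (𝓡 m) (fA g j) p (Y p)) := fun p => by
    have h : (lieCoord (darboux m 𝓘(ℝ, Heis n) g p (Y p))).c = 0 := hg.2 p _ (hD p)
    rw [lieCoord_darboux_c hg.1] at h
    linarith
  have h2 := integral_mvfderiv_eq_zero hY hdiv (contMDiff_fC hg.1)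
  simp only [h1] at h2
  have hi : ∀ j, Integrable (fun p => fA g j p * mvfderiv (𝓡 m) (fB g j) p (Y p) -
      fB g j p * mvfderiv (𝓡 m) (fA g j) p (Y p)) vol.μ := fun j =>
    (integrable_advection hY (hA j) (hB j)).sub (integrable_advection hY (hB j) (hA j))
  rw [integral_const_mul, integral_finsetSum _ fun j _ => hi j] at h2
  have h3 : ∀ j, ∫ p, (fA g j p * mvfderiv (𝓡 m) (fB g j) p (Y p) -
      fB g j p * mvfderiv (𝓡 m) (fA g j) p (Y p)) ∂vol.μ =
      2 * advection vol Y (fA g j) (fB g j) := fun j => by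
    rw [integral_sub (integrable_advection hY (hA j) (hB j))
      (integrable_advection hY (hB j) (hA j))]
    change advection vol Y _ _ - advection vol Y _ _ = _
    rw [advection_comm hY hdiv (hB j) (hA j)]
    ring
  simp only [h3, ← Finset.mul_sum] at h2
  linarith

/-- For horizontal maps `f` solving the equation for `ζ`, the first variation of the energy in the
direction of another horizontal map is quadratic. -/
theorem first_variation_eq (hY : SmoothField Y) (hD : S.IsHorizontalField Y)
    (hdiv : ∀ x, vol.div Y x = 0) {N : ℕ} {Z : Fin N → VField m M} (hZ : ∀ k, SmoothField (Z k))
    (hP : ∀ x (β : TangentSpace (𝓡 m) x →L[ℝ] ℝ), S.sharp x β = ∑ k, β (Z k x) • Z k x)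
    {f g : M → Heis n} (hf : IsHorizontalMap S (standard n) f)
    (hg : IsHorizontalMap S (standard n) g)
    (hA : ∀ j x, subLaplacian S vol (fA f j) x = - mvfderiv (𝓡 m) (fB f j) x (Y x))
    (hB : ∀ j x, subLaplacian S vol (fB f j) x = mvfderiv (𝓡 m) (fA f j) x (Y x)) :
    ∑ j, (∑ k, ∫ p, mvfderiv (𝓡 m) (fA f j) p (Z k p) *
        mvfderiv (𝓡 m) (fun q => fA g j q - fA f j q) p (Z k p) ∂vol.μ +
      ∑ k, ∫ p, mvfderiv (𝓡 m) (fB f j) p (Z k p) *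
        mvfderiv (𝓡 m) (fun q => fB g j q - fB f j q) p (Z k p) ∂vol.μ) =
      - ∑ j, advection vol Y (fun q => fA g j q - fA f j q) (fun q => fB g j q - fB f j q) := by
  have hAf := contMDiff_fA hf.1
  have hBf := contMDiff_fB hf.1
  have hAg := contMDiff_fA hg.1
  have hBg := contMDiff_fB hg.1
  have hAd : ∀ j, ContMDiff (𝓡 m) 𝓘(ℝ, ℝ) ∞ (fun q => fA g j q - fA f j q) := fun j =>
    (hAg j).sub (hAf j)
  have hBd : ∀ j, ContMDiff (𝓡 m) 𝓘(ℝ, ℝ) ∞ (fun q => fB g j q - fB f j q) := fun j =>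
    (hBg j).sub (hBf j)
  -- Green's formula and the equation give A(u_g - u_f, v_f) - A(v_g - v_f, u_f); antisymmetry and
  -- bilinearity rewrite this as below. The first two terms vanish after summation over `j`, by
  -- horizontality of `g` and `f`.
  have hj : ∀ j, (∑ k, ∫ p, mvfderiv (𝓡 m) (fA f j) p (Z k p) *
        mvfderiv (𝓡 m) (fun q => fA g j q - fA f j q) p (Z k p) ∂vol.μ +
      ∑ k, ∫ p, mvfderiv (𝓡 m) (fB f j) p (Z k p) *
        mvfderiv (𝓡 m) (fun q => fB g j q - fB f j q) p (Z k p) ∂vol.μ) =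
      advection vol Y (fA g j) (fB g j) - advection vol Y (fA f j) (fB f j) -
        advection vol Y (fun q => fA g j q - fA f j q) (fun q => fB g j q - fB f j q) := by
    intro j
    rw [sum_integral_mvfderiv_mul S hZ hP (hAd j) (hAf j),
      sum_integral_mvfderiv_mul S hZ hP (hBd j) (hBf j)]
    simp only [hA, hB, mul_neg, integral_neg, neg_neg]
    change advection vol Y (fun q => fA g j q - fA f j q) (fB f j) +
      -advection vol Y (fun q => fB g j q - fB f j q) (fA f j) = _
    rw [← advection_comm hY hdiv (hAf j) (hBd j), advection_sub_left hY (hAg j) (hAf j) (hBd j),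
      advection_sub_left hY (hAg j) (hAf j) (hBf j), advection_sub_right hY (hAg j) (hBg j) (hBf j),
      advection_sub_right hY (hAf j) (hBg j) (hBf j)]
    ring
  rw [Finset.sum_congr rfl fun j _ => hj j, Finset.sum_sub_distrib, Finset.sum_sub_distrib,
    sum_advection_eq_zero hY hD hdiv hg, sum_advection_eq_zero hY hD hdiv hf]
  ring

end FirstVariation

end Heis
end
end SubRiem

namespace SubRiem
noncomputable section

/-! ### Continuity of integrals of products in L². -/

section SquareIntegrable

open MeasureTheory

variable {Ω : Type*} [MeasurableSpace Ω] {μ : Measure Ω}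

theorem inner_toLp_eq_integral {F G : Ω → ℝ} (hF : MemLp F 2 μ) (hG : MemLp G 2 μ) :
    inner ℝ (hF.toLp F) (hG.toLp G) = ∫ x, F x * G x ∂μ := by
  rw [L2.inner_def]
  refine integral_congr_ae ?_
  filter_upwards [hF.coeFn_toLp, hG.coeFn_toLp] with x h1 h2
  rw [h1, h2, real_inner_eq_re_inner, RCLike.inner_apply]
  simp [mul_comm]

theorem tendsto_toLp {ι : Type*} {l : Filter ι} {F : ι → Ω → ℝ} {F₀ : Ω → ℝ}
    (hF : ∀ k, MemLp (F k) 2 μ) (hF₀ : MemLp F₀ 2 μ)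
    (h : Filter.Tendsto (fun k => eLpNorm (fun x => F k x - F₀ x) 2 μ) l (𝓝 0)) :
    Filter.Tendsto (fun k => (hF k).toLp (F k)) l (𝓝 (hF₀.toLp F₀)) :=
  (Lp.tendsto_Lp_iff_tendsto_eLpNorm'' F hF F₀ hF₀).2 h

/-- Joint continuity of the L² inner product, which carries estimates from horizontal maps to the
closure. -/
theorem tendsto_integral_mul {ι : Type*} {l : Filter ι} {F G : ι → Ω → ℝ} {F₀ G₀ : Ω → ℝ}
    (hF : ∀ k, MemLp (F k) 2 μ) (hF₀ : MemLp F₀ 2 μ) (hG : ∀ k, MemLp (G k) 2 μ)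
    (hG₀ : MemLp G₀ 2 μ)
    (h : Filter.Tendsto (fun k => eLpNorm (fun x => F k x - F₀ x) 2 μ) l (𝓝 0))
    (h' : Filter.Tendsto (fun k => eLpNorm (fun x => G k x - G₀ x) 2 μ) l (𝓝 0)) :
    Filter.Tendsto (fun k => ∫ x, F k x * G k x ∂μ) l (𝓝 (∫ x, F₀ x * G₀ x ∂μ)) := by
  have h1 := (tendsto_toLp hF hF₀ h).inner (𝕜 := ℝ) (tendsto_toLp hG hG₀ h')
  simpa only [inner_toLp_eq_integral] using h1

theorem integral_sq_le_of_eLpNorm_le {F : Ω → ℝ} (hF : MemLp F 2 μ) {r : ENNReal} (hr : r ≠ ⊤)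
    (h : eLpNorm F 2 μ ≤ r) : ∫ x, F x ^ 2 ∂μ ≤ r.toReal ^ 2 := by
  have h1 := inner_toLp_eq_integral hF hF
  rw [real_inner_self_eq_norm_sq, Lp.norm_toLp] at h1
  simp only [pow_two (F _)]
  rw [← h1]
  exact pow_le_pow_left₀ ENNReal.toReal_nonneg (ENNReal.toReal_mono hr h) 2

end SquareIntegrable

namespace Heis

variable {n : ℕ}

/-- The coordinates `a_j`, `b_j` on the Lie algebra. -/
def horizCoord : Fin n ⊕ Fin n → (GroupLieAlgebra 𝓘(ℝ, Heis n) (Heis n) →L[ℝ] ℝ) :=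
  Sum.elim (fun j => (coordA j).comp (lieCoord (n := n)).toContinuousLinearMap)
    (fun j => (coordB j).comp (lieCoord (n := n)).toContinuousLinearMap)

/-- The coordinate `c` on the Lie algebra. -/
def vertCoord : GroupLieAlgebra 𝓘(ℝ, Heis n) (Heis n) →L[ℝ] ℝ :=
  coordC.comp (lieCoord (n := n)).toContinuousLinearMap

theorem normSq_eq_sum_horizCoord {A : GroupLieAlgebra 𝓘(ℝ, Heis n) (Heis n)}
    (hA : vertCoord A = 0) : (standard n).normSq A = ∑ l, horizCoord l A ^ 2 := by
  rw [normSq_standard hA, Fintype.sum_sum_type, Finset.sum_add_distrib]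
  rfl

/-! ### Energy on the closure, and harmonicity. -/

section Harmonic

set_option linter.unusedSectionVars false

open MeasureTheory

variable {m : ℕ} {M : Type*} [TopologicalSpace M] [ChartedSpace (EuclideanSpace ℝ (Fin m)) M]
  [IsManifold (𝓡 m) ∞ M]

theorem horizCoord_inl_darboux {f : M → Heis n} (hf : ContMDiff (𝓡 m) 𝓘(ℝ, Heis n) ∞ f) (j : Fin n)
    (x : M) (v : TangentSpace (𝓡 m) x) :
    horizCoord (.inl j) (darboux m 𝓘(ℝ, Heis n) f x v) = mvfderiv (𝓡 m) (fA f j) x v :=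
  lieCoord_darboux_a hf x v j

theorem horizCoord_inr_darboux {f : M → Heis n} (hf : ContMDiff (𝓡 m) 𝓘(ℝ, Heis n) ∞ f) (j : Fin n)
    (x : M) (v : TangentSpace (𝓡 m) x) :
    horizCoord (.inr j) (darboux m 𝓘(ℝ, Heis n) f x v) = mvfderiv (𝓡 m) (fB f j) x v :=
  lieCoord_darboux_b hf x v j

variable [T2Space M] [CompactSpace M] [MeasurableSpace M] [BorelSpace M]
  {S : SubRiemannianStructure m M} {vol : VolumeDensity m M}

theorem memLp_horizCoord_darboux {f : M → Heis n} (hf : ContMDiff (𝓡 m) 𝓘(ℝ, Heis n) ∞ f)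
    {X : VField m M} (hX : SmoothField X) (l : Fin n ⊕ Fin n) :
    MemLp (fun x => horizCoord l (darboux m 𝓘(ℝ, Heis n) f x (X x))) 2 vol.μ := by
  rcases l with j | j
  · simp only [horizCoord_inl_darboux hf]
    exact memLp_two_of_contMDiff vol (contMDiff_mvfderiv_apply (contMDiff_fA hf j) hX)
  · simp only [horizCoord_inr_darboux hf]
    exact memLp_two_of_contMDiff vol (contMDiff_mvfderiv_apply (contMDiff_fB hf j) hX)

/-- Both sides equal γ(♯γ). -/
theorem sum_apply_onb_sq {N : ℕ} {Z : Fin N → VField m M}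
    (hP : ∀ x (β : TangentSpace (𝓡 m) x →L[ℝ] ℝ), S.sharp x β = ∑ k, β (Z k x) • Z k x)
    (x : M) (γ : TangentSpace (𝓡 m) x →L[ℝ] ℝ) :
    ∑ i, γ (S.onb x i) ^ 2 = ∑ k, γ (Z k x) ^ 2 := by
  have h := S.apply_sharp x γ γ
  rw [hP, map_sum] at h
  simp only [map_smul, smul_eq_mul, ← pow_two] at h
  exact h.symm

theorem sum_normSq_onb {N : ℕ} {Z : Fin N → VField m M}
    (hP : ∀ x (β : TangentSpace (𝓡 m) x →L[ℝ] ℝ), S.sharp x β = ∑ k, β (Z k x) • Z k x)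
    {x : M} {A : TangentSpace (𝓡 m) x →L[ℝ] GroupLieAlgebra 𝓘(ℝ, Heis n) (Heis n)}
    (hA : ∀ k, vertCoord (A (Z k x)) = 0) :
    ∑ i, (standard n).normSq (A (S.onb x i)) = ∑ l, ∑ k, horizCoord l (A (Z k x)) ^ 2 := by
  -- The vertical component is transferred from the frame to `onb` as a sum of squares; its
  -- vanishing keeps `normSq` away from its default value outside 𝔢.
  have h1 : ∑ i, vertCoord (A (S.onb x i)) ^ 2 = 0 := by
    refine (sum_apply_onb_sq hP x (vertCoord.comp A)).trans ?_
    refine Finset.sum_eq_zero fun k _ => ?_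
    rw [ContinuousLinearMap.comp_apply, hA]
    exact zero_pow two_ne_zero
  have h2 : ∀ i, vertCoord (A (S.onb x i)) = 0 := fun i => by
    rw [Finset.sum_eq_zero_iff_of_nonneg fun _ _ => sq_nonneg _] at h1
    exact pow_eq_zero_iff two_ne_zero |>.1 (h1 i (Finset.mem_univ i))
  rw [Finset.sum_congr rfl fun i _ => normSq_eq_sum_horizCoord (h2 i), Finset.sum_comm]
  exact Finset.sum_congr rfl fun l _ => sum_apply_onb_sq hP x ((horizCoord l).comp A)

/-- The energy in terms of a Parseval frame. -/
theorem energy_eq_sum_integral {N : ℕ} {Z : Fin N → VField m M}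
    (hP : ∀ x (β : TangentSpace (𝓡 m) x →L[ℝ] ℝ), S.sharp x β = ∑ k, β (Z k x) • Z k x)
    {β : LieForm1 m M 𝓘(ℝ, Heis n) (Heis n)}
    (hL : ∀ k l, MemLp (fun x => horizCoord l (β x (Z k x))) 2 vol.μ)
    (hv : ∀ k, ∀ᵐ x ∂vol.μ, vertCoord (β x (Z k x)) = 0) :
    energy S vol (standard n) β =
      (1 / 2) * ∑ l, ∑ k, ∫ x, horizCoord l (β x (Z k x)) ^ 2 ∂vol.μ := by
  have hi : ∀ l k, Integrable (fun x => horizCoord l (β x (Z k x)) ^ 2) vol.μ := fun l k =>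
    (hL k l).integrable_sq
  have hi' : ∀ l, Integrable (fun x => ∑ k, horizCoord l (β x (Z k x)) ^ 2) vol.μ := fun l =>
    integrable_finsetSum _ fun k _ => hi l k
  unfold energy
  congr 1
  rw [Finset.sum_congr rfl fun l _ => (integral_finsetSum _ fun k _ => hi l k).symm,
    ← integral_finsetSum _ fun l _ => hi' l]
  refine integral_congr_ae ?_
  filter_upwards [Filter.eventually_all.2 hv] with x hx using sum_normSq_onb hP hx

/-- Taking values in 𝔢 on `D` is a closed condition in L². Hence the energy is a genuine quadratic
expression on the closure. -/
theorem InHorizontalClosure.ae_vertCoord_eq_zero {β : LieForm1 m M 𝓘(ℝ, Heis n) (Heis n)}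
    (hβ : InHorizontalClosure S vol (standard n) β) {X : VField m M} (hX : SmoothField X)
    (hD : S.IsHorizontalField X) : ∀ᵐ x ∂vol.μ, vertCoord (β x (X x)) = 0 := by
  obtain ⟨hL, g, hg, hlim⟩ := hβ
  have h := hlim X hX vertCoord
  have h0 : ∀ k x, vertCoord (darboux m 𝓘(ℝ, Heis n) (g k) x (X x)) = 0 := fun k x =>
    (hg k).2 x _ (hD x)
  simp only [h0, zero_sub] at h
  have h1 := tendsto_nhds_unique h tendsto_const_nhds
  have h2 : eLpNorm (fun x => - vertCoord (β x (X x))) 2 vol.μ = 0 := h1.symm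
  have hm : AEStronglyMeasurable (fun x => - vertCoord (β x (X x))) vol.μ :=
    (hL X hX vertCoord).aestronglyMeasurable.neg
  rw [eLpNorm_eq_zero_iff hm (by simp)] at h2
  filter_upwards [h2] with x hx
  exact neg_eq_zero.1 hx

variable {Y : VField m M}

/-- Quadratic bound for the first variation in the direction of horizontal maps. -/
theorem exists_first_variation_bound [ConnectedSpace M] (hY : SmoothField Y)
    (hD : S.IsHorizontalField Y) (hdiv : ∀ x, vol.div Y x = 0) {N : ℕ} {Z : Fin N → VField m M}
    (hZ : ∀ k, SmoothField (Z k))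
    (hP : ∀ x (β : TangentSpace (𝓡 m) x →L[ℝ] ℝ), S.sharp x β = ∑ k, β (Z k x) • Z k x)
    {f : M → Heis n} (hf : IsHorizontalMap S (standard n) f)
    (hA : ∀ j x, subLaplacian S vol (fA f j) x = - mvfderiv (𝓡 m) (fB f j) x (Y x))
    (hB : ∀ j x, subLaplacian S vol (fB f j) x = mvfderiv (𝓡 m) (fA f j) x (Y x)) :
    ∃ (ι : Type) (_ : Fintype ι) (W : ι → VField m M) (C : ℝ), (∀ k, SmoothField (W k)) ∧
      ∀ g : M → Heis n, IsHorizontalMap S (standard n) g →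
        |∑ l, ∑ k, ∫ x, horizCoord l (darboux m 𝓘(ℝ, Heis n) f x (Z k x)) *
          (horizCoord l (darboux m 𝓘(ℝ, Heis n) g x (Z k x)) -
            horizCoord l (darboux m 𝓘(ℝ, Heis n) f x (Z k x))) ∂vol.μ| ≤
        C * ∑ l, ∑ k, ∫ x, (horizCoord l (darboux m 𝓘(ℝ, Heis n) g x (W k x)) -
            horizCoord l (darboux m 𝓘(ℝ, Heis n) f x (W k x))) ^ 2 ∂vol.μ := by
  obtain ⟨ι, hι, W, C, hW, h⟩ := exists_abs_advection_le hY hdiv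
  refine ⟨ι, hι, W, C, hW, fun g hg => ?_⟩
  have hAf := contMDiff_fA hf.1
  have hBf := contMDiff_fB hf.1
  have hAg := contMDiff_fA hg.1
  have hBg := contMDiff_fB hg.1
  have hvar := first_variation_eq hY hD hdiv hZ hP hf hg hA hB
  simp only [Fintype.sum_sum_type, horizCoord_inl_darboux hf.1, horizCoord_inr_darboux hf.1,
    horizCoord_inl_darboux hg.1, horizCoord_inr_darboux hg.1,
    ← mvfderiv_sub_apply (hAg _) (hAf _), ← mvfderiv_sub_apply (hBg _) (hBf _),
    ← Finset.sum_add_distrib] at hvar ⊢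
  rw [hvar, abs_neg, Finset.mul_sum]
  refine (Finset.abs_sum_le_sum_abs _ _).trans (Finset.sum_le_sum fun j _ => ?_)
  rw [Finset.sum_add_distrib]
  exact h _ _ ((hAg j).sub (hAf j)) ((hBg j).sub (hBf j))

/-- The energy of forms in the closure of the horizontal Darboux derivatives deviates at most
quadratically from the energy at a horizontal map solving the equation for `ζ`. -/
theorem exists_energy_bound [ConnectedSpace M] (hY : SmoothField Y)
    (hD : S.IsHorizontalField Y) (hdiv : ∀ x, vol.div Y x = 0)
    {f : M → Heis n} (hf : IsHorizontalMap S (standard n) f)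
    (hA : ∀ j x, subLaplacian S vol (fA f j) x = - mvfderiv (𝓡 m) (fB f j) x (Y x))
    (hB : ∀ j x, subLaplacian S vol (fB f j) x = mvfderiv (𝓡 m) (fA f j) x (Y x)) :
    ∃ (ι : Type) (_ : Fintype ι) (W : ι → VField m M) (C : ℝ), (∀ k, SmoothField (W k)) ∧
      ∀ β : LieForm1 m M 𝓘(ℝ, Heis n) (Heis n), InHorizontalClosure S vol (standard n) β →
        |energy S vol (standard n) β -
          energy S vol (standard n) (darboux m 𝓘(ℝ, Heis n) f)| ≤
        C * ∑ l, ∑ k, ∫ x, (horizCoord l (β x (W k x)) -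
            horizCoord l (darboux m 𝓘(ℝ, Heis n) f x (W k x))) ^ 2 ∂vol.μ := by
  obtain ⟨N, Z, hZ, hZD, hP⟩ := S.exists_parseval_frame
  obtain ⟨ι, hι, W, C, hW, h⟩ := exists_first_variation_bound hY hD hdiv hZ hP hf hA hB
  set α := darboux m 𝓘(ℝ, Heis n) f
  have hα : ∀ {X : VField m M}, SmoothField X → ∀ l,
      MemLp (fun x => horizCoord l (α x (X x))) 2 vol.μ := fun hX l =>
    memLp_horizCoord_darboux hf.1 hX l
  -- The fields `W` control the linear term of the energy difference and `Z` the quadratic one,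
  -- whence the constant |C| + 1/2.
  let V : ι ⊕ Fin N → VField m M := Sum.elim W Z
  refine ⟨ι ⊕ Fin N, inferInstance, V, |C| + 1 / 2, ?_, fun β hβ => ?_⟩
  · rintro (k | k)
    exacts [hW k, hZ k]
  have hβL : ∀ {X : VField m M}, SmoothField X → ∀ l,
      MemLp (fun x => horizCoord l (β x (X x))) 2 vol.μ := fun hX l => hβ.1 _ hX _
  -- The bound known for Darboux derivatives of horizontal maps involves only L²-continuous
  -- integrals, so it passes to the limit.
  have hlin : |∑ l, ∑ k, ∫ x, horizCoord l (α x (Z k x)) *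
      (horizCoord l (β x (Z k x)) - horizCoord l (α x (Z k x))) ∂vol.μ| ≤
      C * ∑ l, ∑ k, ∫ x, (horizCoord l (β x (W k x)) - horizCoord l (α x (W k x))) ^ 2 ∂vol.μ := by
    obtain ⟨-, g, hg, hlim⟩ := hβ
    have hd : ∀ {X : VField m M}, SmoothField X → ∀ l, Filter.Tendsto (fun i => eLpNorm (fun x =>
        (horizCoord l (darboux m 𝓘(ℝ, Heis n) (g i) x (X x)) - horizCoord l (α x (X x))) -
        (horizCoord l (β x (X x)) - horizCoord l (α x (X x)))) 2 vol.μ) Filter.atTop (𝓝 0) := by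
      intro X hX l
      simpa only [sub_sub_sub_cancel_right] using hlim X hX (horizCoord l)
    have hm : ∀ {X : VField m M}, SmoothField X → ∀ l i, MemLp (fun x =>
        horizCoord l (darboux m 𝓘(ℝ, Heis n) (g i) x (X x)) - horizCoord l (α x (X x))) 2 vol.μ :=
      fun hX l i => (memLp_horizCoord_darboux (hg i).1 hX l).sub (hα hX l)
    have hm' : ∀ {X : VField m M}, SmoothField X → ∀ l, MemLp (fun x =>
        horizCoord l (β x (X x)) - horizCoord l (α x (X x))) 2 vol.μ :=
      fun hX l => (hβL hX l).sub (hα hX l)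
    refine le_of_tendsto_of_tendsto' (Filter.Tendsto.abs (tendsto_finsetSum _ fun l _ =>
      tendsto_finsetSum _ fun k _ => tendsto_integral_mul (fun _ => hα (hZ k) l) (hα (hZ k) l)
        (hm (hZ k) l) (hm' (hZ k) l) (by simp) (hd (hZ k) l)))
      (Filter.Tendsto.const_mul C (tendsto_finsetSum _ fun l _ => tendsto_finsetSum _ fun k _ => ?_))
      fun i => h (g i) (hg i)
    simp only [pow_two]
    exact tendsto_integral_mul (hm (hW k) l) (hm' (hW k) l) (hm (hW k) l) (hm' (hW k) l)
      (hd (hW k) l) (hd (hW k) l)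
  have hαv : ∀ k, ∀ᵐ x ∂vol.μ, vertCoord (α x (Z k x)) = 0 := fun k =>
    .of_forall fun x => hf.2 x _ (hZD k x)
  rw [energy_eq_sum_integral hP (fun k l => hβL (hZ k) l)
    fun k => InHorizontalClosure.ae_vertCoord_eq_zero hβ (hZ k) (hZD k),
    energy_eq_sum_integral hP (fun k l => hα (hZ k) l) hαv]
  have hexp : ∀ l k, ∫ x, horizCoord l (β x (Z k x)) ^ 2 ∂vol.μ =
      ∫ x, horizCoord l (α x (Z k x)) ^ 2 ∂vol.μ +
      2 * ∫ x, horizCoord l (α x (Z k x)) *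
        (horizCoord l (β x (Z k x)) - horizCoord l (α x (Z k x))) ∂vol.μ +
      ∫ x, (horizCoord l (β x (Z k x)) - horizCoord l (α x (Z k x))) ^ 2 ∂vol.μ := by
    intro l k
    have h1 := (hα (hZ k) l).integrable_sq
    have h2 : Integrable (fun x => (horizCoord l (β x (Z k x)) - horizCoord l (α x (Z k x))) ^ 2)
      vol.μ := ((hβL (hZ k) l).sub (hα (hZ k) l)).integrable_sq
    have h3 : Integrable (fun x => 2 * (horizCoord l (α x (Z k x)) *
        (horizCoord l (β x (Z k x)) - horizCoord l (α x (Z k x))))) vol.μ :=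
      ((hα (hZ k) l).integrable_mul ((hβL (hZ k) l).sub (hα (hZ k) l))).const_mul 2
    have h4 : Integrable (fun x => horizCoord l (α x (Z k x)) ^ 2 +
        2 * (horizCoord l (α x (Z k x)) *
        (horizCoord l (β x (Z k x)) - horizCoord l (α x (Z k x))))) vol.μ := h1.add h3
    rw [← integral_const_mul, ← integral_add h1 h3, ← integral_add h4 h2]
    exact integral_congr_ae (.of_forall fun x => by ring)
  have hsplit : ∀ l, ∑ k, ∫ x, (horizCoord l (β x (V k x)) - horizCoord l (α x (V k x))) ^ 2 ∂vol.μ =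
      ∑ k, ∫ x, (horizCoord l (β x (W k x)) - horizCoord l (α x (W k x))) ^ 2 ∂vol.μ +
      ∑ k, ∫ x, (horizCoord l (β x (Z k x)) - horizCoord l (α x (Z k x))) ^ 2 ∂vol.μ := fun l =>
    Fintype.sum_sum_type _
  simp only [hexp, hsplit, Finset.sum_add_distrib, ← Finset.mul_sum]
  -- The energy difference is L + QZ/2, with |L| ≤ C · QW.
  set L := ∑ l, ∑ k, ∫ x, horizCoord l (α x (Z k x)) *
      (horizCoord l (β x (Z k x)) - horizCoord l (α x (Z k x))) ∂vol.μ
  set QW := ∑ l, ∑ k, ∫ x, (horizCoord l (β x (W k x)) - horizCoord l (α x (W k x))) ^ 2 ∂vol.μ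
  set QZ := ∑ l, ∑ k, ∫ x, (horizCoord l (β x (Z k x)) - horizCoord l (α x (Z k x))) ^ 2 ∂vol.μ
  have hQW : 0 ≤ QW := Finset.sum_nonneg fun l _ => Finset.sum_nonneg fun k _ =>
    integral_nonneg fun x => sq_nonneg _
  have hQZ : 0 ≤ QZ := Finset.sum_nonneg fun l _ => Finset.sum_nonneg fun k _ =>
    integral_nonneg fun x => sq_nonneg _
  have h1 := abs_le.1 hlin
  have h2 := mul_le_mul_of_nonneg_right (le_abs_self C) hQW
  have h3 := mul_nonneg (abs_nonneg C) hQZ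
  rw [abs_le]
  constructor <;> nlinarith

/-- The `L²` distance from the starting point grows at most linearly along a variation. -/
theorem IsVariation.integral_sq_isBigO {α : LieForm1 m M 𝓘(ℝ, Heis n) (Heis n)} {ε : ℝ}
    {a : ℝ → LieForm1 m M 𝓘(ℝ, Heis n) (Heis n)} (ha : IsVariation S vol (standard n) α ε a)
    {X : VField m M} (hX : SmoothField X) (l : GroupLieAlgebra 𝓘(ℝ, Heis n) (Heis n) →L[ℝ] ℝ) :
    (fun s => ∫ x, (l (a s x (X x)) - l (α x (X x))) ^ 2 ∂vol.μ) =O[𝓝 0] fun s : ℝ => s ^ 2 := by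
  have h0 : (0 : ℝ) ∈ Set.Ioo (-ε) ε := ⟨neg_lt_zero.2 ha.pos, ha.pos⟩
  obtain ⟨η, hη, hlim⟩ := ha.diff 0 h0
  have hlim' := hlim X hX l
  have hηL := hη X hX l
  -- Near 0 the difference quotient lies within distance 1 of the derivative η, so its norm is at
  -- most `r`.
  set r := 1 + eLpNorm (fun x => l (η x (X x))) 2 vol.μ with hr
  have hrt : r ≠ ⊤ := ENNReal.add_ne_top.2 ⟨ENNReal.one_ne_top, hηL.eLpNorm_ne_top⟩
  refine Asymptotics.IsBigO.of_bound (r.toReal ^ 2) ?_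
  have hev : ∀ᶠ s in 𝓝[≠] (0 : ℝ), eLpNorm (fun x =>
      l ((s⁻¹ • (a (0 + s) x - a 0 x)) (X x)) - l (η x (X x))) 2 vol.μ ≤ 1 :=
    (hlim'.eventually (gt_mem_nhds one_pos)).mono fun s hs => hs.le
  rw [eventually_nhdsWithin_iff] at hev
  filter_upwards [hev, Ioo_mem_nhds h0.1 h0.2] with s hs hsε
  rw [Real.norm_of_nonneg (integral_nonneg fun x => sq_nonneg _), Real.norm_of_nonneg (sq_nonneg s)]
  -- The derivative is a punctured limit; at s = 0 both sides vanish.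
  by_cases hs0 : s = 0
  · rw [hs0, ha.zero]
    simp
  · have hF : ∀ x, l ((s⁻¹ • (a (0 + s) x - a 0 x)) (X x)) =
        s⁻¹ * (l (a s x (X x)) - l (α x (X x))) := fun x => by
      rw [zero_add, ha.zero]
      simp only [smul_apply, sub_apply, map_smul, map_sub, smul_eq_mul]
    have hs' := hs hs0
    simp only [hF] at hs'
    have hFL : MemLp (fun x => s⁻¹ * (l (a s x (X x)) - l (α x (X x)))) 2 vol.μ := by
      have h1 := (ha.mem s hsε).1 X hX l
      have h2 := (ha.mem 0 h0).1 X hX l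
      rw [ha.zero] at h2
      exact (h1.sub h2).const_mul s⁻¹
    have hle : eLpNorm (fun x => s⁻¹ * (l (a s x (X x)) - l (α x (X x)))) 2 vol.μ ≤ r := by
      have h1 := eLpNorm_add_le (hFL.sub hηL).aestronglyMeasurable hηL.aestronglyMeasurable
        (one_le_two (α := ENNReal))
      rw [sub_add_cancel] at h1
      exact h1.trans (add_le_add_left hs' _)
    have h := integral_sq_le_of_eLpNorm_le hFL hrt hle
    simp only [mul_pow] at h
    rw [integral_const_mul, inv_pow, inv_mul_le_iff₀ (by positivity)] at h
    linarith

/-- Horizontal maps solving the equation for `ζ` are harmonic. -/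
theorem isHarmonic_of_equation [ConnectedSpace M] (hY : SmoothField Y)
    (hD : S.IsHorizontalField Y) (hdiv : ∀ x, vol.div Y x = 0)
    {f : M → Heis n} (hf : IsHorizontalMap S (standard n) f)
    (hA : ∀ j x, subLaplacian S vol (fA f j) x = - mvfderiv (𝓡 m) (fB f j) x (Y x))
    (hB : ∀ j x, subLaplacian S vol (fB f j) x = mvfderiv (𝓡 m) (fA f j) x (Y x)) :
    IsHarmonic S vol (standard n) f := by
  refine ⟨hf, fun ε a ha => ?_⟩
  obtain ⟨ι, hι, W, C, hW, h⟩ := exists_energy_bound hY hD hdiv hf hA hB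
  have hsum : (fun s => C * ∑ l, ∑ k, ∫ x, (horizCoord l (a s x (W k x)) -
      horizCoord l (darboux m 𝓘(ℝ, Heis n) f x (W k x))) ^ 2 ∂vol.μ) =O[𝓝 0]
      fun s : ℝ => s ^ 2 :=
    (Asymptotics.IsBigO.fun_sum fun l _ => Asymptotics.IsBigO.fun_sum fun k _ =>
      IsVariation.integral_sq_isBigO ha (hW k) (horizCoord l)).const_mul_left C
  have h0 : (0 : ℝ) ∈ Set.Ioo (-ε) ε := ⟨neg_lt_zero.2 ha.pos, ha.pos⟩
  -- A change of energy of order s² makes the energy differentiable at 0 with derivative zero, so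
  -- differentiability need not be known beforehand.
  have hE : (fun s => energy S vol (standard n) (a s) - energy S vol (standard n) (a 0)) =O[𝓝 0]
      fun s : ℝ => s ^ 2 := by
    refine Asymptotics.IsBigO.trans (Asymptotics.IsBigO.of_bound 1 ?_) hsum
    filter_upwards [Ioo_mem_nhds h0.1 h0.2] with s hs
    rw [one_mul, ha.zero, Real.norm_eq_abs]
    exact (h (a s) (ha.mem s hs)).trans (le_abs_self _)
  rw [hasDerivAt_iff_isLittleO]
  simp only [smul_zero, sub_zero]
  exact hE.trans_isLittleO (Asymptotics.isLittleO_pow_id one_lt_two)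

end Harmonic

end Heis
end
end SubRiem

theorem proposition4p6 {m n : ℕ} {M : Type*} [TopologicalSpace M]
    [ChartedSpace (EuclideanSpace ℝ (Fin m)) M] [IsManifold (𝓡 m) ∞ M] [T2Space M]
    [CompactSpace M] [SimplyConnectedSpace M] [MeasurableSpace M] [BorelSpace M]
    (S : SubRiem.SubRiemannianStructure m M) (vol : SubRiem.VolumeDensity m M)
    (nabla : SubRiem.Connection m M) (hnabla : SubRiem.IsCompatible S vol nabla)
    (f : M → SubRiem.Heis n) (hf : SubRiem.IsHorizontalMap S (SubRiem.Heis.standard n) f) :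
    SubRiem.IsNormalHarmonic S vol (SubRiem.Heis.standard n) nabla f ↔
      ∃ Y : SubRiem.VField m M, SubRiem.SmoothField Y ∧ S.IsHorizontalField Y ∧
        (∀ x, vol.div Y x = 0) ∧
        ∀ (j : Fin n) (x : M),
          SubRiem.subLaplacianC S vol (SubRiem.Heis.zeta f j) x -
            Complex.I * mvfderiv (𝓡 m) (SubRiem.Heis.zeta f j) x (Y x) = 0 := by
  have hz := fun j x v => SubRiem.Heis.zeta_equation_iff (S := S) (vol := vol) hf.1 j x v
  constructor
  · rintro ⟨-, lam, hlam, hsharp, heq⟩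
    exact SubRiem.Heis.exists_field_of_normal hnabla hf.1 hlam hsharp heq
  · rintro ⟨Y, hY, hD, hdiv, h⟩
    have hA := fun j x => ((hz j x (Y x)).1 (h j x)).1
    have hB := fun j x => ((hz j x (Y x)).1 (h j x)).2
    exact ⟨SubRiem.Heis.isHarmonic_of_equation hY hD hdiv hf hA hB,
      SubRiem.Heis.exists_multiplier hnabla hf hY hD hdiv hA hB⟩
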